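/- Let $a,b>0$. Consider the rectangular lattice graph $\Gamma$ with vertices $(i,j)\in\mathbb Z^2$, horizontal edges of length $a$ joining $(i,j)$ to $(i+1,j)$, and vertical edges of length $b$ joining $(i,j)$ to $(i,j+1)$. For real couplings $c(i,j)$ let $\mathscr H$ act in $L^2(\Gamma)$ as $-\mathrm d^2/\mathrm dx^2$ on each edge, on the functions $\psi\in L^2(\Gamma)$ that are $H^2$ on every edge, with $\psi''\in L^2(\Gamma)$, and that satisfy the $\delta$-condition at every vertex: $\psi$ is continuous there and the sum of the outgoing derivatives at $(i,j)$ equals $c(i,j)\,\psi(i,j)$. Let $\mathscr H_\gamma$ be the operator with $c\equiv\gamma$, and $\mathscr H_{\gamma,\tilde\gamma}$ the operator with $c(0,j)=\tilde\gamma$ for all $j\in\mathbb Z$ and $c(i,j)=\gamma$ for $i\ne0$ (the coupling is changed on a straight chain in the direction of the edges of length $b$). For all real $\gamma,\tilde\gamma$ the set $\sigma(\mathscr H_\gamma)$ is closed, bounded below and unbounded above, and $\sigma(\mathscr H_\gamma)\subset\sigma(\mathscr H_{\gamma,\tilde\gamma})$. So the gaps of $\sigma(\mathscr H_\gamma)$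 are the semi-infinite one $(-\infty,\inf\sigma(\mathscr H_\gamma))$ and the bounded ones $(l,u)$ above $\inf\sigma(\mathscr H_\gamma)$, with $l,u\in\sigma(\mathscr H_\gamma)$. We say that there is a new band in a gap $G$ if $G\cap\sigma(\mathscr H_{\gamma,\tilde\gamma})=G\cap[\alpha,\beta]$ for some $\alpha<\beta$ with $[\alpha,\beta]\subset\overline G$; it touches an edge of $G$ if that edge is $\alpha$ or $\beta$. (i) Let $\gamma<0$. If $\tilde\gamma<\gamma$, then $\sigma(\mathscr H_{\gamma,\tilde\gamma})$ has no point in the gaps above $\inf\sigma(\mathscr H_\gamma)$, and there is a new band, consisting of negative energies, in the gap below $\inf\sigma(\mathscr H_\gamma)$. It touches $\inf\sigma(\mathscr H_\gamma)$ for some $\tilde\gamma<\gamma$ and does not touch it for some other $\tilde\gamma<\gamma$. (ii) Let $\gamma<0$. If $\tilde\gamma>\gamma$, then $\sigma(\mathscr H_{\gamma,\tilde\gamma})$ has no point below $\inf\sigma(\mathscr H_\gamma)$, and there is a new band in every gap $(l,u)$ above $\inf\sigma(\mathscr H_\gamma)$. For each such gap the new band touches $l$ for some $\tilde\gamma>\gamma$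 and does not touch $l$ for some other $\tilde\gamma>\gamma$; it does not touch $u$ for some $\tilde\gamma>\gamma$, and if $a=b$ it touches $u$ for no $\tilde\gamma>\gamma$ (so no gap closes completely). If $a$ is not an integer multiple of $b$ (in particular $a\ne b$), there are $\gamma<0$ and $\tilde\gamma>\gamma$ for which some gap $(l,u)$ of $\sigma(\mathscr H_\gamma)$ closes completely, $(l,u)\subset\sigma(\mathscr H_{\gamma,\tilde\gamma})$; the new band then touches both edges. (iii) Let $\gamma>0$. If $\tilde\gamma<\gamma$, there is a new band in every gap of $\sigma(\mathscr H_\gamma)$, including the semi-infinite one. In the semi-infinite gap it touches $\inf\sigma(\mathscr H_\gamma)$ for some $\tilde\gamma<\gamma$ and does not touch it for some other $\tilde\gamma<\gamma$. For each bounded gap $(l,u)$ it touches $u$ for some $\tilde\gamma<\gamma$ and does not touch $u$ for some other $\tilde\gamma<\gamma$; it does not touch $l$ for some $\tilde\gamma<\gamma$, and if $a=b$ it touches $l$ for no $\tilde\gamma<\gamma$ (so no bounded gap closes completely). If $a$ is not an integer multiple of $b$, there are $\gamma>0$ and $\tilde\gamma<\gamma$ for which some bounded gap $(l,u)$ of $\sigma(\mathscr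 H_\gamma)$ closes completely, $(l,u)\subset\sigma(\mathscr H_{\gamma,\tilde\gamma})$. (iv) If $\tilde\gamma>\gamma>0$, then $\sigma(\mathscr H_{\gamma,\tilde\gamma})=\sigma(\mathscr H_\gamma)$. -/

import Mathlib

open MeasureTheory Set

namespace DeltaLattice

noncomputable section

/-- Edges of the rectangular lattice with vertex set `ℤ × ℤ`. The edge `Sum.inl (i, j)` is the
horizontal one from `(i, j)` to `(i + 1, j)`, the edge `Sum.inr (i, j)` is the vertical one from
`(i, j)` to `(i, j + 1)`. -/
abbrev Edge : Type := (ℤ × ℤ) ⊕ (ℤ × ℤ)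

/-- Horizontal edges have length `a`, vertical edges have length `b`. -/
def len (a b : ℝ) : Edge → ℝ := Sum.elim (fun _ => a) (fun _ => b)

/-- The Hilbert space `L²(Γ)`, the `ℓ²` direct sum of the spaces `L²(0, len e)` over all edges. -/
abbrev L2Graph (a b : ℝ) : Type :=
  lp (fun e : Edge => Lp ℂ 2 (volume.restrict (Ioo (0 : ℝ) (len a b e)))) 2

/-- `ψ ∈ H²(0, L)` and `-ψ'' = φ`, where `u` is the `C¹` representative of `ψ` on `[0, L]`, `v` is
the derivative of `u`, and `v` is absolutely continuous with almost everywhere derivative `-φ`. -/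
structure SolvesOnEdge (L : ℝ) (ψ φ : Lp ℂ 2 (volume.restrict (Ioo (0 : ℝ) L)))
    (u v : ℝ → ℂ) : Prop where
  repr : (ψ : ℝ → ℂ) =ᵐ[volume.restrict (Ioo (0 : ℝ) L)] u
  deriv_fun : ∀ x ∈ Icc (0 : ℝ) L, HasDerivWithinAt u (v x) (Icc 0 L) x
  deriv_deriv : ∀ x ∈ Icc (0 : ℝ) L, v x = v 0 - ∫ t in (0 : ℝ)..x, (φ : ℝ → ℂ) t

/-- The `δ`-coupling of strength `c` at the vertex `(i, j)`: the four boundary values agree, and the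
sum of the four outgoing derivatives is `c` times the common value. -/
structure DeltaCondition (a b : ℝ) (c : ℝ) (u v : Edge → ℝ → ℂ) (i j : ℤ) : Prop where
  cont_left : u (.inl (i - 1, j)) a = u (.inl (i, j)) 0
  cont_up : u (.inr (i, j)) 0 = u (.inl (i, j)) 0
  cont_down : u (.inr (i, j - 1)) b = u (.inl (i, j)) 0
  deriv_sum : v (.inl (i, j)) 0 - v (.inl (i - 1, j)) a
    + v (.inr (i, j)) 0 - v (.inr (i, j - 1)) b = (c : ℂ) * u (.inl (i, j)) 0

/-- `ψ` lies in the domain of the Hamiltonian with `δ`-couplings `c`, and the Hamiltonian maps `ψ`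
to `φ`. -/
def IsHamiltonian (a b : ℝ) (c : ℤ → ℤ → ℝ) (ψ φ : L2Graph a b) : Prop :=
  ∃ u v : Edge → ℝ → ℂ,
    (∀ e, SolvesOnEdge (len a b e) (ψ e) (φ e) (u e) (v e)) ∧
    ∀ i j, DeltaCondition a b (c i j) u v i j

theorem intervalIntegrable_of_Lp {L x : ℝ} (hx : x ∈ Icc (0 : ℝ) L)
    (φ : Lp ℂ 2 (volume.restrict (Ioo (0 : ℝ) L))) :
    IntervalIntegrable (φ : ℝ → ℂ) volume 0 x := by
  have h1 : Integrable (φ : ℝ → ℂ) (volume.restrict (Ioo (0 : ℝ) L)) :=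
    (Lp.memLp φ).integrable (by norm_num)
  have h2 : IntegrableOn (φ : ℝ → ℂ) (Ioc (0 : ℝ) L) volume :=
    (integrableOn_Ioc_iff_integrableOn_Ioo).2 h1
  rw [intervalIntegrable_iff_integrableOn_Ioc_of_le hx.1]
  exact h2.mono_set (Ioc_subset_Ioc_right hx.2)

theorem SolvesOnEdge.add {L : ℝ} {ψ₁ φ₁ ψ₂ φ₂ : Lp ℂ 2 (volume.restrict (Ioo (0 : ℝ) L))}
    {u₁ v₁ u₂ v₂ : ℝ → ℂ} (h₁ : SolvesOnEdge L ψ₁ φ₁ u₁ v₁) (h₂ : SolvesOnEdge L ψ₂ φ₂ u₂ v₂) :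
    SolvesOnEdge L (ψ₁ + ψ₂) (φ₁ + φ₂) (u₁ + u₂) (v₁ + v₂) where
  repr := (Lp.coeFn_add ψ₁ ψ₂).trans (h₁.repr.add h₂.repr)
  deriv_fun x hx := (h₁.deriv_fun x hx).add (h₂.deriv_fun x hx)
  deriv_deriv x hx := by
    have key : ∫ t in (0 : ℝ)..x, ((φ₁ + φ₂ : Lp ℂ 2 _) : ℝ → ℂ) t =
        ∫ t in (0 : ℝ)..x, ((φ₁ : ℝ → ℂ) t + (φ₂ : ℝ → ℂ) t) := by
      rw [intervalIntegral.integral_of_le hx.1, intervalIntegral.integral_of_le hx.1,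
        integral_Ioc_eq_integral_Ioo, integral_Ioc_eq_integral_Ioo]
      apply integral_congr_ae
      exact ae_restrict_of_ae_restrict_of_subset (Ioo_subset_Ioo_right hx.2)
        (Lp.coeFn_add φ₁ φ₂)
    rw [key, intervalIntegral.integral_add (intervalIntegrable_of_Lp hx φ₁)
      (intervalIntegrable_of_Lp hx φ₂), Pi.add_apply, Pi.add_apply,
      h₁.deriv_deriv x hx, h₂.deriv_deriv x hx]
    ring

theorem SolvesOnEdge.smul {L : ℝ} {ψ φ : Lp ℂ 2 (volume.restrict (Ioo (0 : ℝ) L))}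
    {u v : ℝ → ℂ} (z : ℂ) (h : SolvesOnEdge L ψ φ u v) :
    SolvesOnEdge L (z • ψ) (z • φ) (z • u) (z • v) where
  repr := (Lp.coeFn_smul z ψ).trans (h.repr.const_smul z)
  deriv_fun x hx := (h.deriv_fun x hx).const_smul z
  deriv_deriv x hx := by
    have key : ∫ t in (0 : ℝ)..x, ((z • φ : Lp ℂ 2 _) : ℝ → ℂ) t =
        ∫ t in (0 : ℝ)..x, z • (φ : ℝ → ℂ) t := by
      rw [intervalIntegral.integral_of_le hx.1, intervalIntegral.integral_of_le hx.1,
        integral_Ioc_eq_integral_Ioo, integral_Ioc_eq_integral_Ioo]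
      apply integral_congr_ae
      exact ae_restrict_of_ae_restrict_of_subset (Ioo_subset_Ioo_right hx.2)
        (Lp.coeFn_smul z φ)
    rw [key, intervalIntegral.integral_smul, Pi.smul_apply, Pi.smul_apply, h.deriv_deriv x hx,
      smul_sub]

theorem SolvesOnEdge.zero (L : ℝ) : SolvesOnEdge L 0 0 0 0 where
  repr := Lp.coeFn_zero _ _ _
  deriv_fun x _ := hasDerivWithinAt_const x _ (0 : ℂ)
  deriv_deriv x hx := by
    have key : ∫ t in (0 : ℝ)..x,
        ((0 : Lp ℂ 2 (volume.restrict (Ioo (0 : ℝ) L))) : ℝ → ℂ) t = 0 := by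
      rw [intervalIntegral.integral_of_le hx.1, integral_Ioc_eq_integral_Ioo]
      apply integral_eq_zero_of_ae
      exact ae_restrict_of_ae_restrict_of_subset (Ioo_subset_Ioo_right hx.2)
        (Lp.coeFn_zero _ _ _)
    rw [key]; simp

/-- The image of `ψ` on an edge is determined by `ψ`. -/
theorem SolvesOnEdge.eq_zero {L : ℝ} {φ : Lp ℂ 2 (volume.restrict (Ioo (0 : ℝ) L))}
    {u v : ℝ → ℂ} (h : SolvesOnEdge L 0 φ u v) : φ = 0 := by
  have hcont : ContinuousOn u (Ioo (0 : ℝ) L) := fun x hx =>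
    ((h.deriv_fun x (Ioo_subset_Icc_self hx)).continuousWithinAt).mono Ioo_subset_Icc_self
  have hu0 : EqOn u 0 (Ioo (0 : ℝ) L) :=
    Measure.eqOn_open_of_ae_eq (h.repr.symm.trans (Lp.coeFn_zero _ _ _)) isOpen_Ioo hcont
      continuousOn_const
  have hv0 : ∀ x ∈ Ioo (0 : ℝ) L, v x = 0 := fun x hx => by
    have hd : HasDerivAt u (v x) x :=
      (h.deriv_fun x (Ioo_subset_Icc_self hx)).hasDerivAt (Icc_mem_nhds hx.1 hx.2)
    have hz : HasDerivAt u 0 x :=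
      (hasDerivAt_const x (0 : ℂ)).congr_of_eventuallyEq
        (Filter.eventuallyEq_of_mem (isOpen_Ioo.mem_nhds hx) hu0)
    exact hd.unique hz
  rcases le_or_gt L 0 with hL | hL
  · apply Lp.ext
    rw [Filter.EventuallyEq, ae_restrict_iff' measurableSet_Ioo]
    exact Filter.Eventually.of_forall fun x hx => absurd (hx.1.trans hx.2) (not_lt.2 hL)
  have hint := intervalIntegrable_of_Lp (right_mem_Icc.2 hL.le) φ
  apply Lp.ext
  refine Filter.EventuallyEq.trans ?_ (Lp.coeFn_zero _ _ _).symm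
  rw [Filter.EventuallyEq, ae_restrict_iff' measurableSet_Ioo]
  filter_upwards [hint.ae_hasDerivAt_integral] with x hx hxm
  have hd := hx (by rw [uIcc_of_le hL.le]; exact Ioo_subset_Icc_self hxm) 0 left_mem_uIcc
  have hz : HasDerivAt (fun x => ∫ t in (0 : ℝ)..x, (φ : ℝ → ℂ) t) 0 x := by
    refine (hasDerivAt_const x (v 0)).congr_of_eventuallyEq
      (Filter.eventuallyEq_of_mem (isOpen_Ioo.mem_nhds hxm) fun y hy => ?_)
    have e := h.deriv_deriv y (Ioo_subset_Icc_self hy)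
    rw [hv0 y hy] at e
    exact (sub_eq_zero.1 e.symm).symm
  exact hd.unique hz

/-- The graph of the Hamiltonian. -/
def hamiltonianGraph (a b : ℝ) (c : ℤ → ℤ → ℝ) : Submodule ℂ (L2Graph a b × L2Graph a b) where
  carrier := {p | IsHamiltonian a b c p.1 p.2}
  add_mem' := by
    rintro p q ⟨u₁, v₁, h₁, d₁⟩ ⟨u₂, v₂, h₂, d₂⟩
    refine ⟨u₁ + u₂, v₁ + v₂, fun e => (h₁ e).add (h₂ e), fun i j => ⟨?_, ?_, ?_, ?_⟩⟩
    · simp [(d₁ i j).cont_left, (d₂ i j).cont_left]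
    · simp [(d₁ i j).cont_up, (d₂ i j).cont_up]
    · simp [(d₁ i j).cont_down, (d₂ i j).cont_down]
    · have e₁ := (d₁ i j).deriv_sum
      have e₂ := (d₂ i j).deriv_sum
      simp only [Pi.add_apply]
      linear_combination e₁ + e₂
  zero_mem' := ⟨0, 0, fun e => SolvesOnEdge.zero _, fun i j => ⟨by simp, by simp, by simp, by simp⟩⟩
  smul_mem' := by
    rintro z p ⟨u, v, h, d⟩
    refine ⟨z • u, z • v, fun e => (h e).smul z, fun i j => ⟨?_, ?_, ?_, ?_⟩⟩
    · simp [(d i j).cont_left]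
    · simp [(d i j).cont_up]
    · simp [(d i j).cont_down]
    · have e := (d i j).deriv_sum
      simp only [Pi.smul_apply, smul_eq_mul]
      linear_combination z * e

/-- The Hamiltonian: the negative second derivative on the edges, on the `H²` functions that satisfy
the `δ`-coupling of strength `c i j` at every vertex `(i, j)`. -/
def hamiltonian (a b : ℝ) (c : ℤ → ℤ → ℝ) : L2Graph a b →ₗ.[ℂ] L2Graph a b :=
  (hamiltonianGraph a b c).toLinearPMap

/-- The Hamiltonian does what its graph says. -/
theorem mem_graph_hamiltonian (a b : ℝ) (c : ℤ → ℤ → ℝ) (ψ φ : L2Graph a b) :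
    (ψ, φ) ∈ (hamiltonian a b c).graph ↔ IsHamiltonian a b c ψ φ := by
  rw [hamiltonian, Submodule.toLinearPMap_graph_eq]
  · rfl
  · rintro ⟨ψ, φ⟩ ⟨u, v, h, -⟩ rfl
    apply lp.ext
    funext e
    exact (h e).eq_zero

/-- `z` belongs to the resolvent set of `T`: the operator `T - z` maps the domain of `T`
bijectively onto the whole space, and the inverse is bounded. -/
def IsResolventPoint {X : Type*} [NormedAddCommGroup X] [NormedSpace ℂ X]
    (T : X →ₗ.[ℂ] X) (z : ℂ) : Prop :=
  ∃ R : X →L[ℂ] X,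
    (∀ f : X, ∃ h : R f ∈ T.domain, T ⟨R f, h⟩ - z • R f = f) ∧
    ∀ ψ : T.domain, R (T ψ - z • (ψ : X)) = ψ

/-- The spectrum of the lattice Hamiltonian with couplings `c`, as a set of real numbers. -/
def spec (a b : ℝ) (c : ℤ → ℤ → ℝ) : Set ℝ :=
  {E | ¬ IsResolventPoint (hamiltonian a b c) (E : ℂ)}

/-- `σ(H_γ)`: the coupling is `γ` at all vertices. -/
def σ₀ (a b γ : ℝ) : Set ℝ := spec a b fun _ _ => γ

/-- `σ(H_{γ,γ'})`: the coupling is `γ'` at the vertices `(0, j)`, a straight chain in the direction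
of the edges of length `b`, and `γ` at all other vertices. -/
def σ₁ (a b γ γ' : ℝ) : Set ℝ := spec a b fun i _ => if i = 0 then γ' else γ

/-- `(l, u)` is a bounded gap of `S`. -/
structure IsGap (S : Set ℝ) (l u : ℝ) : Prop where
  lt : l < u
  left_mem : l ∈ S
  right_mem : u ∈ S
  disjoint : Disjoint (Ioo l u) S

/-- The part of `S'` inside the gap `G` is one band, the trace in `G` of the nondegenerate compact
interval `[α, β]`, which may reach the endpoints of `G`. -/
structure IsNewBand (G S' : Set ℝ) (α β : ℝ) : Prop where
  lt : α < β
  subset : Icc α β ⊆ closure G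
  inter_eq : G ∩ S' = G ∩ Icc α β

end

end DeltaLattice

/-! The problem is Floquet theory along the chain combined with a one-dimensional impurity problem
across it. At an energy `E` without Dirichlet eigenfunctions on the edges (`Regular`), a solution of
`-ψ'' = E ψ` is determined by its values at the vertices, and the δ-conditions become a difference
equation (`vertexOp`). On a plane wave each direction contributes `2 (cos θ - cs) / sn`, which
ranges over `[2 lo, 2 up]`. Hence a regular `E` lies in the unperturbed spectrum iff `γ` lies
between `2 lo a + 2 lo b` and `2 up a + 2 up b` (`mem_σ₀_iff_of_regular`), while the Dirichlet
energies always belong to it.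

With the cosine `x` of the quasimomentum along the chain fixed, put `X = γ - 2 (x - cs b) / sn b`.
Off the chain the transversal recursion is `g (i + 1) + g (i - 1) = (2 cs a + sn a X) g i`. Its
bound states are `λ ^ |i|` with `|λ| < 1`, and matching on the chain requires `λ - 1/λ = sn a (γ' -
γ)`. Squared, this reads `(γ' - γ)² = (X - 2 up a) (X - 2 lo a)`; the decay forces `γ' < γ` if `γ`
lies above the dispersion and `γ' > γ` if it lies below. As `X` runs over `[γ - 2 up b, γ - 2 lo b]`
the right-hand side fills an interval, so in a gap `E` is in the perturbed spectrum iff the sign is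
right and `(γ' - γ)²` lies between an explicit minimum and maximum (`mem_σ₁_iff_above`,
`mem_σ₁_iff_below`).

The rest is monotonicity in `E`. Between Dirichlet energies `up` and `lo` strictly increase, with
`up` tending to `+∞` on the left of a Dirichlet energy and `lo` to `-∞` on the right. Therefore a
bounded gap has a Dirichlet energy at one end, and at the other end `γ / 2` is an extreme of the
dispersion (`belowGap_of_isGap`, `aboveGap_of_isGap`). At the latter end the minimum is `0` and the
maximum positive; towards the Dirichlet end both increase and the maximum is unbounded. The
condition thus selects one interval, which reaches the non-Dirichlet end exactly for small `|γ' -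
γ|`. The minimum also blows up if the Dirichlet end belongs to the edges of length `a`, which
prevents contact when `a = b`. If only the edges of length `b` are resonant, the minimum stays
bounded, and a short gap next to such an energy can be filled.

Membership in the spectrum is shown with truncated waves, whose defect stays small against their
norm; non-membership with an explicit Green operator built by functional calculus
(`isUnit_perturbed`). -/

namespace DeltaLattice

open Filter Topology
open scoped ENNReal

/-! ### Fundamental solutions on an edge, in position and in energy -/

/-- The solution of `-y'' = E y` with `y 0 = 1`, `y' 0 = 0`. -/
noncomputable def cs (E x : ℝ) : ℝ :=
  if 0 ≤ E then Real.cos (√E * x) else Real.cosh (√(-E) * x)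

/-- The solution of `-y'' = E y` with `y 0 = 0`, `y' 0 = 1`. -/
noncomputable def sn (E x : ℝ) : ℝ :=
  if 0 ≤ E then x * Real.sinc (√E * x) else x * dslope Real.sinh 0 (√(-E) * x)

theorem sn_of_pos {E : ℝ} (hE : 0 < E) (x : ℝ) : sn E x = Real.sin (√E * x) / √E := by
  have h : √E ≠ 0 := (Real.sqrt_pos.2 hE).ne'
  rcases eq_or_ne x 0 with rfl | hx
  · simp [sn]
  · rw [sn, if_pos hE.le, Real.sinc_of_ne_zero (by positivity)]
    field_simp

theorem sn_of_neg {E : ℝ} (hE : E < 0) (x : ℝ) : sn E x = Real.sinh (√(-E) * x) / √(-E) := by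
  have h : √(-E) ≠ 0 := (Real.sqrt_pos.2 (neg_pos.2 hE)).ne'
  rcases eq_or_ne x 0 with rfl | hx
  · simp [sn]
  · rw [sn, if_neg (not_le.2 hE), dslope_of_ne _ (by positivity), slope_def_field]
    simp only [Real.sinh_zero, sub_zero]
    field_simp

theorem cs_of_pos {E : ℝ} (hE : 0 < E) (x : ℝ) : cs E x = Real.cos (√E * x) := if_pos hE.le

theorem cs_of_neg {E : ℝ} (hE : E < 0) (x : ℝ) : cs E x = Real.cosh (√(-E) * x) :=
  if_neg (not_le.2 hE)

@[simp] theorem cs_energy_zero (x : ℝ) : cs 0 x = 1 := by simp [cs]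
@[simp] theorem sn_energy_zero (x : ℝ) : sn 0 x = x := by simp [sn]
@[simp] theorem cs_zero (E : ℝ) : cs E 0 = 1 := by simp [cs]
@[simp] theorem sn_zero (E : ℝ) : sn E 0 = 0 := by simp [sn]

theorem hasDerivAt_sn (E x : ℝ) : HasDerivAt (sn E) (cs E x) x := by
  rcases lt_trichotomy E 0 with hE | rfl | hE
  · have h : √(-E) ≠ 0 := (Real.sqrt_pos.2 (neg_pos.2 hE)).ne'
    have : sn E = fun x => Real.sinh (√(-E) * x) / √(-E) := funext (sn_of_neg hE)
    rw [this, cs_of_neg hE]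
    convert! (((hasDerivAt_id x).const_mul (√(-E))).sinh).div_const (√(-E)) using 1
    field_simp
    simp
  · have : sn 0 = id := funext sn_energy_zero
    rw [this, cs_energy_zero]
    exact hasDerivAt_id x
  · have h : √E ≠ 0 := (Real.sqrt_pos.2 hE).ne'
    have : sn E = fun x => Real.sin (√E * x) / √E := funext (sn_of_pos hE)
    rw [this, cs_of_pos hE]
    convert! (((hasDerivAt_id x).const_mul (√E)).sin).div_const (√E) using 1
    field_simp
    simp

theorem hasDerivAt_cs (E x : ℝ) : HasDerivAt (cs E) (-E * sn E x) x := by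
  rcases lt_trichotomy E 0 with hE | rfl | hE
  · have h : √(-E) ≠ 0 := (Real.sqrt_pos.2 (neg_pos.2 hE)).ne'
    have : cs E = fun x => Real.cosh (√(-E) * x) := funext (cs_of_neg hE)
    rw [this, sn_of_neg hE]
    convert! ((hasDerivAt_id x).const_mul (√(-E))).cosh using 1
    have h2 := Real.sq_sqrt (neg_pos.2 hE).le
    field_simp
    simp only [id]
    linear_combination (-Real.sinh (√(-E) * x)) * h2
  · have : cs 0 = fun _ => 1 := funext cs_energy_zero
    rw [this]
    simpa using hasDerivAt_const x (1 : ℝ)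
  · have h : √E ≠ 0 := (Real.sqrt_pos.2 hE).ne'
    have : cs E = fun x => Real.cos (√E * x) := funext (cs_of_pos hE)
    rw [this, sn_of_pos hE]
    convert! ((hasDerivAt_id x).const_mul (√E)).cos using 1
    have h2 := Real.sq_sqrt hE.le
    field_simp
    simp only [id]
    linear_combination (Real.sin (√E * x)) * h2

theorem continuous_cs (E : ℝ) : Continuous (cs E) :=
  continuous_iff_continuousAt.2 fun x => (hasDerivAt_cs E x).continuousAt

theorem continuous_sn (E : ℝ) : Continuous (sn E) :=
  continuous_iff_continuousAt.2 fun x => (hasDerivAt_sn E x).continuousAt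

theorem cs_sq_add (E x : ℝ) : cs E x ^ 2 + E * sn E x ^ 2 = 1 := by
  rcases lt_trichotomy E 0 with hE | rfl | hE
  · have h : √(-E) ≠ 0 := (Real.sqrt_pos.2 (neg_pos.2 hE)).ne'
    have h2 := Real.sq_sqrt (neg_pos.2 hE).le
    have h3 := hE.ne
    rw [cs_of_neg hE, sn_of_neg hE, div_pow, h2, Real.cosh_sq]
    field_simp
    ring
  · simp
  · have h2 := Real.sq_sqrt hE.le
    rw [cs_of_pos hE, sn_of_pos hE, div_pow, h2, mul_div_cancel₀ _ hE.ne']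
    exact Real.cos_sq_add_sin_sq _

theorem continuous_cs_energy (L : ℝ) : Continuous fun E => cs E L := by
  unfold cs
  refine Continuous.if_le (by fun_prop) (by fun_prop) continuous_const continuous_id ?_
  rintro E rfl
  simp

theorem continuous_sn_energy (L : ℝ) : Continuous fun E => sn E L := by
  unfold sn
  have h : Continuous (dslope Real.sinh 0) := by
    rw [continuous_iff_continuousAt]
    intro x
    rcases eq_or_ne x 0 with rfl | hx
    · exact continuousAt_dslope_same.2 Real.differentiable_sinh.differentiableAt
    · exact (continuousAt_dslope_of_ne hx).2 Real.continuous_sinh.continuousAt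
  refine Continuous.if_le ?_ ?_ continuous_const continuous_id ?_
  · exact continuous_const.mul (Real.continuous_sinc.comp (by fun_prop))
  · exact continuous_const.mul (h.comp (by fun_prop))
  · rintro E rfl
    simp

theorem hasDerivAt_cs_energy {E : ℝ} (hE : E ≠ 0) (L : ℝ) :
    HasDerivAt (fun E => cs E L) (-(L * sn E L / 2)) E := by
  rcases hE.lt_or_gt with hE | hE
  · have h : √(-E) ≠ 0 := (Real.sqrt_pos.2 (neg_pos.2 hE)).ne'
    have h1 : HasDerivAt (fun E => Real.cosh (√(-E) * L)) (-(L * sn E L / 2)) E := by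
      convert! ((((hasDerivAt_id E).neg).sqrt (by simpa using hE.ne)).mul_const L).cosh using 1
      rw [sn_of_neg hE]
      simp only [id, Pi.neg_apply]
      field_simp
    exact h1.congr_of_eventuallyEq (eventually_of_mem (Iio_mem_nhds hE) fun y hy => cs_of_neg hy L)
  · have h : √E ≠ 0 := (Real.sqrt_pos.2 hE).ne'
    have h1 : HasDerivAt (fun E => Real.cos (√E * L)) (-(L * sn E L / 2)) E := by
      convert! ((((hasDerivAt_id E)).sqrt (by simpa using hE.ne')).mul_const L).cos using 1
      rw [sn_of_pos hE]
      simp only [id]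
      field_simp
    exact h1.congr_of_eventuallyEq (eventually_of_mem (Ioi_mem_nhds hE) fun y hy => cs_of_pos hy L)

theorem hasDerivAt_sn_energy {E : ℝ} (hE : E ≠ 0) (L : ℝ) :
    HasDerivAt (fun E => sn E L) ((L * cs E L - sn E L) / (2 * E)) E := by
  rcases hE.lt_or_gt with hE | hE
  · have h : √(-E) ≠ 0 := (Real.sqrt_pos.2 (neg_pos.2 hE)).ne'
    have h0 : HasDerivAt (fun E => √(-E)) (-1 / (2 * √(-E))) E :=
      ((hasDerivAt_id E).neg).sqrt (by simpa using hE.ne)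
    have h1 : HasDerivAt (fun E => Real.sinh (√(-E) * L) / √(-E))
        ((L * cs E L - sn E L) / (2 * E)) E := by
      convert! ((h0.mul_const L).sinh).div h0 h using 1
      rw [sn_of_neg hE, cs_of_neg hE]
      have h2 := Real.sq_sqrt (neg_pos.2 hE).le
      have h3 : E = -√(-E) ^ 2 := by linarith
      generalize √(-E) = k at *
      subst h3
      field_simp
      ring
    exact h1.congr_of_eventuallyEq (eventually_of_mem (Iio_mem_nhds hE) fun y hy => sn_of_neg hy L)
  · have h : √E ≠ 0 := (Real.sqrt_pos.2 hE).ne'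
    have h0 : HasDerivAt (fun E => √E) (1 / (2 * √E)) E :=
      (hasDerivAt_id E).sqrt (by simpa using hE.ne')
    have h1 : HasDerivAt (fun E => Real.sin (√E * L) / √E)
        ((L * cs E L - sn E L) / (2 * E)) E := by
      convert! ((h0.mul_const L).sin).div h0 h using 1
      rw [sn_of_pos hE, cs_of_pos hE]
      have h2 := Real.sq_sqrt hE.le
      have h3 : E = √E ^ 2 := by linarith
      generalize √E = k at *
      subst h3
      field_simp
    exact h1.congr_of_eventuallyEq (eventually_of_mem (Ioi_mem_nhds hE) fun y hy => sn_of_pos hy L)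

theorem sn_pos_of_nonpos {E L : ℝ} (hE : E ≤ 0) (hL : 0 < L) : 0 < sn E L := by
  rcases hE.lt_or_eq with hE | rfl
  · have h : 0 < √(-E) := Real.sqrt_pos.2 (neg_pos.2 hE)
    rw [sn_of_neg hE]
    exact div_pos (Real.sinh_pos_iff.2 (by positivity)) h
  · simpa

theorem pos_of_sn_eq_zero {E L : ℝ} (hL : 0 < L) (h : sn E L = 0) : 0 < E := by
  by_contra hE
  exact (sn_pos_of_nonpos (not_lt.1 hE) hL).ne' h

theorem abs_sn_lt_of_pos {E L : ℝ} (hE : 0 < E) (hL : 0 < L) : |sn E L| < L := by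
  have h : 0 < √E := Real.sqrt_pos.2 hE
  rw [sn_of_pos hE, abs_div, abs_of_pos h, div_lt_iff₀ h, mul_comm L]
  have := Real.abs_sin_lt_abs (x := √E * L) (by positivity)
  rwa [abs_of_pos (by positivity : 0 < √E * L)] at this

theorem lt_sn_of_neg {E L : ℝ} (hE : E < 0) (hL : 0 < L) : L < sn E L := by
  have h : 0 < √(-E) := Real.sqrt_pos.2 (neg_pos.2 hE)
  rw [sn_of_neg hE, lt_div_iff₀ h, mul_comm L]
  exact Real.self_lt_sinh_iff.2 (by positivity)

theorem one_lt_cs_of_neg {E L : ℝ} (hE : E < 0) (hL : 0 < L) : 1 < cs E L := by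
  have h : 0 < √(-E) := Real.sqrt_pos.2 (neg_pos.2 hE)
  rw [cs_of_neg hE]
  exact Real.one_lt_cosh.2 (by positivity)

theorem sn_eq_zero_of_nat {L : ℝ} (hL : 0 < L) (n : ℕ) (hn : 0 < n) :
    sn ((n * Real.pi / L) ^ 2) L = 0 := by
  have : 0 < (n * Real.pi / L) := by positivity
  rw [sn_of_pos (by positivity), Real.sqrt_sq this.le, div_mul_cancel₀ _ hL.ne',
    Real.sin_nat_mul_pi, zero_div]

theorem exists_nat_of_sn_eq_zero {E L : ℝ} (hL : 0 < L) (h : sn E L = 0) :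
    ∃ n : ℕ, 0 < n ∧ √E * L = n * Real.pi := by
  have hE := pos_of_sn_eq_zero hL h
  have hs := Real.sqrt_pos.2 hE
  rw [sn_of_pos hE, div_eq_zero_iff, or_iff_left hs.ne', Real.sin_eq_zero_iff] at h
  obtain ⟨n, hn⟩ := h
  have hn0 : 0 < n := by
    have : 0 < (n : ℝ) * Real.pi := by rw [hn]; positivity
    exact_mod_cast (pos_iff_pos_of_mul_pos this).2 Real.pi_pos
  lift n to ℕ using hn0.le
  exact ⟨n, by exact_mod_cast hn0, by rw [← hn]; simp⟩

/-! ### Boundary functions of the one-edge dispersion -/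

/-- The upper end of the range of `(cos θ - cos k L) k / sin k L` over real `θ`, at
energy `k ^ 2`. -/
noncomputable def up (L E : ℝ) : ℝ := -cs E L / sn E L + 1 / |sn E L|

/-- The lower end of the range of `(cos θ - cos k L) k / sin k L` over real `θ`, at energy
`k ^ 2`. -/
noncomputable def lo (L E : ℝ) : ℝ := -cs E L / sn E L - 1 / |sn E L|

theorem lo_lt_up {L E : ℝ} (h : sn E L ≠ 0) : lo L E < up L E := by
  have : 0 < 1 / |sn E L| := by positivity
  unfold lo up
  linarith

/-- The product is `(cs² - 1) / sn²`, and `cs² + E sn² = 1`. For `E > 0` the two ends therefore have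
opposite signs, which is how `lo_neg` and `up_pos` are obtained. -/
theorem lo_mul_up {L E : ℝ} (h : sn E L ≠ 0) : lo L E * up L E = -E := by
  have h1 : lo L E * up L E = (cs E L ^ 2 - 1) / sn E L ^ 2 := by
    unfold lo up
    have : (1 / |sn E L|) ^ 2 = 1 / sn E L ^ 2 := by rw [div_pow, sq_abs, one_pow]
    field_simp at this ⊢
    linear_combination -this
  rw [h1, div_eq_iff (by positivity)]
  linear_combination cs_sq_add E L

theorem up_of_pos {L E : ℝ} (h : 0 < sn E L) : up L E = (1 - cs E L) / sn E L := by
  rw [up, abs_of_pos h]; ring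

theorem lo_of_pos {L E : ℝ} (h : 0 < sn E L) : lo L E = -(1 + cs E L) / sn E L := by
  rw [lo, abs_of_pos h]; ring

theorem up_of_neg {L E : ℝ} (h : sn E L < 0) : up L E = -(1 + cs E L) / sn E L := by
  rw [up, abs_of_neg h, one_div, inv_neg]; ring

theorem lo_of_neg {L E : ℝ} (h : sn E L < 0) : lo L E = (1 - cs E L) / sn E L := by
  rw [lo, abs_of_neg h, one_div, inv_neg]; ring

theorem lo_neg {L E : ℝ} (hL : 0 < L) (h : sn E L ≠ 0) : lo L E < 0 := by
  have h1 := lo_lt_up h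
  have h2 := lo_mul_up h
  rcases le_or_gt E 0 with hE | hE
  · have hs := sn_pos_of_nonpos hE hL
    have hc : 1 ≤ cs E L := by
      rcases hE.lt_or_eq with hE | rfl
      · exact (one_lt_cs_of_neg hE hL).le
      · simp
    rw [lo_of_pos hs]
    exact div_neg_of_neg_of_pos (by linarith) hs
  · by_contra hc
    nlinarith

theorem up_pos {L E : ℝ} (hL : 0 < L) (h : sn E L ≠ 0) (hE : 0 < E) : 0 < up L E := by
  have h1 := lo_neg hL h
  have h2 := lo_mul_up h
  by_contra hc
  nlinarith

theorem up_nonneg {L E : ℝ} (hL : 0 < L) (h : sn E L ≠ 0) (hE : 0 ≤ E) : 0 ≤ up L E := by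
  rcases hE.eq_or_lt with rfl | hE
  · rw [up_of_pos (by simpa)]; simp
  · exact (up_pos hL h hE).le

theorem continuousAt_up {L E : ℝ} (h : sn E L ≠ 0) : ContinuousAt (up L) E := by
  have h1 := (continuous_cs_energy L).continuousAt (x := E)
  have h2 := (continuous_sn_energy L).continuousAt (x := E)
  exact (h1.neg.div h2 h).add (continuousAt_const.div h2.abs (abs_ne_zero.2 h))

theorem continuousAt_lo {L E : ℝ} (h : sn E L ≠ 0) : ContinuousAt (lo L) E := by
  have h1 := (continuous_cs_energy L).continuousAt (x := E)
  have h2 := (continuous_sn_energy L).continuousAt (x := E)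
  exact (h1.neg.div h2 h).sub (continuousAt_const.div h2.abs (abs_ne_zero.2 h))

/-- On an interval without zeros of `sn · L`, the two boundary functions are strictly increasing. -/
theorem ratio_lt_of_same_side {L x y : ℝ} (hL : 0 < L) (hxy : x < y)
    (h : ∀ E ∈ Icc x y, sn E L ≠ 0) (h0 : y ≤ 0 ∨ 0 ≤ x) :
    (1 - cs x L) / sn x L < (1 - cs y L) / sn y L ∧
      -(1 + cs x L) / sn x L < -(1 + cs y L) / sn y L := by
  have hc := continuous_cs_energy L
  have hs := continuous_sn_energy L
  have hne : ∀ E ∈ Ioo x y, E ≠ 0 := by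
    rintro E ⟨h1, h2⟩ rfl
    rcases h0 with h0 | h0 <;> linarith
  have hmem : ∀ E ∈ Ioo x y, sn E L ≠ 0 := fun E hE => h E (Ioo_subset_Icc_self hE)
  -- These are the energy derivatives of the two quotients. For `E > 0` one has `|sn| < L` and `|cs|
  -- < 1`; for `E < 0` one has `sn > L` and `cs > 1`, and the sign changes in numerator and
  -- denominator compensate.
  have key : ∀ E ∈ Ioo x y, 0 < (1 - cs E L) * (L + sn E L) / (2 * E * sn E L ^ 2) ∧
      0 < (1 + cs E L) * (L - sn E L) / (2 * E * sn E L ^ 2) := by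
    intro E hE
    have hsq : 0 < sn E L ^ 2 := by have := hmem E hE; positivity
    have hid := cs_sq_add E L
    rcases (hne E hE).lt_or_gt with hE0 | hE0
    · have h1 := lt_sn_of_neg hE0 hL
      have h2 := one_lt_cs_of_neg hE0 hL
      constructor
      · exact div_pos_of_neg_of_neg (mul_neg_of_neg_of_pos (by linarith) (by linarith))
          (mul_neg_of_neg_of_pos (by linarith) hsq)
      · exact div_pos_of_neg_of_neg (mul_neg_of_pos_of_neg (by linarith) (by linarith))
          (mul_neg_of_neg_of_pos (by linarith) hsq)
    · have h1 := abs_lt.1 (abs_sn_lt_of_pos hE0 hL)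
      have h2 : cs E L ^ 2 < 1 := by nlinarith [mul_pos hE0 hsq]
      have h3 := abs_lt.1 ((sq_lt_one_iff_abs_lt_one _).1 h2)
      constructor
      · exact div_pos (mul_pos (by linarith) (by linarith)) (by positivity)
      · exact div_pos (mul_pos (by linarith) (by linarith)) (by positivity)
  have hd : ∀ E ∈ Ioo x y,
      HasDerivAt (fun E => (1 - cs E L) / sn E L)
        ((1 - cs E L) * (L + sn E L) / (2 * E * sn E L ^ 2)) E ∧
      HasDerivAt (fun E => -(1 + cs E L) / sn E L)
        ((1 + cs E L) * (L - sn E L) / (2 * E * sn E L ^ 2)) E := by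
    intro E hE
    have h1 := hasDerivAt_cs_energy (hne E hE) L
    have h2 := hasDerivAt_sn_energy (hne E hE) L
    have hid := cs_sq_add E L
    have hE0 := hne E hE
    have hS := hmem E hE
    constructor
    · convert! (h1.const_sub 1).div h2 hS using 1
      field_simp
      linear_combination (-L) * hid
    · convert! ((h1.const_add 1).neg).div h2 hS using 1
      simp only [Pi.neg_apply]
      field_simp
      linear_combination (-L) * hid
  constructor
  · refine strictMonoOn_of_deriv_pos (f := fun E => (1 - cs E L) / sn E L)
      (convex_Icc x y) ?_ ?_ (left_mem_Icc.2 hxy.le) (right_mem_Icc.2 hxy.le) hxy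
    · exact ContinuousOn.div (by fun_prop) hs.continuousOn h
    · rw [interior_Icc]
      intro E hE
      rw [(hd E hE).1.deriv]
      exact (key E hE).1
  · refine strictMonoOn_of_deriv_pos (f := fun E => -(1 + cs E L) / sn E L)
      (convex_Icc x y) ?_ ?_ (left_mem_Icc.2 hxy.le) (right_mem_Icc.2 hxy.le) hxy
    · exact ContinuousOn.div (by fun_prop) hs.continuousOn h
    · rw [interior_Icc]
      intro E hE
      rw [(hd E hE).2.deriv]
      exact (key E hE).2

/-- The derivative formulas carry a factor `1 / E`, so an interval that contains `0` is cut there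
and the two inequalities are chained. -/
theorem ratio_lt {L x y : ℝ} (hL : 0 < L) (hxy : x < y) (h : ∀ E ∈ Icc x y, sn E L ≠ 0) :
    (1 - cs x L) / sn x L < (1 - cs y L) / sn y L ∧
      -(1 + cs x L) / sn x L < -(1 + cs y L) / sn y L := by
  rcases le_or_gt y 0 with hy | hy
  · exact ratio_lt_of_same_side hL hxy h (.inl hy)
  rcases le_or_gt 0 x with hx | hx
  · exact ratio_lt_of_same_side hL hxy h (.inr hx)
  have h1 := ratio_lt_of_same_side hL hx (fun E hE => h E ⟨hE.1, hE.2.trans hy.le⟩) (.inl le_rfl)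
  have h2 := ratio_lt_of_same_side hL hy (fun E hE => h E ⟨hx.le.trans hE.1, hE.2⟩) (.inr le_rfl)
  exact ⟨h1.1.trans h2.1, h1.2.trans h2.2⟩

/-- Which of the two quotients is the upper one depends on the sign of `sn`; by the intermediate
value theorem this sign is constant on an interval without zeros. -/
theorem up_lo_lt {L x y : ℝ} (hL : 0 < L) (hxy : x < y) (h : ∀ E ∈ Icc x y, sn E L ≠ 0) :
    up L x < up L y ∧ lo L x < lo L y := by
  have hr := ratio_lt hL hxy h
  have hsign : 0 < sn x L * sn y L := by
    by_contra hc
    have hx := h x (left_mem_Icc.2 hxy.le)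
    have hy := h y (right_mem_Icc.2 hxy.le)
    have h0 : (0 : ℝ) ∈ uIcc (sn x L) (sn y L) := by
      rw [mem_uIcc]
      rcases hx.lt_or_gt with h1 | h1 <;> rcases hy.lt_or_gt with h2 | h2
      · exact absurd (mul_pos_of_neg_of_neg h1 h2) hc
      · exact .inl ⟨h1.le, h2.le⟩
      · exact .inr ⟨h2.le, h1.le⟩
      · exact absurd (mul_pos h1 h2) hc
    obtain ⟨E, hE, hE0⟩ := intermediate_value_uIcc
      (continuous_sn_energy L).continuousOn (a := x) (b := y) h0
    rw [uIcc_of_le hxy.le] at hE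
    exact h E hE hE0
  rcases pos_and_pos_or_neg_and_neg_of_mul_pos hsign with ⟨h1, h2⟩ | ⟨h1, h2⟩
  · rw [up_of_pos h1, up_of_pos h2, lo_of_pos h1, lo_of_pos h2]
    exact hr
  · rw [up_of_neg h1, up_of_neg h2, lo_of_neg h1, lo_of_neg h2]
    exact hr.symm

theorem up_lt {L x y : ℝ} (hL : 0 < L) (hxy : x < y) (h : ∀ E ∈ Icc x y, sn E L ≠ 0) :
    up L x < up L y := (up_lo_lt hL hxy h).1

theorem lo_lt {L x y : ℝ} (hL : 0 < L) (hxy : x < y) (h : ∀ E ∈ Icc x y, sn E L ≠ 0) :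
    lo L x < lo L y := (up_lo_lt hL hxy h).2

theorem tendsto_abs_sn_inv {L p : ℝ} (hp : sn p L = 0) {s : Set ℝ}
    (hne : ∀ᶠ E in 𝓝[s] p, sn E L ≠ 0) :
    Tendsto (fun E => 1 / |sn E L|) (𝓝[s] p) atTop := by
  simp only [one_div]
  refine tendsto_inv_nhdsGT_zero.comp ?_
  rw [tendsto_nhdsWithin_iff]
  constructor
  · have := ((continuous_sn_energy L).abs.tendsto p).mono_left (nhdsWithin_le_nhds (s := s))
    simpa [hp] using this
  · filter_upwards [hne] with E hE using abs_pos.2 hE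

/-- At a Dirichlet energy `cs² = 1`, so `cs · sn` has derivative `L / (2 p) > 0` there: it passes
from negative to positive. This decides on which side `up` and `lo` blow up. -/
theorem sn_sign_near {L p : ℝ} (hL : 0 < L) (hp : sn p L = 0) :
    (∀ᶠ E in 𝓝[<] p, cs E L * sn E L < 0) ∧ ∀ᶠ E in 𝓝[>] p, 0 < cs E L * sn E L := by
  have hp0 := pos_of_sn_eq_zero hL hp
  have hc : cs p L ^ 2 = 1 := by simpa [hp] using cs_sq_add p L
  have hd : HasDerivAt (fun E => cs E L * sn E L) (L / (2 * p)) p := by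
    convert! (hasDerivAt_cs_energy hp0.ne' L).mul (hasDerivAt_sn_energy hp0.ne' L) using 1
    rw [hp]
    field_simp
    linear_combination (-L) * hc
  have hpos : 0 < deriv (fun E => cs E L * sn E L) p := by rw [hd.deriv]; positivity
  have := eventually_nhdsWithin_sign_eq_of_deriv_pos hpos (by simp [hp])
  constructor
  · filter_upwards [this.filter_mono nhdsWithin_le_nhds, self_mem_nhdsWithin]
      with E hE hlt
    rw [sign_neg (sub_neg.2 hlt)] at hE
    exact sign_eq_neg_one_iff.1 hE
  · filter_upwards [this.filter_mono nhdsWithin_le_nhds, self_mem_nhdsWithin]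
      with E hE hlt
    rw [sign_pos (sub_pos.2 hlt)] at hE
    exact sign_eq_one_iff.1 hE

theorem tendsto_up_left {L p : ℝ} (hL : 0 < L) (hp : sn p L = 0) :
    Tendsto (up L) (𝓝[<] p) atTop := by
  have h1 := (sn_sign_near hL hp).1
  refine tendsto_atTop_mono' _ ?_ (tendsto_abs_sn_inv hp (h1.mono fun E hE h0 => ?_))
  · filter_upwards [h1] with E hE
    have : 0 < -cs E L / sn E L := by
      rw [neg_div, neg_pos]
      exact div_neg_iff.2 (mul_neg_iff.1 hE)
    unfold up
    linarith
  · simp [h0] at hE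

theorem tendsto_lo_right {L p : ℝ} (hL : 0 < L) (hp : sn p L = 0) :
    Tendsto (lo L) (𝓝[>] p) atBot := by
  have h1 := (sn_sign_near hL hp).2
  refine tendsto_atBot_mono' _ ?_ (tendsto_neg_atTop_atBot.comp
    (tendsto_abs_sn_inv hp (h1.mono fun E hE h0 => ?_)))
  · filter_upwards [h1] with E hE
    have : 0 < cs E L / sn E L := div_pos_iff.2 (mul_pos_iff.1 hE)
    simp only [lo, Function.comp, neg_div]
    linarith
  · simp [h0] at hE

theorem tendsto_up_atBot {L : ℝ} (hL : 0 < L) : Tendsto (up L) atBot atBot := by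
  have h1 : Tendsto (fun E : ℝ => -√(-E / 2)) atBot atBot := by
    refine tendsto_neg_atTop_atBot.comp (Real.tendsto_sqrt_atTop.comp ?_)
    exact (tendsto_neg_atBot_atTop).atTop_div_const (by norm_num)
  refine tendsto_atBot_mono' _ ?_ h1
  -- The inequality `(cs - 1) / sn ≥ √(-E / 2)` amounts to `(cs - 1)² ≥ (cs² - 1) / 2`, that is, to
  -- `cs ≥ 3`. Since `cosh² t ≥ 1 + t²`, this holds once `√(-E) L ≥ 3`.
  filter_upwards [eventually_lt_atBot 0, eventually_le_atBot (-(3 / L) ^ 2)] with E hE hE3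
  have hs := sn_pos_of_nonpos hE.le hL
  have hk : 0 < √(-E) := Real.sqrt_pos.2 (neg_pos.2 hE)
  have hc : 3 ≤ cs E L := by
    have h3 : 3 ≤ √(-E) * L := by
      rw [← div_le_iff₀ hL]
      exact Real.le_sqrt_of_sq_le (by linarith)
    rw [cs_of_neg hE]
    have h4 := Real.one_le_cosh (√(-E) * L)
    have h5 := Real.cosh_sq (√(-E) * L)
    have h6 : √(-E) * L ≤ Real.sinh (√(-E) * L) := Real.self_le_sinh_iff.2 (by positivity)
    nlinarith
  rw [up_of_pos hs, le_neg, ← neg_div, neg_sub]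
  refine Real.sqrt_le_iff.2 ⟨div_nonneg (by linarith) hs.le, ?_⟩
  rw [div_pow, le_div_iff₀ (by positivity)]
  nlinarith [cs_sq_add E L]

/-! ### Intervals cut out by two monotone functions -/

/-- A threshold `d` cuts the domain `(l, u)` of a strictly increasing function in one point `β`. -/
theorem exists_cut {l u d : ℝ} {f : ℝ → ℝ} (hlu : l < u) (hf : StrictMonoOn f (Ico l u))
    (hfc : ContinuousOn f (Ico l u)) (hl : f l < d) :
    ∃ β, l < β ∧ β ≤ u ∧ (∀ E ∈ Ico l u, f E ≤ d ↔ E ≤ β) ∧ (∀ E ∈ Ico l u, f E < d ↔ E < β) ∧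
      ((∃ E ∈ Ioo l u, d < f E) → β < u) := by
  by_cases h : ∃ E ∈ Ico l u, d ≤ f E
  · obtain ⟨E₁, hE₁, hd⟩ := h
    obtain ⟨β, hβ, hβd⟩ := intermediate_value_Icc hE₁.1
      (hfc.mono fun x hx => ⟨hx.1, hx.2.trans_lt hE₁.2⟩) ⟨hl.le, hd⟩
    have hβm : β ∈ Ico l u := ⟨hβ.1, hβ.2.trans_lt hE₁.2⟩
    refine ⟨β, lt_of_le_of_ne hβ.1 ?_, hβm.2.le, fun E hE => ?_, fun E hE => ?_, fun _ => hβm.2⟩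
    · rintro rfl; exact hl.ne hβd
    · rw [← hβd, hf.le_iff_le hE hβm]
    · rw [← hβd, hf.lt_iff_lt hE hβm]
  · push Not at h
    -- The threshold is never reached, and the cut is placed at the end `u` by convention.
    refine ⟨u, hlu, le_rfl, fun E hE => ⟨fun _ => hE.2.le, fun _ => (h E hE).le⟩,
      fun E hE => ⟨fun _ => hE.2, fun _ => h E hE⟩, ?_⟩
    rintro ⟨E, hE, hd⟩
    exact absurd hd (h E (Ioo_subset_Ico_self hE)).le.not_gt

/-- The part of `(l, u)` where `d` lies between two strictly increasing functions is an interval. -/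
theorem exists_band_of_increasing {l u d : ℝ} {f g : ℝ → ℝ} (hlu : l < u)
    (hf : StrictMonoOn f (Ico l u)) (hfc : ContinuousOn f (Ico l u))
    (hg : StrictMonoOn g (Ico l u)) (hgc : ContinuousOn g (Ico l u))
    (hfg : ∀ E ∈ Ico l u, f E < g E) (hl : f l < d) (hd : ∃ E ∈ Ioo l u, d < g E) :
    ∃ α β, l ≤ α ∧ α < β ∧ β ≤ u ∧
      (∀ E ∈ Ioo l u, (f E ≤ d ∧ d ≤ g E) ↔ (α ≤ E ∧ E ≤ β)) ∧
      (d ≤ g l → α = l) ∧ (g l < d → l < α) ∧ ((∃ E ∈ Ioo l u, d < f E) → β < u) := by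
  obtain ⟨β, h1, h2, h3, h4, h5⟩ := exists_cut hlu hf hfc hl
  have hl0 : l ∈ Ico l u := left_mem_Ico.2 hlu
  by_cases hgl : d ≤ g l
  · refine ⟨l, β, le_rfl, h1, h2, fun E hE => ?_, fun _ => rfl, fun h => absurd h hgl.not_gt, h5⟩
    have hE' := Ioo_subset_Ico_self hE
    rw [h3 E hE']
    have : g l < g E := (hg.lt_iff_lt hl0 hE').2 hE.1
    constructor
    · exact fun h => ⟨hE.1.le, h.1⟩
    · exact fun h => ⟨h.2, hgl.trans this.le⟩
  · push Not at hgl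
    obtain ⟨α, k1, k2, k3, k4, k5⟩ := exists_cut hlu hg hgc hgl
    have hα : α ∈ Ico l u := ⟨k1.le, k5 hd⟩
    have hgα : g α = d := le_antisymm ((k3 α hα).2 le_rfl)
      (not_lt.1 fun h => lt_irrefl _ ((k4 α hα).1 h))
    -- The larger function crosses `d` first: `f α < g α = d` puts `α` strictly before the crossing
    -- `β` of `f`.
    refine ⟨α, β, k1.le, (h4 α hα).1 (hgα ▸ hfg α hα), h2, fun E hE => ?_,
      fun h => absurd h hgl.not_ge, fun _ => k1, h5⟩
    have hE' := Ioo_subset_Ico_self hE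
    rw [h3 E hE', and_comm, ← not_lt, k4 E hE', not_lt]

/-- The part of `(l, u)` where `d` lies between two strictly decreasing functions is an interval. -/
theorem exists_band_of_decreasing {l u d : ℝ} {f g : ℝ → ℝ} (hlu : l < u)
    (hf : StrictAntiOn f (Ioc l u)) (hfc : ContinuousOn f (Ioc l u))
    (hg : StrictAntiOn g (Ioc l u)) (hgc : ContinuousOn g (Ioc l u))
    (hfg : ∀ E ∈ Ioc l u, f E < g E) (hu : f u < d) (hd : ∃ E ∈ Ioo l u, d < g E) :
    ∃ α β, l ≤ α ∧ α < β ∧ β ≤ u ∧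
      (∀ E ∈ Ioo l u, (f E ≤ d ∧ d ≤ g E) ↔ (α ≤ E ∧ E ≤ β)) ∧
      (d ≤ g u → β = u) ∧ (g u < d → β < u) ∧ ((∃ E ∈ Ioo l u, d < f E) → l < α) := by
  -- The reflection `x ↦ -x` reduces the claim to increasing functions.
  have hm : MapsTo (fun x : ℝ => -x) (Ico (-u) (-l)) (Ioc l u) := fun x hx =>
    ⟨by linarith [hx.2], by linarith [hx.1]⟩
  have hneg : ∀ {h : ℝ → ℝ}, StrictAntiOn h (Ioc l u) →
      StrictMonoOn (fun x => h (-x)) (Ico (-u) (-l)) := fun h x hx y hy hxy =>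
    h (hm hy) (hm hx) (neg_lt_neg hxy)
  obtain ⟨E, hE, hdE⟩ := hd
  obtain ⟨α, β, h1, h2, h3, h4, h5, h6, h7⟩ :=
    exists_band_of_increasing (l := -u) (u := -l) (d := d) (f := fun x => f (-x))
      (g := fun x => g (-x)) (neg_lt_neg hlu) (hneg hf) (hfc.comp continuous_neg.continuousOn hm)
      (hneg hg) (hgc.comp continuous_neg.continuousOn hm) (fun x hx => hfg _ (hm hx))
      (by simpa using hu) ⟨-E, ⟨by linarith [hE.2], by linarith [hE.1]⟩, by simpa using hdE⟩
  refine ⟨-β, -α, by linarith, by linarith, by linarith, fun x hx => ?_, fun h => ?_, fun h => ?_,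
    ?_⟩
  · have := h4 (-x) ⟨by linarith [hx.2], by linarith [hx.1]⟩
    rw [neg_neg] at this
    rw [this, and_comm, neg_le, le_neg]
  · linarith [h5 (by simpa using h)]
  · linarith [h6 (by simpa using h)]
  · rintro ⟨x, hx, hdx⟩
    linarith [h7 ⟨-x, ⟨by linarith [hx.2], by linarith [hx.1]⟩, by simpa using hdx⟩]

theorem IsNewBand.of_iff {l u α β : ℝ} {S' : Set ℝ} (hlu : l < u) (h1 : l ≤ α) (h2 : α < β)
    (h3 : β ≤ u) (h : ∀ E ∈ Ioo l u, E ∈ S' ↔ (α ≤ E ∧ E ≤ β)) : IsNewBand (Ioo l u) S' α β where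
  lt := h2
  subset := by
    rw [closure_Ioo hlu.ne]
    exact Icc_subset_Icc h1 h3
  inter_eq := by
    ext E
    simp only [mem_inter_iff, mem_Icc]
    exact and_congr_right fun hE => h E hE

theorem IsNewBand.Iio_of_iff {u α β : ℝ} {S' : Set ℝ} (h2 : α < β)
    (h3 : β ≤ u) (h : ∀ E < u, E ∈ S' ↔ (α ≤ E ∧ E ≤ β)) : IsNewBand (Iio u) S' α β where
  lt := h2
  subset := by
    rw [closure_Iio]
    exact fun x hx => hx.2.trans h3
  inter_eq := by
    ext E
    simp only [mem_inter_iff, mem_Icc]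
    exact and_congr_right fun hE => h E hE

/-! ### Extremes of the squared binding coupling inside a gap -/

/-- Both edges of a two-dimensional vertex dispersion are free of Dirichlet eigenvalues. -/
def Regular (a b E : ℝ) : Prop := sn E a ≠ 0 ∧ sn E b ≠ 0

/-- The extremes over the quasimomentum of the squared coupling change that binds a state at `E`
when `γ / 2` exceeds the upper end of the dispersion. -/
noncomputable def minAbove (a b γ E : ℝ) : ℝ :=
  (γ - 2 * up b E - 2 * up a E) * (γ - 2 * up b E - 2 * lo a E)

/-- See `minAbove`. -/
noncomputable def maxAbove (a b γ E : ℝ) : ℝ :=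
  (γ - 2 * lo b E - 2 * up a E) * (γ - 2 * lo b E - 2 * lo a E)

/-- The extremes over the quasimomentum of the squared coupling change that binds a state at `E`
when `γ / 2` is less than the lower end of the dispersion. -/
noncomputable def minBelow (a b γ E : ℝ) : ℝ :=
  (2 * up a E + 2 * lo b E - γ) * (2 * lo a E + 2 * lo b E - γ)

/-- See `minBelow`. -/
noncomputable def maxBelow (a b γ E : ℝ) : ℝ :=
  (2 * up a E + 2 * up b E - γ) * (2 * lo a E + 2 * up b E - γ)

section

variable {a b γ E : ℝ}

theorem minAbove_continuousAt (h : Regular a b E) : ContinuousAt (minAbove a b γ) E := by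
  have h1 := continuousAt_up h.1
  have h2 := continuousAt_lo h.1
  have h3 := continuousAt_up h.2
  unfold minAbove; fun_prop

theorem maxAbove_continuousAt (h : Regular a b E) : ContinuousAt (maxAbove a b γ) E := by
  have h1 := continuousAt_up h.1
  have h2 := continuousAt_lo h.1
  have h3 := continuousAt_lo h.2
  unfold maxAbove; fun_prop

theorem minBelow_continuousAt (h : Regular a b E) : ContinuousAt (minBelow a b γ) E := by
  have h1 := continuousAt_up h.1
  have h2 := continuousAt_lo h.1
  have h3 := continuousAt_lo h.2
  unfold minBelow; fun_prop

theorem maxBelow_continuousAt (h : Regular a b E) : ContinuousAt (maxBelow a b γ) E := by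
  have h1 := continuousAt_up h.1
  have h2 := continuousAt_lo h.1
  have h3 := continuousAt_up h.2
  unfold maxBelow; fun_prop

theorem minAbove_lt_maxAbove (h : Regular a b E) (hγ : 2 * up a E + 2 * up b E ≤ γ) :
    minAbove a b γ E < maxAbove a b γ E := by
  have h1 := lo_lt_up h.1
  have h2 := lo_lt_up h.2
  exact mul_lt_mul'' (by linarith) (by linarith) (by linarith) (by linarith)

theorem minBelow_lt_maxBelow (h : Regular a b E) (hγ : γ ≤ 2 * lo a E + 2 * lo b E) :
    minBelow a b γ E < maxBelow a b γ E := by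
  have h1 := lo_lt_up h.1
  have h2 := lo_lt_up h.2
  exact mul_lt_mul'' (by linarith) (by linarith) (by linarith) (by linarith)

/-- Both factors of each product decrease in the energy because `up` and `lo` increase, and they are
nonnegative because `γ` is not below the upper end of the dispersion at `y`. -/
theorem above_lt {x y : ℝ} (ha : 0 < a) (hb : 0 < b) (hxy : x < y)
    (h : ∀ E ∈ Icc x y, Regular a b E) (hγ : 2 * up a y + 2 * up b y ≤ γ) :
    minAbove a b γ y < minAbove a b γ x ∧ maxAbove a b γ y < maxAbove a b γ x := by
  have h1 := up_lo_lt ha hxy fun E hE => (h E hE).1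
  have h2 := up_lo_lt hb hxy fun E hE => (h E hE).2
  have hy := h y (right_mem_Icc.2 hxy.le)
  have h3 := lo_lt_up hy.1
  have h4 := lo_lt_up hy.2
  constructor <;>
  exact mul_lt_mul'' (by linarith) (by linarith) (by linarith) (by linarith)

theorem below_lt {x y : ℝ} (ha : 0 < a) (hb : 0 < b) (hxy : x < y)
    (h : ∀ E ∈ Icc x y, Regular a b E) (hγ : γ ≤ 2 * lo a x + 2 * lo b x) :
    minBelow a b γ x < minBelow a b γ y ∧ maxBelow a b γ x < maxBelow a b γ y := by
  have h1 := up_lo_lt ha hxy fun E hE => (h E hE).1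
  have h2 := up_lo_lt hb hxy fun E hE => (h E hE).2
  have hy := h x (left_mem_Icc.2 hxy.le)
  have h3 := lo_lt_up hy.1
  have h4 := lo_lt_up hy.2
  constructor <;>
  exact mul_lt_mul'' (by linarith) (by linarith) (by linarith) (by linarith)

end

/-- `(l, u)` is an interval below which the upper end of the dispersion reaches `γ / 2` at `u`. -/
structure AboveGap (a b γ l u : ℝ) : Prop where
  lt : l < u
  regular : ∀ E ∈ Ioc l u, Regular a b E
  edge : up a u + up b u = γ / 2

/-- `(l, u)` is an interval whose lower end `l` is where the lower end of the dispersion is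
`γ / 2`. -/
structure BelowGap (a b γ l u : ℝ) : Prop where
  lt : l < u
  regular : ∀ E ∈ Ico l u, Regular a b E
  edge : lo a l + lo b l = γ / 2

section

variable {a b γ l u : ℝ}

theorem AboveGap.lt_of_mem (h : AboveGap a b γ l u) (ha : 0 < a) (hb : 0 < b) {E : ℝ}
    (hE : E ∈ Ioo l u) : 2 * up a E + 2 * up b E < γ := by
  have hr : ∀ x ∈ Icc E u, Regular a b x := fun x hx => h.regular x ⟨hE.1.trans_le hx.1, hx.2⟩
  have h1 := up_lt ha hE.2 fun x hx => (hr x hx).1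
  have h2 := up_lt hb hE.2 fun x hx => (hr x hx).2
  linarith [h.edge]

theorem BelowGap.lt_of_mem (h : BelowGap a b γ l u) (ha : 0 < a) (hb : 0 < b) {E : ℝ}
    (hE : E ∈ Ioo l u) : γ < 2 * lo a E + 2 * lo b E := by
  have hr : ∀ x ∈ Icc l E, Regular a b x := fun x hx => h.regular x ⟨hx.1, hx.2.trans_lt hE.2⟩
  have h1 := lo_lt ha hE.1 fun x hx => (hr x hx).1
  have h2 := lo_lt hb hE.1 fun x hx => (hr x hx).2
  linarith [h.edge]

theorem AboveGap.le_of_mem (h : AboveGap a b γ l u) (ha : 0 < a) (hb : 0 < b) {E : ℝ}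
    (hE : E ∈ Ioc l u) : 2 * up a E + 2 * up b E ≤ γ := by
  rcases hE.2.eq_or_lt with rfl | hlt
  · linarith [h.edge]
  · exact (h.lt_of_mem ha hb ⟨hE.1, hlt⟩).le

theorem BelowGap.le_of_mem (h : BelowGap a b γ l u) (ha : 0 < a) (hb : 0 < b) {E : ℝ}
    (hE : E ∈ Ico l u) : γ ≤ 2 * lo a E + 2 * lo b E := by
  rcases hE.1.eq_or_lt with rfl | hlt
  · linarith [h.edge]
  · exact (h.lt_of_mem ha hb ⟨hlt, hE.2⟩).le

theorem AboveGap.anti (h : AboveGap a b γ l u) (ha : 0 < a) (hb : 0 < b) :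
    StrictAntiOn (minAbove a b γ) (Ioc l u) ∧ StrictAntiOn (maxAbove a b γ) (Ioc l u) :=
  ⟨fun _ hx _ hy hxy => (above_lt ha hb hxy (fun E hE => h.regular E ⟨hx.1.trans_le hE.1,
    hE.2.trans hy.2⟩) (h.le_of_mem ha hb hy)).1,
  fun _ hx _ hy hxy => (above_lt ha hb hxy (fun E hE => h.regular E ⟨hx.1.trans_le hE.1,
    hE.2.trans hy.2⟩) (h.le_of_mem ha hb hy)).2⟩

theorem BelowGap.mono (h : BelowGap a b γ l u) (ha : 0 < a) (hb : 0 < b) :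
    StrictMonoOn (minBelow a b γ) (Ico l u) ∧ StrictMonoOn (maxBelow a b γ) (Ico l u) :=
  ⟨fun _ hx _ hy hxy => (below_lt ha hb hxy (fun E hE => h.regular E ⟨hx.1.trans hE.1,
    hE.2.trans_lt hy.2⟩) (h.le_of_mem ha hb hx)).1,
  fun _ hx _ hy hxy => (below_lt ha hb hxy (fun E hE => h.regular E ⟨hx.1.trans hE.1,
    hE.2.trans_lt hy.2⟩) (h.le_of_mem ha hb hx)).2⟩

theorem AboveGap.minAbove_edge (h : AboveGap a b γ l u) : minAbove a b γ u = 0 := by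
  have : γ - 2 * up b u - 2 * up a u = 0 := by linarith [h.edge]
  rw [minAbove, this, zero_mul]

theorem BelowGap.minBelow_edge (h : BelowGap a b γ l u) : minBelow a b γ l = 0 := by
  have : 2 * lo a l + 2 * lo b l - γ = 0 := by linarith [h.edge]
  rw [minBelow, this, mul_zero]

theorem AboveGap.maxAbove_edge_pos (h : AboveGap a b γ l u) : 0 < maxAbove a b γ u := by
  rw [← h.minAbove_edge]
  exact minAbove_lt_maxAbove (h.regular u (right_mem_Ioc.2 h.lt)) (by linarith [h.edge])

theorem BelowGap.maxBelow_edge_pos (h : BelowGap a b γ l u) : 0 < maxBelow a b γ l := by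
  rw [← h.minBelow_edge]
  exact minBelow_lt_maxBelow (h.regular l (left_mem_Ico.2 h.lt)) (by linarith [h.edge])

theorem AboveGap.exists_band (h : AboveGap a b γ l u) (ha : 0 < a) (hb : 0 < b) {d : ℝ}
    (hd : 0 < d) (hmax : ∃ E ∈ Ioo l u, d < maxAbove a b γ E) :
    ∃ α β, l ≤ α ∧ α < β ∧ β ≤ u ∧
      (∀ E ∈ Ioo l u, (minAbove a b γ E ≤ d ∧ d ≤ maxAbove a b γ E) ↔ (α ≤ E ∧ E ≤ β)) ∧
      (d ≤ maxAbove a b γ u → β = u) ∧ (maxAbove a b γ u < d → β < u) ∧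
      ((∃ E ∈ Ioo l u, d < minAbove a b γ E) → l < α) :=
  exists_band_of_decreasing h.lt (h.anti ha hb).1
    (fun E hE => (minAbove_continuousAt (h.regular E hE)).continuousWithinAt) (h.anti ha hb).2
    (fun E hE => (maxAbove_continuousAt (h.regular E hE)).continuousWithinAt)
    (fun E hE => minAbove_lt_maxAbove (h.regular E hE) (h.le_of_mem ha hb hE))
    (by rwa [h.minAbove_edge]) hmax

theorem BelowGap.exists_band (h : BelowGap a b γ l u) (ha : 0 < a) (hb : 0 < b) {d : ℝ}
    (hd : 0 < d) (hmax : ∃ E ∈ Ioo l u, d < maxBelow a b γ E) :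
    ∃ α β, l ≤ α ∧ α < β ∧ β ≤ u ∧
      (∀ E ∈ Ioo l u, (minBelow a b γ E ≤ d ∧ d ≤ maxBelow a b γ E) ↔ (α ≤ E ∧ E ≤ β)) ∧
      (d ≤ maxBelow a b γ l → α = l) ∧ (maxBelow a b γ l < d → l < α) ∧
      ((∃ E ∈ Ioo l u, d < minBelow a b γ E) → β < u) :=
  exists_band_of_increasing h.lt (h.mono ha hb).1
    (fun E hE => (minBelow_continuousAt (h.regular E hE)).continuousWithinAt) (h.mono ha hb).2
    (fun E hE => (maxBelow_continuousAt (h.regular E hE)).continuousWithinAt)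
    (fun E hE => minBelow_lt_maxBelow (h.regular E hE) (h.le_of_mem ha hb hE))
    (by rwa [h.minBelow_edge]) hmax

/-- If the lower edge is a Dirichlet energy of the edges of length `a`, the smallest binding
coupling blows up there. -/
theorem AboveGap.tendsto_minAbove (h : AboveGap a b γ l u) (ha : 0 < a) (hb : 0 < b)
    (hl : sn l a = 0) : Tendsto (minAbove a b γ) (𝓝[>] l) atTop := by
  obtain ⟨x, hx⟩ := exists_between h.lt
  have hl0 := pos_of_sn_eq_zero ha hl
  have hc : 0 < γ - 2 * up b x - 2 * up a x := by linarith [h.lt_of_mem ha hb hx]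
  -- Near `l` the first factor of the minimum exceeds its positive value at the fixed point `x`,
  -- while the second is at least `-2 lo a E`, which tends to `+∞`.
  have h1 : Tendsto (fun E => (γ - 2 * up b x - 2 * up a x) * (-2 * lo a E)) (𝓝[>] l) atTop :=
    ((tendsto_lo_right ha hl).const_mul_atBot_of_neg (by norm_num)).const_mul_atTop hc
  refine tendsto_atTop_mono' _ ?_ h1
  filter_upwards [Ioo_mem_nhdsGT hx.1] with E hE
  have hEu : E ∈ Ioo l u := ⟨hE.1, hE.2.trans hx.2⟩
  have hr : ∀ y ∈ Icc E x, Regular a b y := fun y hy =>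
    h.regular y ⟨hE.1.trans_le hy.1, (hy.2.trans_lt hx.2).le⟩
  have h2 := up_lt ha hE.2 fun y hy => (hr y hy).1
  have h3 := up_lt hb hE.2 fun y hy => (hr y hy).2
  have hrE := hr E (left_mem_Icc.2 hE.2.le)
  have h4 := lo_neg ha hrE.1
  have h5 := up_pos ha hrE.1 (hl0.trans hE.1)
  have h6 := h.lt_of_mem ha hb hEu
  exact mul_le_mul (by linarith) (by linarith) (by linarith) (by linarith)

/-- Unlike the minimum, the maximum contains `lo b` in both factors, so a Dirichlet energy of either
kind of edge makes it blow up. This is why every bounded gap receives a band, however large the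
perturbation. -/
theorem AboveGap.tendsto_maxAbove (h : AboveGap a b γ l u) (ha : 0 < a) (hb : 0 < b)
    (hl : sn l a = 0 ∨ sn l b = 0) : Tendsto (maxAbove a b γ) (𝓝[>] l) atTop := by
  rcases hl with hl | hl
  · refine tendsto_atTop_mono' _ ?_ (h.tendsto_minAbove ha hb hl)
    filter_upwards [Ioo_mem_nhdsGT h.lt] with E hE
    exact (minAbove_lt_maxAbove (h.regular E (Ioo_subset_Ioc_self hE))
      (h.lt_of_mem ha hb hE).le).le
  obtain ⟨x, hx⟩ := exists_between h.lt
  have hl0 := pos_of_sn_eq_zero hb hl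
  have hc : 0 < γ - 2 * up b x - 2 * up a x := by linarith [h.lt_of_mem ha hb hx]
  have h1 : Tendsto (fun E => (γ - 2 * up b x - 2 * up a x) * (-2 * lo b E)) (𝓝[>] l) atTop :=
    ((tendsto_lo_right hb hl).const_mul_atBot_of_neg (by norm_num)).const_mul_atTop hc
  refine tendsto_atTop_mono' _ ?_ h1
  filter_upwards [Ioo_mem_nhdsGT hx.1] with E hE
  have hEu : E ∈ Ioo l u := ⟨hE.1, hE.2.trans hx.2⟩
  have hr : ∀ y ∈ Icc E x, Regular a b y := fun y hy =>
    h.regular y ⟨hE.1.trans_le hy.1, (hy.2.trans_lt hx.2).le⟩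
  have h2 := up_lt ha hE.2 fun y hy => (hr y hy).1
  have h3 := up_lt hb hE.2 fun y hy => (hr y hy).2
  have hrE := hr E (left_mem_Icc.2 hE.2.le)
  have h4 := lo_neg hb hrE.2
  have h5 := up_pos hb hrE.2 (hl0.trans hE.1)
  have h6 := h.lt_of_mem ha hb hEu
  have h7 := lo_lt_up hrE.1
  have h8 := lo_lt_up hrE.2
  have h9 := lo_neg ha hrE.1
  have h10 := up_pos ha hrE.1 (hl0.trans hE.1)
  exact mul_le_mul (by linarith) (by linarith) (by linarith) (by linarith)

theorem BelowGap.tendsto_minBelow (h : BelowGap a b γ l u) (ha : 0 < a) (hb : 0 < b)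
    (hu : sn u a = 0) : Tendsto (minBelow a b γ) (𝓝[<] u) atTop := by
  obtain ⟨x, hx⟩ := exists_between h.lt
  have hc : 0 < 2 * lo a x + 2 * lo b x - γ := by linarith [h.lt_of_mem ha hb hx]
  have h1 : Tendsto (fun E => 2 * up a E * (2 * lo a x + 2 * lo b x - γ)) (𝓝[<] u) atTop :=
    ((tendsto_up_left ha hu).const_mul_atTop (by norm_num)).atTop_mul_const hc
  refine tendsto_atTop_mono' _ ?_ h1
  filter_upwards [Ioo_mem_nhdsLT hx.2] with E hE
  have hEu : E ∈ Ioo l u := ⟨hx.1.trans hE.1, hE.2⟩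
  have hr : ∀ y ∈ Icc x E, Regular a b y := fun y hy =>
    h.regular y ⟨(hx.1.trans_le hy.1).le, hy.2.trans_lt hE.2⟩
  have h2 := lo_lt ha hE.1 fun y hy => (hr y hy).1
  have h3 := lo_lt hb hE.1 fun y hy => (hr y hy).2
  have hrE := hr E (right_mem_Icc.2 hE.1.le)
  have h4 := lo_neg ha hrE.1
  have h6 := h.lt_of_mem ha hb hEu
  have h7 := lo_lt_up hrE.1
  exact mul_le_mul (by linarith) (by linarith) (by linarith) (by linarith)

theorem BelowGap.tendsto_maxBelow (h : BelowGap a b γ l u) (ha : 0 < a) (hb : 0 < b)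
    (hu : sn u a = 0 ∨ sn u b = 0) : Tendsto (maxBelow a b γ) (𝓝[<] u) atTop := by
  rcases hu with hu | hu
  · refine tendsto_atTop_mono' _ ?_ (h.tendsto_minBelow ha hb hu)
    filter_upwards [Ioo_mem_nhdsLT h.lt] with E hE
    exact (minBelow_lt_maxBelow (h.regular E (Ioo_subset_Ico_self hE))
      (h.lt_of_mem ha hb hE).le).le
  obtain ⟨x, hx⟩ := exists_between h.lt
  have hc : 0 < 2 * lo a x + 2 * lo b x - γ := by linarith [h.lt_of_mem ha hb hx]
  have h1 : Tendsto (fun E => 2 * up b E * (2 * lo a x + 2 * lo b x - γ)) (𝓝[<] u) atTop :=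
    ((tendsto_up_left hb hu).const_mul_atTop (by norm_num)).atTop_mul_const hc
  refine tendsto_atTop_mono' _ ?_ h1
  filter_upwards [Ioo_mem_nhdsLT hx.2] with E hE
  have hEu : E ∈ Ioo l u := ⟨hx.1.trans hE.1, hE.2⟩
  have hr : ∀ y ∈ Icc x E, Regular a b y := fun y hy =>
    h.regular y ⟨(hx.1.trans_le hy.1).le, hy.2.trans_lt hE.2⟩
  have h2 := lo_lt ha hE.1 fun y hy => (hr y hy).1
  have h3 := lo_lt hb hE.1 fun y hy => (hr y hy).2
  have hrE := hr E (right_mem_Icc.2 hE.1.le)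
  have h4 := lo_neg ha hrE.1
  have h5 := lo_neg hb hrE.2
  have h6 := h.lt_of_mem ha hb hEu
  have h7 := lo_lt_up hrE.1
  have h8 := lo_lt_up hrE.2
  exact mul_le_mul (by linarith) (by linarith) (by linarith) (by linarith)

end

/-! ### Boundary value problems on one edge -/

/-- Functions on an edge of length `L`. -/
abbrev EdgeLp (L : ℝ) : Type := Lp ℂ 2 (volume.restrict (Ioo (0 : ℝ) L))

theorem memLp_edge {f : ℝ → ℂ} (hf : Continuous f) (L : ℝ) :
    MemLp f 2 (volume.restrict (Ioo (0 : ℝ) L)) := by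
  obtain ⟨C, hC⟩ := isCompact_Icc.exists_bound_of_continuousOn (hf.continuousOn (s := Icc 0 L))
  refine MemLp.of_bound hf.aestronglyMeasurable C ?_
  exact (ae_restrict_iff' measurableSet_Ioo).2
    (.of_forall fun x hx => hC x (Ioo_subset_Icc_self hx))

/-- A continuous function as an element of `L²` of an edge. -/
noncomputable def toEdge (L : ℝ) (f : ℝ → ℂ) (hf : Continuous f) : EdgeLp L :=
  (memLp_edge hf L).toLp f

theorem coeFn_toEdge (L : ℝ) {f : ℝ → ℂ} (hf : Continuous f) :
    (toEdge L f hf : ℝ → ℂ) =ᵐ[volume.restrict (Ioo (0 : ℝ) L)] f := MemLp.coeFn_toLp _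

theorem exists_norm_toEdge_le (L : ℝ) : ∃ B : ℝ, 0 ≤ B ∧ ∀ (f : ℝ → ℂ) (hf : Continuous f) (C : ℝ),
    0 ≤ C → (∀ x ∈ Icc 0 L, ‖f x‖ ≤ C) → ‖toEdge L f hf‖ ≤ B * C := by
  refine ⟨(measureUnivNNReal (volume.restrict (Ioo (0 : ℝ) L)) : ℝ) ^ (2 : ℝ≥0∞).toReal⁻¹,
    by positivity, fun f hf C hC h => Lp.norm_le_of_ae_bound hC ?_⟩
  have h1 : ∀ᵐ x ∂(volume.restrict (Ioo (0 : ℝ) L)), ‖f x‖ ≤ C :=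
    (ae_restrict_iff' measurableSet_Ioo).2 (.of_forall fun x hx => h x (Ioo_subset_Icc_self hx))
  filter_upwards [coeFn_toEdge L hf, h1] with x hx hx'
  rwa [hx]

theorem exists_integral_norm_le (L : ℝ) : ∃ B : ℝ, 0 ≤ B ∧ ∀ f : EdgeLp L,
    ∫ x in Ioo (0 : ℝ) L, ‖(f : ℝ → ℂ) x‖ ≤ B * ‖f‖ := by
  refine ⟨((volume.restrict (Ioo (0 : ℝ) L)) univ ^
      (1 / (1 : ℝ≥0∞).toReal - 1 / (2 : ℝ≥0∞).toReal)).toReal,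
    ENNReal.toReal_nonneg, fun f => ?_⟩
  have h1 := eLpNorm_le_eLpNorm_mul_rpow_measure_univ (μ := volume.restrict (Ioo (0 : ℝ) L))
    (one_le_two : (1 : ℝ≥0∞) ≤ 2) (Lp.aestronglyMeasurable f)
  have hi : Integrable (f : ℝ → ℂ) (volume.restrict (Ioo (0 : ℝ) L)) :=
    (Lp.memLp f).integrable (by norm_num)
  have h2 : ∫ x in Ioo (0 : ℝ) L, ‖(f : ℝ → ℂ) x‖ =
      (eLpNorm (f : ℝ → ℂ) 1 (volume.restrict (Ioo (0 : ℝ) L))).toReal := by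
    rw [eLpNorm_one_eq_lintegral_enorm, integral_norm_eq_lintegral_enorm hi.1]
  rw [h2, mul_comm, Lp.norm_def, ← ENNReal.toReal_mul]
  refine ENNReal.toReal_mono (ENNReal.mul_ne_top (Lp.eLpNorm_ne_top f) ?_) h1
  exact (ENNReal.rpow_lt_top_of_nonneg (by norm_num) (by simp)).ne

theorem integral_congr_edge {L x : ℝ} (hx : x ∈ Icc 0 L) {f g : ℝ → ℂ}
    (h : f =ᵐ[volume.restrict (Ioo (0 : ℝ) L)] g) :
    ∫ t in (0 : ℝ)..x, f t = ∫ t in (0 : ℝ)..x, g t := by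
  rw [intervalIntegral.integral_of_le hx.1, intervalIntegral.integral_of_le hx.1,
    integral_Ioc_eq_integral_Ioo, integral_Ioc_eq_integral_Ioo]
  exact integral_congr_ae (ae_restrict_of_ae_restrict_of_subset (Ioo_subset_Ioo_right hx.2) h)

theorem solvesOnEdge_toEdge (L : ℝ) {u v w : ℝ → ℂ} (hu : Continuous u) (hw : Continuous w)
    (h1 : ∀ x, HasDerivAt u (v x) x) (h2 : ∀ x, HasDerivAt v (-w x) x) :
    SolvesOnEdge L (toEdge L u hu) (toEdge L w hw) u v where
  repr := coeFn_toEdge L hu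
  deriv_fun x _ := (h1 x).hasDerivWithinAt
  deriv_deriv x hx := by
    rw [integral_congr_edge hx (coeFn_toEdge L hw)]
    have := intervalIntegral.integral_eq_sub_of_hasDerivAt (a := 0) (b := x) (fun t _ => h2 t)
      (hw.neg.intervalIntegrable _ _)
    rw [intervalIntegral.integral_neg] at this
    linear_combination -this

/-- `cs E` as a complex function. -/
noncomputable def csC (E x : ℝ) : ℂ := (cs E x : ℂ)

/-- `sn E` as a complex function. -/
noncomputable def snC (E x : ℝ) : ℂ := (sn E x : ℂ)

theorem hasDerivAt_csC (E x : ℝ) : HasDerivAt (csC E) (-E * snC E x) x := by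
  have := (hasDerivAt_cs E x).ofReal_comp
  unfold csC snC
  convert! this using 1
  push_cast; rfl

theorem hasDerivAt_snC (E x : ℝ) : HasDerivAt (snC E) (csC E x) x :=
  (hasDerivAt_sn E x).ofReal_comp

theorem continuous_csC (E : ℝ) : Continuous (csC E) :=
  Complex.continuous_ofReal.comp (continuous_cs E)

theorem continuous_snC (E : ℝ) : Continuous (snC E) :=
  Complex.continuous_ofReal.comp (continuous_sn E)

theorem csC_sq_add (E x : ℝ) : csC E x ^ 2 + E * snC E x ^ 2 = 1 := by
  unfold csC snC
  exact_mod_cast cs_sq_add E x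

@[simp] theorem csC_zero (E : ℝ) : csC E 0 = 1 := by simp [csC]
@[simp] theorem snC_zero (E : ℝ) : snC E 0 = 0 := by simp [snC]

theorem toEdge_smul (L : ℝ) {f : ℝ → ℂ} (hf : Continuous f) (z : ℂ)
    (hf' : Continuous fun x => z * f x) :
    toEdge L (fun x => z * f x) hf' = z • toEdge L f hf :=
  MemLp.toLp_const_smul z (memLp_edge hf L)

theorem solvesOnEdge_csC (E L : ℝ) :
    SolvesOnEdge L (toEdge L (csC E) (continuous_csC E))
      ((E : ℂ) • toEdge L (csC E) (continuous_csC E))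
      (csC E) (fun x => -E * snC E x) := by
  rw [← toEdge_smul L (continuous_csC E) E ((continuous_csC E).const_mul _)]
  refine solvesOnEdge_toEdge L _ _ (hasDerivAt_csC E) fun x => ?_
  convert! (hasDerivAt_snC E x).const_mul (-E : ℂ) using 1
  ring

theorem solvesOnEdge_snC (E L : ℝ) :
    SolvesOnEdge L (toEdge L (snC E) (continuous_snC E))
      ((E : ℂ) • toEdge L (snC E) (continuous_snC E))
      (snC E) (csC E) := by
  rw [← toEdge_smul L (continuous_snC E) E ((continuous_snC E).const_mul _)]
  refine solvesOnEdge_toEdge L _ _ (hasDerivAt_snC E) fun x => ?_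
  convert! hasDerivAt_csC E x using 1
  ring

/-- The solution of `-u'' = E u` on an edge with given Cauchy data at `0`. -/
noncomputable def cauchy (E L : ℝ) : ℂ × ℂ →ₗ[ℂ] EdgeLp L :=
  (LinearMap.toSpanSingleton ℂ _ (toEdge L (csC E) (continuous_csC E))).coprod
    (LinearMap.toSpanSingleton ℂ _ (toEdge L (snC E) (continuous_snC E)))

theorem cauchy_apply (E L : ℝ) (α β : ℂ) : cauchy E L (α, β) =
    α • toEdge L (csC E) (continuous_csC E) + β • toEdge L (snC E) (continuous_snC E) := rfl

theorem solvesOnEdge_cauchy (E L : ℝ) (α β : ℂ) :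
    SolvesOnEdge L (cauchy E L (α, β)) ((E : ℂ) • cauchy E L (α, β))
      (fun x => α * csC E x + β * snC E x) (fun x => -E * α * snC E x + β * csC E x) := by
  have := ((solvesOnEdge_csC E L).smul α).add ((solvesOnEdge_snC E L).smul β)
  rw [cauchy_apply, smul_add, smul_comm (E : ℂ) α, smul_comm (E : ℂ) β]
  convert! this using 1
  funext x
  simp only [Pi.add_apply, Pi.smul_apply, smul_eq_mul]
  ring

/-- A linear injection of the finite-dimensional space of Cauchy data is bounded below; injectivity
holds because a continuous function vanishing almost everywhere vanishes up to the end `0`, together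
with its derivative. Square-integrability on the graph thereby passes to the data at the vertices.
-/
theorem exists_norm_le_cauchy (E : ℝ) {L : ℝ} (hL : 0 < L) :
    ∃ K : ℝ, 0 ≤ K ∧ ∀ α β : ℂ, ‖α‖ ≤ K * ‖cauchy E L (α, β)‖ ∧ ‖β‖ ≤ K * ‖cauchy E L (α, β)‖ := by
  have hinj : LinearMap.ker (cauchy E L) = ⊥ := by
    rw [LinearMap.ker_eq_bot']
    rintro ⟨α, β⟩ h0
    have hs := solvesOnEdge_cauchy E L α β
    rw [h0] at hs
    have hcu : Continuous fun x => α * csC E x + β * snC E x :=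
      ((continuous_csC E).const_mul _).add ((continuous_snC E).const_mul _)
    have hcv : Continuous fun x => -E * α * snC E x + β * csC E x :=
      ((continuous_snC E).const_mul _).add ((continuous_csC E).const_mul _)
    have hu0 : EqOn (fun x => α * csC E x + β * snC E x) 0 (Ioo (0 : ℝ) L) :=
      Measure.eqOn_open_of_ae_eq (hs.repr.symm.trans (Lp.coeFn_zero _ _ _)) isOpen_Ioo
        hcu.continuousOn continuousOn_const
    have hv0 : EqOn (fun x => -E * α * snC E x + β * csC E x) 0 (Ioo (0 : ℝ) L) := fun x hx => by
      have hd := (hs.deriv_fun x (Ioo_subset_Icc_self hx)).hasDerivAt (Icc_mem_nhds hx.1 hx.2)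
      exact hd.unique ((hasDerivAt_const x (0 : ℂ)).congr_of_eventuallyEq
        (eventuallyEq_of_mem (isOpen_Ioo.mem_nhds hx) hu0))
    have hcl : (0 : ℝ) ∈ closure (Ioo (0 : ℝ) L) := by
      rw [closure_Ioo hL.ne]; exact left_mem_Icc.2 hL.le
    have h1 := hu0.closure hcu continuous_zero hcl
    have h2 := hv0.closure hcv continuous_zero hcl
    simpa using And.intro h1 h2
  obtain ⟨K, -, hK⟩ := LinearMap.exists_antilipschitzWith _ hinj
  refine ⟨K, K.2, fun α β => ?_⟩
  have := hK.le_mul_norm_sub 0 (α, β)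
  simp only [neg_zero, zero_add, map_zero] at this
  exact ⟨(norm_fst_le _).trans this, (norm_snd_le _).trans this⟩

/-- Uniqueness for the homogeneous equation on an edge. -/
theorem SolvesOnEdge.eq_cauchy {E L : ℝ} (hL : 0 < L) {ψ : EdgeLp L} {u v : ℝ → ℂ}
    (h : SolvesOnEdge L ψ ((E : ℂ) • ψ) u v) :
    ψ = cauchy E L (u 0, v 0) ∧ u L = u 0 * csC E L + v 0 * snC E L ∧
      v L = -E * u 0 * snC E L + v 0 * csC E L := by
  have hcu : ContinuousOn u (Icc 0 L) := fun x hx => (h.deriv_fun x hx).continuousWithinAt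
  have hint : ∀ x ∈ Icc 0 L, v x = v 0 - ∫ t in (0 : ℝ)..x, (E : ℂ) * u t := fun x hx => by
    rw [h.deriv_deriv x hx]
    congr 1
    refine integral_congr_edge hx ((Lp.coeFn_smul (E : ℂ) ψ).trans ?_)
    filter_upwards [h.repr] with t ht
    simp [ht]
  have hdv : ∀ x ∈ Icc 0 L, HasDerivWithinAt v (-(E * u x)) (Icc 0 L) x := by
    intro x hx
    have hc : ContinuousOn (fun t => (E : ℂ) * u t) (Icc 0 L) := continuousOn_const.mul hcu
    have : Fact (x ∈ Icc 0 L) := ⟨hx⟩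
    have h1 : HasDerivWithinAt (fun x => ∫ t in (0 : ℝ)..x, (E : ℂ) * u t) (E * u x) (Icc 0 L) x :=
      intervalIntegral.integral_hasDerivWithinAt_right
        ((hc.mono (by rw [uIcc_of_le hx.1]; exact Icc_subset_Icc_right hx.2)).intervalIntegrable)
        (hc.stronglyMeasurableAtFilter_nhdsWithin measurableSet_Icc x) (hc x hx)
    have h2 := h1.const_sub (v 0)
    exact h2.congr hint (hint x hx)
  have hds : ∀ x, HasDerivWithinAt (snC E) (csC E x) (Icc 0 L) x := fun x =>
    (hasDerivAt_snC E x).hasDerivWithinAt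
  have hdc : ∀ x, HasDerivWithinAt (csC E) (-E * snC E x) (Icc 0 L) x := fun x =>
    (hasDerivAt_csC E x).hasDerivWithinAt
  have key : ∀ f : ℝ → ℂ, (∀ x ∈ Icc 0 L, HasDerivWithinAt f 0 (Icc 0 L) x) →
      ∀ x ∈ Icc 0 L, f x = f 0 := fun f hf =>
    constant_of_derivWithin_zero (fun x hx => (hf x hx).differentiableWithinAt) fun x hx =>
      (hf x (Ico_subset_Icc_self hx)).derivWithin
        (uniqueDiffOn_Icc hL x (Ico_subset_Icc_self hx))
  -- The two constants of motion, `u cs - v sn` and `E u sn + v cs`, recover the Cauchy data at `0`.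
  have w1 := key (fun x => u x * csC E x - v x * snC E x) fun x hx => by
    convert! ((h.deriv_fun x hx).mul (hdc x)).sub ((hdv x hx).mul (hds x)) using 1
    ring
  have w2 := key (fun x => E * u x * snC E x + v x * csC E x) fun x hx => by
    convert! (((h.deriv_fun x hx).const_mul (E : ℂ)).mul (hds x)).add
      ((hdv x hx).mul (hdc x)) using 1
    ring
  simp only [csC_zero, snC_zero, mul_one, mul_zero, sub_zero, zero_add] at w1 w2
  have hu : ∀ x ∈ Icc 0 L, u x = u 0 * csC E x + v 0 * snC E x := fun x hx => by
    linear_combination csC E x * w1 x hx + snC E x * w2 x hx - u x * csC_sq_add E x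
  have hv : ∀ x ∈ Icc 0 L, v x = -E * u 0 * snC E x + v 0 * csC E x := fun x hx => by
    linear_combination -E * snC E x * w1 x hx + csC E x * w2 x hx - v x * csC_sq_add E x
  refine ⟨?_, hu L (right_mem_Icc.2 hL.le), hv L (right_mem_Icc.2 hL.le)⟩
  apply Lp.ext
  refine h.repr.trans (EventuallyEq.trans ?_ (solvesOnEdge_cauchy E L (u 0) (v 0)).repr.symm)
  exact (ae_restrict_iff' measurableSet_Ioo).2
    (.of_forall fun x hx => hu x (Ioo_subset_Icc_self hx))

theorem norm_primitive_le {f : ℝ → ℂ} {C L x : ℝ} (hC : ∀ t ∈ Icc 0 L, ‖f t‖ ≤ C)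
    (hx : x ∈ Icc 0 L) : ‖∫ t in (0 : ℝ)..x, f t‖ ≤ C * L := by
  have h0 : 0 ≤ C := (norm_nonneg _).trans (hC x hx)
  have h := intervalIntegral.norm_integral_le_of_norm_le_const (a := 0) (b := x) (f := f) (C := C)
    fun t ht => by
      rw [uIoc_of_le hx.1] at ht
      exact hC t ⟨ht.1.le, ht.2.trans hx.2⟩
  rw [sub_zero, abs_of_nonneg hx.1] at h
  exact h.trans (mul_le_mul_of_nonneg_left hx.2 h0)

theorem hasDerivAt_primitive {f : ℝ → ℂ} (hf : Continuous f) (x : ℝ) :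
    HasDerivAt (fun x => ∫ t in (0 : ℝ)..x, f t) (f x) x :=
  intervalIntegral.integral_hasDerivAt_right (hf.intervalIntegrable _ _)
    hf.stronglyMeasurable.stronglyMeasurableAtFilter hf.continuousAt

/-- Solvability of the inhomogeneous equation with zero Cauchy data, for a continuous right-hand
side. -/
theorem exists_forced_solution (E : ℝ) {r : ℝ → ℂ} (hr : Continuous r) :
    ∃ y w : ℝ → ℂ, (∀ x, HasDerivAt y (w x) x) ∧ (∀ x, HasDerivAt w (-E * y x + r x) x) ∧
      y 0 = 0 ∧ w 0 = 0 ∧ ∀ L M C : ℝ, 0 ≤ L → 0 ≤ C → (∀ x ∈ Icc 0 L, ‖csC E x‖ ≤ M) →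
        (∀ x ∈ Icc 0 L, ‖snC E x‖ ≤ M) → (∀ x ∈ Icc 0 L, ‖r x‖ ≤ C) →
        ∀ x ∈ Icc 0 L, ‖y x‖ ≤ 2 * M ^ 2 * L * C ∧ ‖w x‖ ≤ (1 + |E|) * M ^ 2 * L * C := by
  have hc := (continuous_csC E).mul hr
  have hs := (continuous_snC E).mul hr
  -- Variation of constants: `y = sn ∫ cs r - cs ∫ sn r`.
  set Jc : ℝ → ℂ := fun x => ∫ t in (0 : ℝ)..x, csC E t * r t with hJc
  set Js : ℝ → ℂ := fun x => ∫ t in (0 : ℝ)..x, snC E t * r t with hJs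
  have dc : ∀ x, HasDerivAt Jc (csC E x * r x) x := hasDerivAt_primitive hc
  have ds : ∀ x, HasDerivAt Js (snC E x * r x) x := hasDerivAt_primitive hs
  refine ⟨fun x => snC E x * Jc x - csC E x * Js x, fun x => csC E x * Jc x + E * snC E x * Js x,
    fun x => ?_, fun x => ?_, by simp [hJc, hJs], by simp [hJc, hJs], ?_⟩
  · convert! ((hasDerivAt_snC E x).mul (dc x)).sub ((hasDerivAt_csC E x).mul (ds x)) using 1
    ring
  · convert! ((hasDerivAt_csC E x).mul (dc x)).add
      (((hasDerivAt_snC E x).const_mul (E : ℂ)).mul (ds x)) using 1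
    linear_combination (-r x) * csC_sq_add E x
  · intro L M C hL hC hMc hMs hCr x hx
    have hM : 0 ≤ M := (norm_nonneg _).trans (hMc x hx)
    have b1 : ‖Jc x‖ ≤ M * C * L := norm_primitive_le (fun t ht => by
      rw [norm_mul]
      exact mul_le_mul (hMc t ht) (hCr t ht) (norm_nonneg _) hM) hx
    have b2 : ‖Js x‖ ≤ M * C * L := norm_primitive_le (fun t ht => by
      rw [norm_mul]
      exact mul_le_mul (hMs t ht) (hCr t ht) (norm_nonneg _) hM) hx
    have p1 : ‖snC E x * Jc x‖ ≤ M * (M * C * L) := by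
      rw [norm_mul]; exact mul_le_mul (hMs x hx) b1 (norm_nonneg _) hM
    have p2 : ‖csC E x * Js x‖ ≤ M * (M * C * L) := by
      rw [norm_mul]; exact mul_le_mul (hMc x hx) b2 (norm_nonneg _) hM
    have p3 : ‖csC E x * Jc x‖ ≤ M * (M * C * L) := by
      rw [norm_mul]; exact mul_le_mul (hMc x hx) b1 (norm_nonneg _) hM
    have p4 : ‖E * snC E x * Js x‖ ≤ |E| * (M * (M * C * L)) := by
      rw [mul_assoc, norm_mul, norm_mul, Complex.norm_real, Real.norm_eq_abs]
      exact mul_le_mul_of_nonneg_left (mul_le_mul (hMs x hx) b2 (norm_nonneg _) hM) (abs_nonneg _)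
    constructor
    · refine (norm_sub_le _ _).trans ((add_le_add p1 p2).trans_eq ?_)
      ring
    · refine (norm_add_le _ _).trans ((add_le_add p3 p4).trans_eq ?_)
      ring

/-- Solvability of the inhomogeneous equation with zero Cauchy data, with bounds. -/
theorem exists_particular_solution (E : ℝ) {L : ℝ} (hL : 0 < L) :
    ∃ B : ℝ, 0 ≤ B ∧ ∀ f : EdgeLp L, ∃ (ψ : EdgeLp L) (u v : ℝ → ℂ),
      SolvesOnEdge L ψ ((E : ℂ) • ψ + f) u v ∧ u 0 = 0 ∧ v 0 = 0 ∧
      ‖u L‖ ≤ B * ‖f‖ ∧ ‖v L‖ ≤ B * ‖f‖ ∧ ‖ψ‖ ≤ B * ‖f‖ := by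
  obtain ⟨B₁, hB₁, hnorm⟩ := exists_norm_toEdge_le L
  obtain ⟨B₂, hB₂, hint⟩ := exists_integral_norm_le L
  obtain ⟨M₁, hM₁⟩ := isCompact_Icc.exists_bound_of_continuousOn
    ((continuous_csC E).continuousOn (s := Icc 0 L))
  obtain ⟨M₂, hM₂⟩ := isCompact_Icc.exists_bound_of_continuousOn
    ((continuous_snC E).continuousOn (s := Icc 0 L))
  set M := max M₁ M₂
  have hMc : ∀ x ∈ Icc 0 L, ‖csC E x‖ ≤ M := fun x hx => (hM₁ x hx).trans (le_max_left _ _)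
  have hMs : ∀ x ∈ Icc 0 L, ‖snC E x‖ ≤ M := fun x hx => (hM₂ x hx).trans (le_max_right _ _)
  set D := 2 * M ^ 2 * L * (|E| * L) + L with hD
  set D' := (1 + |E|) * M ^ 2 * L * (|E| * L) + 1 with hD'
  have hD0 : 0 ≤ D := by positivity
  have hD0' : 0 ≤ D' := by positivity
  refine ⟨(D + D' + B₁ * D) * B₂, by positivity, fun f => ?_⟩
  set N := B₂ * ‖f‖ with hN
  have hN0 : 0 ≤ N := by positivity
  set g : ℝ → ℂ := (Ioo (0 : ℝ) L).indicator f with hg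
  have hfi : IntegrableOn (f : ℝ → ℂ) (Ioo (0 : ℝ) L) := (Lp.memLp f).integrable (by norm_num)
  have hgi : Integrable g := hfi.integrable_indicator measurableSet_Ioo
  have hgf : g =ᵐ[volume.restrict (Ioo (0 : ℝ) L)] f := indicator_ae_eq_restrict measurableSet_Ioo
  set h₁ : ℝ → ℂ := fun x => ∫ t in (0 : ℝ)..x, g t with hh₁
  have hc₁ : Continuous h₁ := intervalIntegral.continuous_primitive
    (fun _ _ => hgi.intervalIntegrable) 0
  set h₂ : ℝ → ℂ := fun x => ∫ t in (0 : ℝ)..x, h₁ t with hh₂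
  have hd₂ : ∀ x, HasDerivAt h₂ (h₁ x) x := hasDerivAt_primitive hc₁
  have hc₂ : Continuous h₂ := continuous_iff_continuousAt.2 fun x => (hd₂ x).continuousAt
  have b₁ : ∀ x ∈ Icc 0 L, ‖h₁ x‖ ≤ N := fun x hx => by
    refine (intervalIntegral.norm_integral_le_integral_norm hx.1).trans ?_
    rw [intervalIntegral.integral_of_le hx.1]
    refine (setIntegral_le_integral hgi.norm (.of_forall fun _ => norm_nonneg _)).trans ?_
    refine le_trans (le_of_eq ?_) (hint f)
    rw [← integral_indicator measurableSet_Ioo]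
    congr 1
    funext t
    simp only [hg, norm_indicator_eq_indicator_norm]
  have b₂ : ∀ x ∈ Icc 0 L, ‖h₂ x‖ ≤ N * L := fun x hx => norm_primitive_le b₁ hx
  -- The right-hand side `f` is only square integrable. Subtracting its double primitive `h₂` leaves
  -- `y'' + E y = E h₂` with a continuous right-hand side, and then `u = y - h₂` satisfies `-u'' = E
  -- u + f`.
  obtain ⟨y, w, hy, hw, hy0, hw0, hb⟩ := exists_forced_solution E (r := fun x => E * h₂ x)
    (hc₂.const_mul _)
  have hyb := hb L M (|E| * (N * L)) hL.le (by positivity) hMc hMs fun x hx => by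
    rw [norm_mul, Complex.norm_real, Real.norm_eq_abs]
    exact mul_le_mul_of_nonneg_left (b₂ x hx) (abs_nonneg _)
  have hcu : Continuous fun x => y x - h₂ x :=
    (continuous_iff_continuousAt.2 fun x => (hy x).continuousAt).sub hc₂
  have hub : ∀ x ∈ Icc 0 L, ‖y x - h₂ x‖ ≤ D * N := fun x hx => by
    refine (norm_sub_le _ _).trans ((add_le_add (hyb x hx).1 (b₂ x hx)).trans_eq ?_)
    rw [hD]; ring
  have hvb : ∀ x ∈ Icc 0 L, ‖w x - h₁ x‖ ≤ D' * N := fun x hx => by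
    refine (norm_sub_le _ _).trans ((add_le_add (hyb x hx).2 (b₁ x hx)).trans_eq ?_)
    rw [hD']; ring
  have hLm : L ∈ Icc 0 L := right_mem_Icc.2 hL.le
  have e1 : D * N ≤ (D + D' + B₁ * D) * B₂ * ‖f‖ := by
    rw [mul_assoc, ← hN]
    exact mul_le_mul_of_nonneg_right (by nlinarith [mul_nonneg hB₁ hD0]) hN0
  have e2 : D' * N ≤ (D + D' + B₁ * D) * B₂ * ‖f‖ := by
    rw [mul_assoc, ← hN]
    exact mul_le_mul_of_nonneg_right (by nlinarith [mul_nonneg hB₁ hD0]) hN0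
  have e3 : B₁ * (D * N) ≤ (D + D' + B₁ * D) * B₂ * ‖f‖ := by
    rw [mul_assoc _ B₂, ← hN, ← mul_assoc]
    exact mul_le_mul_of_nonneg_right (by nlinarith [mul_nonneg hB₁ hD0]) hN0
  refine ⟨toEdge L _ hcu, fun x => y x - h₂ x, fun x => w x - h₁ x, ⟨coeFn_toEdge L hcu,
    fun x _ => ((hy x).sub (hd₂ x)).hasDerivWithinAt, fun x hx => ?_⟩, by simp [hy0, hh₂],
    by simp [hw0, hh₁], (hub L hLm).trans e1, (hvb L hLm).trans e2,
    (hnorm _ hcu _ (by positivity) hub).trans e3⟩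
  have hφ : (((E : ℂ) • toEdge L _ hcu + f : EdgeLp L) : ℝ → ℂ)
      =ᵐ[volume.restrict (Ioo (0 : ℝ) L)] fun t => E * (y t - h₂ t) + g t := by
    filter_upwards [Lp.coeFn_add ((E : ℂ) • toEdge L _ hcu) f,
      Lp.coeFn_smul (E : ℂ) (toEdge L _ hcu),
      coeFn_toEdge L hcu, hgf] with t h1 h2 h3 h4
    simp only [h1, Pi.add_apply, h2, Pi.smul_apply, h3, h4, smul_eq_mul]
  rw [integral_congr_edge hx hφ, intervalIntegral.integral_add
    ((hcu.const_mul _).intervalIntegrable _ _) hgi.intervalIntegrable]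
  have hint2 := intervalIntegral.integral_eq_sub_of_hasDerivAt (a := 0) (b := x)
    (f := fun x => w x) (f' := fun x => -(E * (y x - h₂ x)))
    (fun t _ => by convert! hw t using 1; ring) ((hcu.const_mul _).neg.intervalIntegrable _ _)
  rw [intervalIntegral.integral_neg, hw0] at hint2
  have h10 : h₁ 0 = 0 := by simp [hh₁]
  rw [hw0, h10]
  linear_combination -hint2

/-! ### Square sums with values in `[0, ∞]`, free of summability conditions -/

section Energy

variable {ι κ : Type*} {X Y : ι → Type*} [∀ i, NormedAddCommGroup (X i)]
  [∀ i, NormedAddCommGroup (Y i)]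

/-- The sum of the squared norms of a family. -/
noncomputable def energy (x : ∀ i, X i) : ℝ≥0∞ := ∑' i, ENNReal.ofReal (‖x i‖ ^ 2)

theorem memℓp_iff_energy {x : ∀ i, X i} : Memℓp x 2 ↔ energy x ≠ ⊤ := by
  have h2 : (0 : ℝ) < (2 : ℝ≥0∞).toReal := by norm_num
  rw [memℓp_gen_iff h2]
  simp only [ENNReal.toReal_ofNat, Real.rpow_ofNat]
  constructor
  · intro h
    unfold energy
    rw [← ENNReal.ofReal_tsum_of_nonneg (fun i => by positivity) h]
    exact ENNReal.ofReal_ne_top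
  · intro h
    have := ENNReal.summable_toReal h
    refine this.congr fun i => ?_
    rw [ENNReal.toReal_ofReal (by positivity)]

theorem energy_coe (x : lp X 2) : energy (x : ∀ i, X i) = ENNReal.ofReal (‖x‖ ^ 2) := by
  have h2 : (0 : ℝ) < (2 : ℝ≥0∞).toReal := by norm_num
  have h := lp.hasSum_norm h2 x
  simp only [ENNReal.toReal_ofNat, Real.rpow_ofNat] at h
  rw [energy, ← ENNReal.ofReal_tsum_of_nonneg (fun i => by positivity) h.summable, h.tsum_eq]

theorem energy_ne_top (x : lp X 2) : energy (x : ∀ i, X i) ≠ ⊤ := by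
  rw [energy_coe]
  exact ENNReal.ofReal_ne_top

/-- A square-summable family as an element of `ℓ²`. -/
def ofEnergy (x : ∀ i, X i) (hx : energy x ≠ ⊤) : lp X 2 := ⟨x, memℓp_iff_energy.2 hx⟩

theorem energy_mono {x : ∀ i, X i} {y : ∀ i, Y i} (h : ∀ i, ‖x i‖ ≤ ‖y i‖) :
    energy x ≤ energy y :=
  ENNReal.tsum_le_tsum fun i => ENNReal.ofReal_le_ofReal (pow_le_pow_left₀ (norm_nonneg _) (h i) 2)

theorem energy_le_of_le {x : ∀ i, X i} {y : ∀ i, Y i} {B : ℝ}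
    (h : ∀ i, ‖x i‖ ≤ B * ‖y i‖) : energy x ≤ ENNReal.ofReal (B ^ 2) * energy y := by
  unfold energy
  rw [← ENNReal.tsum_mul_left]
  refine ENNReal.tsum_le_tsum fun i => ?_
  rw [← ENNReal.ofReal_mul (sq_nonneg B), ← mul_pow]
  exact ENNReal.ofReal_le_ofReal (pow_le_pow_left₀ (norm_nonneg _) (h i) 2)

theorem energy_le_add {x : ∀ i, X i} {p q : ι → ℝ} (h : ∀ i, ‖x i‖ ≤ p i + q i) :
    energy x ≤ 2 * energy p + 2 * energy q := by
  unfold energy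
  rw [← ENNReal.tsum_mul_left, ← ENNReal.tsum_mul_left, ← ENNReal.tsum_add]
  refine ENNReal.tsum_le_tsum fun i => ?_
  have e : (2 : ℝ≥0∞) = ENNReal.ofReal 2 := by simp
  rw [e, ← ENNReal.ofReal_mul (by norm_num), ← ENNReal.ofReal_mul (by norm_num),
    ← ENNReal.ofReal_add (by positivity) (by positivity)]
  refine ENNReal.ofReal_le_ofReal ?_
  simp only [Real.norm_eq_abs, sq_abs]
  nlinarith [norm_nonneg (x i), h i, sq_nonneg (p i - q i)]

theorem energy_norm_mul (B : ℝ) (x : ∀ i, X i) :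
    energy (fun i => B * ‖x i‖) = ENNReal.ofReal (B ^ 2) * energy x := by
  unfold energy
  rw [← ENNReal.tsum_mul_left]
  refine tsum_congr fun i => ?_
  rw [← ENNReal.ofReal_mul (sq_nonneg B), norm_mul, norm_norm, Real.norm_eq_abs, mul_pow, sq_abs]

theorem energy_add_le (x y : ∀ i, X i) :
    energy (fun i => x i + y i) ≤ 2 * energy x + 2 * energy y := by
  have := energy_le_add (x := fun i => x i + y i) (p := fun i => 1 * ‖x i‖)
    (q := fun i => 1 * ‖y i‖) fun i => by simpa using norm_add_le (x i) (y i)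
  rw [energy_norm_mul, energy_norm_mul] at this
  simpa using this

theorem energy_neg (x : ∀ i, X i) : energy (fun i => -x i) = energy x := by simp [energy]

theorem energy_comp_equiv {Z : Type*} [NormedAddCommGroup Z] (e : ι ≃ κ) (x : κ → Z) :
    energy (fun i => x (e i)) = energy x :=
  e.tsum_eq fun k => ENNReal.ofReal (‖x k‖ ^ 2)

theorem energy_sum {Z : ι ⊕ κ → Type*} [∀ i, NormedAddCommGroup (Z i)] (x : ∀ i, Z i) :
    energy x = energy (fun i => x (.inl i)) + energy (fun i => x (.inr i)) :=
  Summable.tsum_sum (f := fun i => ENNReal.ofReal (‖x i‖ ^ 2)) ENNReal.summable ENNReal.summable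

theorem energy_eq_zero {x : ∀ i, X i} : energy x = 0 ↔ ∀ i, x i = 0 := by
  rw [energy, ENNReal.tsum_eq_zero]
  refine forall_congr' fun i => ?_
  rw [ENNReal.ofReal_eq_zero]
  constructor
  · intro h
    have : ‖x i‖ ^ 2 = 0 := le_antisymm h (by positivity)
    simpa using this
  · rintro h
    simp [h]

end Energy

theorem exists_norm_cauchy_le (E L : ℝ) : ∃ B : ℝ, 0 ≤ B ∧ ∀ α β : ℂ,
    ‖cauchy E L (α, β)‖ ≤ B * (‖α‖ + ‖β‖) := by
  refine ⟨‖toEdge L (csC E) (continuous_csC E)‖ + ‖toEdge L (snC E) (continuous_snC E)‖,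
    by positivity, fun α β => ?_⟩
  rw [cauchy_apply]
  refine (norm_add_le _ _).trans ?_
  rw [norm_smul, norm_smul]
  nlinarith [norm_nonneg α, norm_nonneg β, norm_nonneg (toEdge L (csC E) (continuous_csC E)),
    norm_nonneg (toEdge L (snC E) (continuous_snC E)),
    mul_nonneg (norm_nonneg α) (norm_nonneg (toEdge L (snC E) (continuous_snC E))),
    mul_nonneg (norm_nonneg β) (norm_nonneg (toEdge L (csC E) (continuous_csC E)))]

/-! ### Resolvent points and a priori bounds -/

section Resolvent

variable {a b : ℝ} {c : ℤ → ℤ → ℝ} {E : ℝ}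

theorem exists_bound_of_isResolventPoint (h : IsResolventPoint (hamiltonian a b c) (E : ℂ)) :
    ∃ C : ℝ, 0 ≤ C ∧ ∀ ψ φ : L2Graph a b, IsHamiltonian a b c ψ φ →
      ‖ψ‖ ≤ C * ‖φ - (E : ℂ) • ψ‖ := by
  obtain ⟨R, -, hR⟩ := h
  refine ⟨‖R‖, norm_nonneg _, fun ψ φ hψ => ?_⟩
  rw [← mem_graph_hamiltonian, LinearPMap.mem_graph_iff] at hψ
  obtain ⟨y, hy1, hy2⟩ := hψ
  have := hR y
  simp only at hy1 hy2
  rw [hy1, hy2] at this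
  calc ‖ψ‖ = ‖R (φ - (E : ℂ) • ψ)‖ := by rw [this]
    _ ≤ _ := R.le_opNorm _

/-- Uniqueness makes any choice of solutions linear in the right-hand side, and the norm bound makes
it a bounded inverse. -/
theorem isResolventPoint_of_exists {C : ℝ}
    (h1 : ∀ f : L2Graph a b, ∃ ψ, IsHamiltonian a b c ψ ((E : ℂ) • ψ + f) ∧ ‖ψ‖ ≤ C * ‖f‖)
    (h2 : ∀ ψ : L2Graph a b, IsHamiltonian a b c ψ ((E : ℂ) • ψ) → ψ = 0) :
    IsResolventPoint (hamiltonian a b c) (E : ℂ) := by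
  have huniq : ∀ f ψ₁ ψ₂ : L2Graph a b, IsHamiltonian a b c ψ₁ ((E : ℂ) • ψ₁ + f) →
      IsHamiltonian a b c ψ₂ ((E : ℂ) • ψ₂ + f) → ψ₁ = ψ₂ := by
    intro f ψ₁ ψ₂ k1 k2
    rw [← sub_eq_zero]
    apply h2
    have := (hamiltonianGraph a b c).sub_mem (x := (ψ₁, (E : ℂ) • ψ₁ + f))
      (y := (ψ₂, (E : ℂ) • ψ₂ + f)) k1 k2
    have e : ((ψ₁, (E : ℂ) • ψ₁ + f) - (ψ₂, (E : ℂ) • ψ₂ + f) : L2Graph a b × L2Graph a b) =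
        (ψ₁ - ψ₂, (E : ℂ) • (ψ₁ - ψ₂)) := by
      rw [Prod.mk_sub_mk, add_sub_add_right_eq_sub, smul_sub]
    rw [e] at this
    exact this
  choose S hS hSn using h1
  let R₀ : L2Graph a b →ₗ[ℂ] L2Graph a b :=
    { toFun := S
      map_add' := fun f g => huniq (f + g) _ _ (hS _) (by
        have := (hamiltonianGraph a b c).add_mem (x := (S f, (E : ℂ) • S f + f))
          (y := (S g, (E : ℂ) • S g + g)) (hS f) (hS g)
        have e : ((S f, (E : ℂ) • S f + f) + (S g, (E : ℂ) • S g + g) :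
            L2Graph a b × L2Graph a b) = (S f + S g, (E : ℂ) • (S f + S g) + (f + g)) := by
          rw [Prod.mk_add_mk, smul_add, add_add_add_comm]
        rw [e] at this
        exact this)
      map_smul' := fun z f => huniq (z • f) _ _ (hS _) (by
        have := (hamiltonianGraph a b c).smul_mem z (x := (S f, (E : ℂ) • S f + f)) (hS f)
        have e : (z • (S f, (E : ℂ) • S f + f) : L2Graph a b × L2Graph a b) =
            (z • S f, (E : ℂ) • (z • S f) + z • f) := by
          rw [Prod.smul_mk, smul_add, smul_comm]
        rw [e] at this
        exact this) }
  refine ⟨R₀.mkContinuous C hSn, fun f => ?_, fun ψ => ?_⟩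
  · have := (mem_graph_hamiltonian a b c _ _).2 (hS f)
    rw [LinearPMap.mem_graph_iff] at this
    obtain ⟨y, hy1, hy2⟩ := this
    simp only at hy1 hy2
    have hm : S f ∈ (hamiltonian a b c).domain := hy1 ▸ y.2
    refine ⟨hm, ?_⟩
    have hy : y = ⟨S f, hm⟩ := Subtype.ext hy1
    rw [hy] at hy2
    change (hamiltonian a b c) ⟨S f, hm⟩ - (E : ℂ) • S f = f
    rw [hy2, add_sub_cancel_left]
  · refine huniq _ _ _ (hS _) ?_
    rw [← mem_graph_hamiltonian, add_sub_cancel]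
    exact LinearPMap.mem_graph _ ψ

theorem len_pos (ha : 0 < a) (hb : 0 < b) (e : Edge) : 0 < len a b e := by
  rcases e with e | e
  · exact ha
  · exact hb

/-- A constant that works on both kinds of edges. -/
theorem exists_uniform {p : ℝ → ℝ → Prop} (ha : 0 < a) (hb : 0 < b)
    (hp : ∀ L, 0 < L → ∃ B, 0 ≤ B ∧ p L B) (hmono : ∀ L B B', B ≤ B' → p L B → p L B') :
    ∃ B, 0 ≤ B ∧ ∀ e : Edge, p (len a b e) B := by
  obtain ⟨A, hA, hpA⟩ := hp a ha
  obtain ⟨B, hB, hpB⟩ := hp b hb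
  refine ⟨max A B, hA.trans (le_max_left _ _), fun e => ?_⟩
  rcases e with e | e
  · exact hmono _ _ _ (le_max_left _ _) hpA
  · exact hmono _ _ _ (le_max_right _ _) hpB

/-- The cubic `x (1 - x / L)²` has a single nonzero boundary datum, its derivative at `0`. Adding a
multiple of it on an edge corrects the derivative condition at the initial vertex and disturbs
nothing else. -/
theorem exists_bump {L : ℝ} (hL : 0 < L) : ∃ (P Q : EdgeLp L) (p p' : ℝ → ℂ),
    SolvesOnEdge L P Q p p' ∧ p 0 = 0 ∧ p' 0 = 1 ∧ p L = 0 ∧ p' L = 0 := by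
  have hL' := hL.ne'
  let p : ℝ → ℝ := fun x => x * (1 - x / L) ^ 2
  let p' : ℝ → ℝ := fun x => (1 - x / L) * (1 - 3 * x / L)
  let q : ℝ → ℝ := fun x => 4 / L - 6 * x / L ^ 2
  have h1 : ∀ x, HasDerivAt p (p' x) x := fun x => by
    convert! (hasDerivAt_id x).mul ((((hasDerivAt_id x).div_const L).const_sub 1).pow 2) using 1
    norm_num [p', id, Pi.pow_apply]
    field_simp
    ring
  have h2 : ∀ x, HasDerivAt p' (-q x) x := fun x => by
    convert! (((hasDerivAt_id x).div_const L).const_sub 1).mul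
      ((((hasDerivAt_id x).const_mul 3).div_const L).const_sub 1) using 1
    simp only [q, id]
    field_simp
    ring
  have hcp : Continuous fun x => (p x : ℂ) := by fun_prop
  have hcq : Continuous fun x => (q x : ℂ) := by fun_prop
  refine ⟨_, _, fun x => (p x : ℂ), fun x => (p' x : ℂ),
    solvesOnEdge_toEdge L hcp hcq (fun x => (h1 x).ofReal_comp) (fun x => ?_),
    by simp [p], by simp [p'], by simp [p, hL'], by simp [p', hL']⟩
  have := (h2 x).ofReal_comp
  push_cast at this
  exact this

/-- Continuity at the vertices of the function `α cs + β sn` given by its Cauchy data on the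
edges. -/
structure MatchesAtVertices (a b E : ℝ) (α β : Edge → ℂ) : Prop where
  left : ∀ i j, α (.inl (i - 1, j)) * csC E a + β (.inl (i - 1, j)) * snC E a = α (.inl (i, j))
  up : ∀ i j, α (.inr (i, j)) = α (.inl (i, j))
  down : ∀ i j, α (.inr (i, j - 1)) * csC E b + β (.inr (i, j - 1)) * snC E b = α (.inl (i, j))

/-- The defect in the derivative condition at the vertices of the function `α cs + β sn`. -/
noncomputable def defect (a b E : ℝ) (c : ℤ → ℤ → ℝ) (α β : Edge → ℂ) (p : ℤ × ℤ) : ℂ :=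
  β (.inl p) - (-E * α (.inl (p.1 - 1, p.2)) * snC E a + β (.inl (p.1 - 1, p.2)) * csC E a)
    + β (.inr p) - (-E * α (.inr (p.1, p.2 - 1)) * snC E b + β (.inr (p.1, p.2 - 1)) * csC E b)
    - c p.1 p.2 * α (.inl p)

/-- At a point of the resolvent set, functions that solve the equation on the edges are controlled
by their defect at the vertices. -/
theorem exists_energy_le_defect (ha : 0 < a) (hb : 0 < b)
    (h : IsResolventPoint (hamiltonian a b c) (E : ℂ)) :
    ∃ C : ℝ≥0∞, C ≠ ⊤ ∧ ∀ α β : Edge → ℂ, energy α ≠ ⊤ → energy β ≠ ⊤ →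
      MatchesAtVertices a b E α β → energy α + energy β ≤ C * energy (defect a b E c α β) := by
  obtain ⟨C, hC, hbound⟩ := exists_bound_of_isResolventPoint h
  have hlen := len_pos (a := a) (b := b) ha hb
  choose! P Q p p' hsol hp0 hp'0 hpL hp'L using fun (L : ℝ) (hL : 0 < L) => exists_bump hL
  obtain ⟨K, hK, hKb⟩ := exists_uniform ha hb (fun L hL => exists_norm_le_cauchy E hL)
    (fun L B B' hB hp α β => ⟨(hp α β).1.trans (by gcongr), (hp α β).2.trans (by gcongr)⟩)
  obtain ⟨B, hB, hBb⟩ := exists_uniform ha hb (fun L _ => exists_norm_cauchy_le E L)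
    (fun L B B' hB hp α β => (hp α β).trans (by gcongr))
  obtain ⟨N, hN, hNb⟩ := exists_uniform (p := fun L N => ‖P L‖ ≤ N ∧ ‖Q L - (E : ℂ) • P L‖ ≤ N)
    ha hb (fun L _ => ⟨‖P L‖ + ‖Q L - (E : ℂ) • P L‖, by positivity,
      le_add_of_nonneg_right (norm_nonneg _), le_add_of_nonneg_left (norm_nonneg _)⟩)
    (fun L N N' hN hp => ⟨hp.1.trans hN, hp.2.trans hN⟩)
  set D : ℝ≥0∞ := 2 * (ENNReal.ofReal (K ^ 2) * (2 * (ENNReal.ofReal (C ^ 2) *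
    ENNReal.ofReal (N ^ 2)) + 2 * ENNReal.ofReal (N ^ 2))) with hD
  -- With `D + 1` the constant cannot be zero, so the bound also holds when the defect has infinite
  -- energy.
  refine ⟨D + 1, by finiteness, fun α β hα hβ hm => ?_⟩
  set g := defect a b E c α β with hg
  rcases eq_or_ne (energy g) ⊤ with htop | htop
  · rw [htop, ENNReal.mul_top (by simp)]
    exact le_top
  -- The defect at a vertex is cancelled on the horizontal edge that starts there. The corrected
  -- function lies in the domain, at the price of a right-hand side `r` whose size is controlled by
  -- the defect.
  set κ : Edge → ℂ := Sum.elim (fun p => -g p) (fun _ => 0) with hκ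
  have hκg : energy κ = energy g := by
    rw [energy_sum]
    have h1 : energy (fun p => κ (.inl p)) = energy g := energy_neg g
    have h2 : energy (fun p => κ (.inr p)) = 0 := energy_eq_zero.2 fun p => rfl
    rw [h1, h2, add_zero]
  set x : ∀ e : Edge, EdgeLp (len a b e) := fun e => cauchy E (len a b e) (α e, β e) with hx
  set z : ∀ e : Edge, EdgeLp (len a b e) := fun e => κ e • P (len a b e) with hz
  set r : ∀ e : Edge, EdgeLp (len a b e) := fun e =>
    κ e • (Q (len a b e) - (E : ℂ) • P (len a b e)) with hr
  have hzκ : energy z ≤ ENNReal.ofReal (N ^ 2) * energy g := by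
    rw [← hκg]
    refine energy_le_of_le fun e => ?_
    rw [hz, norm_smul, mul_comm]
    exact mul_le_mul_of_nonneg_right (hNb e).1 (norm_nonneg _)
  have hrκ : energy r ≤ ENNReal.ofReal (N ^ 2) * energy g := by
    rw [← hκg]
    refine energy_le_of_le fun e => ?_
    rw [hr, norm_smul, mul_comm]
    exact mul_le_mul_of_nonneg_right (hNb e).2 (norm_nonneg _)
  have hxtop : energy x ≠ ⊤ := by
    have := energy_le_add (x := x) (p := fun e => B * ‖α e‖) (q := fun e => B * ‖β e‖) fun e => by
      rw [← mul_add]; exact hBb e _ _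
    rw [energy_norm_mul, energy_norm_mul] at this
    exact ne_top_of_le_ne_top (by finiteness) this
  have hztop : energy z ≠ ⊤ := ne_top_of_le_ne_top (by finiteness) hzκ
  have hrtop : energy r ≠ ⊤ := ne_top_of_le_ne_top (by finiteness) hrκ
  have hψtop : energy (fun e => x e + z e) ≠ ⊤ :=
    ne_top_of_le_ne_top (by finiteness) (energy_add_le x z)
  set ψ : L2Graph a b := ofEnergy (fun e => x e + z e) hψtop with hψ
  set ρ : L2Graph a b := ofEnergy r hrtop with hρ
  have hH : IsHamiltonian a b c ψ ((E : ℂ) • ψ + ρ) := by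
    refine ⟨fun e x => α e * csC E x + β e * snC E x + κ e * p (len a b e) x,
      fun e x => -E * α e * snC E x + β e * csC E x + κ e * p' (len a b e) x, fun e => ?_,
      fun i j => ?_⟩
    · have h1 := (solvesOnEdge_cauchy E (len a b e) (α e) (β e)).add
        ((hsol _ (hlen e)).smul (κ e))
      convert! h1 using 1
      change (E : ℂ) • (x e + z e) + r e = _
      simp only [hx, hz, hr]
      module
    · have q1 := hm.left i j
      have q2 := hm.up i j
      have q3 := hm.down i j
      have la : ∀ p, len a b (.inl p) = a := fun _ => rfl
      have lb : ∀ p, len a b (.inr p) = b := fun _ => rfl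
      refine ⟨?_, ?_, ?_, ?_⟩
      · simpa [la, hpL a ha, hp0 a ha] using q1
      · simpa [la, lb, hp0 a ha, hp0 b hb] using q2
      · simpa [la, lb, hp0 a ha, hpL b hb] using q3
      · have hκ1 : κ (.inl (i, j)) = -g (i, j) := rfl
        have hκ2 : κ (.inr (i, j)) = 0 := rfl
        have hgij : g (i, j) = defect a b E c α β (i, j) := rfl
        simp only [la, lb, hp0 a ha, hp'0 a ha, hp'L a ha, hp'0 b hb, hp'L b hb, hκ1, hκ2, hgij,
          defect, csC_zero, snC_zero]
        ring
  have hle := hbound ψ _ hH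
  rw [add_sub_cancel_left] at hle
  have hψe : energy (fun e => x e + z e) ≤ ENNReal.ofReal (C ^ 2) * energy r := by
    have h1 : energy (fun e => x e + z e) = ENNReal.ofReal (‖ψ‖ ^ 2) := energy_coe ψ
    have h2 : energy r = ENNReal.ofReal (‖ρ‖ ^ 2) := energy_coe ρ
    rw [h1, h2, ← ENNReal.ofReal_mul (sq_nonneg C), ← mul_pow]
    exact ENNReal.ofReal_le_ofReal (pow_le_pow_left₀ (norm_nonneg _) hle 2)
  have hxe : energy x ≤ 2 * energy (fun e => x e + z e) + 2 * energy z := by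
    have := energy_add_le (fun e => x e + z e) (fun e => -z e)
    simpa only [add_neg_cancel_right, energy_neg] using this
  have hαx : energy α ≤ ENNReal.ofReal (K ^ 2) * energy x :=
    energy_le_of_le fun e => (hKb e _ _).1
  have hβx : energy β ≤ ENNReal.ofReal (K ^ 2) * energy x :=
    energy_le_of_le fun e => (hKb e _ _).2
  calc energy α + energy β
      ≤ 2 * (ENNReal.ofReal (K ^ 2) * energy x) := by
        rw [two_mul]; exact add_le_add hαx hβx
    _ ≤ 2 * (ENNReal.ofReal (K ^ 2) * (2 * (ENNReal.ofReal (C ^ 2) *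
        (ENNReal.ofReal (N ^ 2) * energy g)) + 2 * (ENNReal.ofReal (N ^ 2) * energy g))) := by
        gcongr
        refine hxe.trans ?_
        gcongr
        exact hψe.trans (by gcongr)
    _ = D * energy g := by rw [hD]; ring
    _ ≤ (D + 1) * energy g := by gcongr; exact le_self_add

end Resolvent

/-! ### Reduction to the difference equation on the vertices -/

/-- Square-summable functions on the vertices. -/
abbrev Vtx : Type := lp (fun _ : ℤ × ℤ => ℂ) 2

theorem snC_ne_zero {E L : ℝ} (h : sn E L ≠ 0) : snC E L ≠ 0 := by
  unfold snC
  exact_mod_cast h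

/-- The solution of `-u'' = E u` on an edge with boundary values `α` and `β`. -/
noncomputable def interp (E L : ℝ) (α β : ℂ) : EdgeLp L :=
  cauchy E L (α, (β - α * csC E L) / snC E L)

theorem exists_norm_interp_le (E L : ℝ) : ∃ B : ℝ, 0 ≤ B ∧ ∀ α β : ℂ,
    ‖interp E L α β‖ ≤ B * (‖α‖ + ‖β‖) := by
  obtain ⟨B, hB, h⟩ := exists_norm_cauchy_le E L
  refine ⟨B * (1 + (1 + ‖csC E L‖) / ‖snC E L‖), by positivity, fun α β => (h _ _).trans ?_⟩
  rw [mul_assoc]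
  refine mul_le_mul_of_nonneg_left ?_ hB
  have h1 : ‖(β - α * csC E L) / snC E L‖ ≤ (‖β‖ + ‖α‖ * ‖csC E L‖) / ‖snC E L‖ := by
    rw [norm_div, ← norm_mul]
    gcongr
    exact norm_sub_le _ _
  have h2 : (‖β‖ + ‖α‖ * ‖csC E L‖) / ‖snC E L‖ ≤
      (1 + ‖csC E L‖) / ‖snC E L‖ * (‖α‖ + ‖β‖) := by
    rw [div_mul_eq_mul_div]
    gcongr
    nlinarith [norm_nonneg α, norm_nonneg β, norm_nonneg (csC E L),
      mul_nonneg (norm_nonneg β) (norm_nonneg (csC E L))]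
  nlinarith [norm_nonneg β]

/-- Solvability of the inhomogeneous Dirichlet problem on an edge, with bounds. -/
theorem exists_dirichlet_solution {E L : ℝ} (hL : 0 < L) (hs : sn E L ≠ 0) :
    ∃ B : ℝ, 0 ≤ B ∧ ∀ f : EdgeLp L, ∃ (ψ : EdgeLp L) (u v : ℝ → ℂ),
      SolvesOnEdge L ψ ((E : ℂ) • ψ + f) u v ∧ u 0 = 0 ∧ u L = 0 ∧
      ‖v 0‖ ≤ B * ‖f‖ ∧ ‖v L‖ ≤ B * ‖f‖ ∧ ‖ψ‖ ≤ B * ‖f‖ := by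
  obtain ⟨B, hB, h⟩ := exists_particular_solution E hL
  obtain ⟨B', hB', h'⟩ := exists_norm_cauchy_le E L
  have hs' := snC_ne_zero hs
  have hsn : 0 < ‖snC E L‖ := norm_pos_iff.2 hs'
  set k := B / ‖snC E L‖ with hk
  have hk0 : 0 ≤ k := by positivity
  refine ⟨k + (k * ‖csC E L‖ + B) + (B' * k + B), by positivity, fun f => ?_⟩
  obtain ⟨ψ, u, v, h1, h2, h3, h4, h5, h6⟩ := h f
  -- The solution with zero Cauchy data is corrected by the multiple of `sn` that cancels its value
  -- at `L`; this needs `sn ≠ 0`.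
  set β : ℂ := -(u L / snC E L) with hβ
  have hβn : ‖β‖ ≤ k * ‖f‖ := by
    rw [hβ, norm_neg, norm_div, hk, div_mul_eq_mul_div]
    gcongr
  have hsol := (solvesOnEdge_cauchy E L 0 β).add h1
  rw [← add_assoc, ← smul_add] at hsol
  have e1 : ‖β‖ ≤ (k + (k * ‖csC E L‖ + B) + (B' * k + B)) * ‖f‖ := by
    refine hβn.trans (mul_le_mul_of_nonneg_right ?_ (norm_nonneg _))
    nlinarith [norm_nonneg (csC E L), mul_nonneg hk0 (norm_nonneg (csC E L)), mul_nonneg hB' hk0]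
  refine ⟨cauchy E L (0, β) + ψ, _, _, hsol, ?_, ?_, ?_, ?_, ?_⟩
  · simp [h2]
  · simp only [Pi.add_apply, zero_mul, zero_add, hβ]
    field_simp
    ring
  · simpa [h3] using e1
  · simp only [Pi.add_apply, mul_zero, zero_mul, zero_add]
    refine (norm_add_le _ _).trans ?_
    rw [norm_mul]
    have : ‖β‖ * ‖csC E L‖ ≤ k * ‖f‖ * ‖csC E L‖ := by gcongr
    nlinarith [norm_nonneg f, mul_nonneg hk0 (norm_nonneg f),
      mul_nonneg (mul_nonneg hB' hk0) (norm_nonneg f), mul_nonneg hB (norm_nonneg f)]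
  · refine (norm_add_le _ _).trans ?_
    have h7 := h' 0 β
    rw [norm_zero, zero_add] at h7
    have : B' * ‖β‖ ≤ B' * (k * ‖f‖) := by gcongr
    nlinarith [norm_nonneg f, mul_nonneg hk0 (norm_nonneg f),
      mul_nonneg (mul_nonneg hk0 (norm_nonneg (csC E L))) (norm_nonneg f),
      mul_nonneg hB (norm_nonneg f)]

/-- The translation of the vertices by `(n, m)`. -/
def shift (n m : ℤ) : ℤ × ℤ ≃ ℤ × ℤ := (Equiv.addRight n).prodCongr (Equiv.addRight m)

@[simp] theorem shift_apply (n m : ℤ) (p : ℤ × ℤ) : shift n m p = (p.1 + n, p.2 + m) := rfl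

/-- The initial vertex of an edge. -/
def org : Edge → ℤ × ℤ := Sum.elim id id

/-- The final vertex of an edge. -/
def tgt : Edge → ℤ × ℤ := Sum.elim (shift 1 0) (shift 0 1)

theorem energy_comp_org (F : ℤ × ℤ → ℂ) : energy (fun e : Edge => F (org e)) = 2 * energy F := by
  rw [energy_sum, two_mul]; rfl

theorem energy_comp_tgt (F : ℤ × ℤ → ℂ) : energy (fun e : Edge => F (tgt e)) = 2 * energy F := by
  rw [energy_sum, two_mul]
  exact congrArg₂ _ (energy_comp_equiv (shift 1 0) F) (energy_comp_equiv (shift 0 1) F)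

/-- The vertex equation at energy `E`. -/
noncomputable def vertexOp (a b E : ℝ) (c : ℤ → ℤ → ℝ) (F : ℤ × ℤ → ℂ) (p : ℤ × ℤ) : ℂ :=
  (F (p.1 + 1, p.2) + F (p.1 - 1, p.2) - 2 * csC E a * F p) / snC E a +
    (F (p.1, p.2 + 1) + F (p.1, p.2 - 1) - 2 * csC E b * F p) / snC E b - c p.1 p.2 * F p

section

variable {a b : ℝ} {c : ℤ → ℤ → ℝ} {E : ℝ}

/-- The vertex values of an eigenfunction are square summable and solve the homogeneous difference
equation. Once they vanish, so do the Cauchy data, since `sn ≠ 0` expresses the initial slope by the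
values at the two ends. -/
theorem eq_zero_of_eigen (ha : 0 < a) (hb : 0 < b) (hr : Regular a b E)
    (hinj : ∀ F : ℤ × ℤ → ℂ, energy F ≠ ⊤ → vertexOp a b E c F = 0 → F = 0)
    {ψ : L2Graph a b} (h : IsHamiltonian a b c ψ ((E : ℂ) • ψ)) : ψ = 0 := by
  obtain ⟨u, v, hsol, hδ⟩ := h
  have hlen := len_pos (a := a) (b := b) ha hb
  have hsa := snC_ne_zero hr.1
  have hsb := snC_ne_zero hr.2
  obtain ⟨K, hK, hKb⟩ := exists_norm_le_cauchy E ha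
  have hc : ∀ e, ψ e = cauchy E (len a b e) (u e 0, v e 0) ∧
      u e (len a b e) = u e 0 * csC E (len a b e) + v e 0 * snC E (len a b e) ∧
      v e (len a b e) = -E * u e 0 * snC E (len a b e) + v e 0 * csC E (len a b e) :=
    fun e => (hsol e).eq_cauchy (hlen e)
  set F : ℤ × ℤ → ℂ := fun p => u (.inl p) 0 with hF
  have hFtop : energy F ≠ ⊤ := by
    have h1 : energy F ≤ ENNReal.ofReal (K ^ 2) * energy (fun p => ψ (.inl p)) :=
      energy_le_of_le fun p => by
        rw [(hc (.inl p)).1]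
        exact (hKb _ _).1
    have h2 := energy_ne_top ψ
    rw [energy_sum] at h2
    have h3 : energy (fun p => ψ (.inl p)) ≠ ⊤ := fun h => h2 (by rw [h, top_add])
    exact ne_top_of_le_ne_top (by finiteness) h1
  have ka : ∀ i j, F (i + 1, j) = F (i, j) * csC E a + v (.inl (i, j)) 0 * snC E a := fun i j => by
    have h1 := (hδ (i + 1) j).cont_left
    rw [add_sub_cancel_right] at h1
    exact h1.symm.trans (hc (.inl (i, j))).2.1
  have kv : ∀ i j, u (.inr (i, j)) 0 = F (i, j) := fun i j => (hδ i j).cont_up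
  have kb : ∀ i j, F (i, j + 1) = F (i, j) * csC E b + v (.inr (i, j)) 0 * snC E b := fun i j => by
    have h1 := (hδ i (j + 1)).cont_down
    rw [add_sub_cancel_right] at h1
    rw [← kv i j]
    exact h1.symm.trans (hc (.inr (i, j))).2.1
  have hF0 : F = 0 := by
    refine hinj F hFtop ?_
    funext ⟨i, j⟩
    have h1 := (hδ i j).deriv_sum
    have h2 : v (.inl (i - 1, j)) a = _ := (hc (.inl (i - 1, j))).2.2
    have h3 : v (.inr (i, j - 1)) b = _ := (hc (.inr (i, j - 1))).2.2
    have h4 := ka i j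
    have h5 := ka (i - 1) j
    have h6 := kb i j
    have h7 := kb i (j - 1)
    rw [sub_add_cancel] at h5 h7
    have la : ∀ p, len a b (.inl p) = a := fun _ => rfl
    have lb : ∀ p, len a b (.inr p) = b := fun _ => rfl
    rw [la, show u (.inl (i - 1, j)) 0 = F (i - 1, j) from rfl] at h2
    rw [lb, kv] at h3
    rw [h2, h3, show u (.inl (i, j)) 0 = F (i, j) from rfl] at h1
    have e1 := csC_sq_add E a
    have e2 := csC_sq_add E b
    have g1 : (F (i + 1, j) + F (i - 1, j) - 2 * csC E a * F (i, j)) / snC E a =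
        v (.inl (i, j)) 0 + E * F (i - 1, j) * snC E a - v (.inl (i - 1, j)) 0 * csC E a := by
      rw [div_eq_iff hsa]
      linear_combination h4 - csC E a * h5 - F (i - 1, j) * e1
    have g2 : (F (i, j + 1) + F (i, j - 1) - 2 * csC E b * F (i, j)) / snC E b =
        v (.inr (i, j)) 0 + E * F (i, j - 1) * snC E b - v (.inr (i, j - 1)) 0 * csC E b := by
      rw [div_eq_iff hsb]
      linear_combination h6 - csC E b * h7 - F (i, j - 1) * e2
    simp only [vertexOp, Pi.zero_apply]
    rw [g1, g2]
    linear_combination h1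
  apply lp.ext
  funext e
  rw [(hc e).1]
  have hz : u e 0 = 0 ∧ v e 0 = 0 := by
    rcases e with ⟨i, j⟩ | ⟨i, j⟩
    · have h1 := ka i j
      simp only [hF0, Pi.zero_apply, zero_mul, zero_add] at h1
      exact ⟨congrFun hF0 (i, j), (mul_eq_zero.1 h1.symm).resolve_right hsa⟩
    · have h1 := kb i j
      simp only [hF0, Pi.zero_apply, zero_mul, zero_add] at h1
      exact ⟨(kv i j).trans (congrFun hF0 (i, j)), (mul_eq_zero.1 h1.symm).resolve_right hsb⟩
  rw [hz.1, hz.2]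
  exact map_zero _

/-- Solvability of the vertex equation gives solvability of the inhomogeneous equation on the
graph. -/
theorem exists_solution (ha : 0 < a) (hb : 0 < b) (hr : Regular a b E) {M : ℝ}
    (hsurj : ∀ g : Vtx, ∃ F : Vtx, vertexOp a b E c F = g ∧ ‖F‖ ≤ M * ‖g‖) :
    ∃ C : ℝ, ∀ f : L2Graph a b, ∃ ψ, IsHamiltonian a b c ψ ((E : ℂ) • ψ + f) ∧ ‖ψ‖ ≤ C * ‖f‖ := by
  have hsa := snC_ne_zero hr.1
  have hsb := snC_ne_zero hr.2
  obtain ⟨B, hB, hdir⟩ : ∃ B, 0 ≤ B ∧ ∀ e : Edge, ∀ f : EdgeLp (len a b e),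
      ∃ (ψ : EdgeLp (len a b e)) (u v : ℝ → ℂ),
      SolvesOnEdge (len a b e) ψ ((E : ℂ) • ψ + f) u v ∧ u 0 = 0 ∧ u (len a b e) = 0 ∧
      ‖v 0‖ ≤ B * ‖f‖ ∧ ‖v (len a b e)‖ ≤ B * ‖f‖ ∧ ‖ψ‖ ≤ B * ‖f‖ := by
    obtain ⟨B₁, hB₁, h₁⟩ := exists_dirichlet_solution ha hr.1
    obtain ⟨B₂, hB₂, h₂⟩ := exists_dirichlet_solution hb hr.2
    refine ⟨max B₁ B₂, hB₁.trans (le_max_left _ _), fun e f => ?_⟩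
    rcases e with e | e
    · obtain ⟨ψ, u, v, k1, k2, k3, k4, k5, k6⟩ := h₁ f
      have := mul_le_mul_of_nonneg_right (le_max_left B₁ B₂) (norm_nonneg f)
      exact ⟨ψ, u, v, k1, k2, k3, k4.trans this, k5.trans this, k6.trans this⟩
    · obtain ⟨ψ, u, v, k1, k2, k3, k4, k5, k6⟩ := h₂ f
      have := mul_le_mul_of_nonneg_right (le_max_right B₁ B₂) (norm_nonneg f)
      exact ⟨ψ, u, v, k1, k2, k3, k4.trans this, k5.trans this, k6.trans this⟩
  obtain ⟨B', hB', hint⟩ := exists_uniform ha hb (fun L _ => exists_norm_interp_le E L)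
    (fun L B B' hB hp α β => (hp α β).trans (by gcongr))
  set D : ℝ≥0∞ := 2 * (8 * ENNReal.ofReal (B' ^ 2) *
    (ENNReal.ofReal (M ^ 2) * (16 * ENNReal.ofReal (B ^ 2)))) + 2 * ENNReal.ofReal (B ^ 2) with hD
  refine ⟨√D.toReal, fun f => ?_⟩
  choose ψ₀ u₀ v₀ hsol hu0 huL hv0 hvL hψ₀ using fun e => hdir e (f e)
  set T := energy (f : ∀ e : Edge, EdgeLp (len a b e)) with hT
  have hTtop : T ≠ ⊤ := energy_ne_top f
  set fh : ℤ × ℤ → ℝ := fun p => ‖f (.inl p)‖ with hfh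
  set fv : ℤ × ℤ → ℝ := fun p => ‖f (.inr p)‖ with hfv
  have hTs : T = energy fh + energy fv := by
    rw [hT, energy_sum]
    simp only [energy, hfh, hfv, norm_norm]
  -- Solving with Dirichlet conditions on every edge leaves unbalanced derivatives at the vertices.
  -- The interpolation of a function `F` on the vertices has to compensate them, which is the
  -- difference equation with right-hand side `g`.
  set g : ℤ × ℤ → ℂ := fun p => (-v₀ (.inl p) 0 + v₀ (.inl (p.1 - 1, p.2)) a) +
    (-v₀ (.inr p) 0 + v₀ (.inr (p.1, p.2 - 1)) b) with hg
  have hgT : energy g ≤ 16 * ENNReal.ofReal (B ^ 2) * T := by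
    have k1 : energy (fun p => -v₀ (.inl p) 0) ≤ ENNReal.ofReal (B ^ 2) * T :=
      (energy_le_of_le (y := fh) fun p => by
        rw [norm_neg, hfh, norm_norm]; exact hv0 (.inl p)).trans (by rw [hTs]; gcongr; simp)
    have k2 : energy (fun p : ℤ × ℤ => v₀ (.inl (p.1 - 1, p.2)) a) ≤
        ENNReal.ofReal (B ^ 2) * T := by
      rw [← energy_comp_equiv (shift 1 0)]
      exact (energy_le_of_le (y := fh) fun p => by
        rw [hfh, norm_norm]
        simpa using! hvL (.inl p)).trans (by rw [hTs]; gcongr; simp)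
    have k3 : energy (fun p => -v₀ (.inr p) 0) ≤ ENNReal.ofReal (B ^ 2) * T :=
      (energy_le_of_le (y := fv) fun p => by
        rw [norm_neg, hfv, norm_norm]; exact hv0 (.inr p)).trans (by rw [hTs]; gcongr; simp)
    have k4 : energy (fun p : ℤ × ℤ => v₀ (.inr (p.1, p.2 - 1)) b) ≤
        ENNReal.ofReal (B ^ 2) * T := by
      rw [← energy_comp_equiv (shift 0 1)]
      exact (energy_le_of_le (y := fv) fun p => by
        rw [hfv, norm_norm]
        simpa using! hvL (.inr p)).trans (by rw [hTs]; gcongr; simp)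
    calc energy g ≤ 2 * (2 * (ENNReal.ofReal (B ^ 2) * T) + 2 * (ENNReal.ofReal (B ^ 2) * T)) +
          2 * (2 * (ENNReal.ofReal (B ^ 2) * T) + 2 * (ENNReal.ofReal (B ^ 2) * T)) := by
          refine (energy_add_le _ _).trans ?_
          gcongr
          · exact (energy_add_le _ _).trans (by gcongr)
          · exact (energy_add_le _ _).trans (by gcongr)
      _ = 16 * ENNReal.ofReal (B ^ 2) * T := by ring
  have hgtop : energy g ≠ ⊤ := ne_top_of_le_ne_top (by finiteness) hgT
  obtain ⟨F, hFg, hFn⟩ := hsurj (ofEnergy g hgtop)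
  have hFT : energy F ≤ ENNReal.ofReal (M ^ 2) * (16 * ENNReal.ofReal (B ^ 2)) * T := by
    have h1 : energy g = ENNReal.ofReal (‖ofEnergy g hgtop‖ ^ 2) := energy_coe (ofEnergy g hgtop)
    calc energy F ≤ ENNReal.ofReal (M ^ 2) * energy g := by
          rw [energy_coe, h1, ← ENNReal.ofReal_mul (sq_nonneg M), ← mul_pow]
          exact ENNReal.ofReal_le_ofReal (pow_le_pow_left₀ (norm_nonneg _) hFn 2)
      _ ≤ ENNReal.ofReal (M ^ 2) * (16 * ENNReal.ofReal (B ^ 2) * T) := by gcongr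
      _ = _ := by ring
  have hFtop : energy F ≠ ⊤ := energy_ne_top F
  set x : ∀ e : Edge, EdgeLp (len a b e) := fun e =>
    interp E (len a b e) (F (org e)) (F (tgt e)) with hx
  have hxF : energy x ≤ 8 * ENNReal.ofReal (B' ^ 2) * energy F := by
    have := energy_le_add (x := x) (p := fun e => B' * ‖F (org e)‖)
      (q := fun e => B' * ‖F (tgt e)‖) fun e => by rw [← mul_add]; exact hint e _ _
    rw [energy_norm_mul, energy_norm_mul, energy_comp_org, energy_comp_tgt] at this
    exact this.trans_eq (by ring)
  have hψ₀T : energy ψ₀ ≤ ENNReal.ofReal (B ^ 2) * T := energy_le_of_le hψ₀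
  have hψT : energy (fun e => x e + ψ₀ e) ≤ D * T := by
    calc energy (fun e => x e + ψ₀ e) ≤ 2 * energy x + 2 * energy ψ₀ := energy_add_le _ _
      _ ≤ 2 * (8 * ENNReal.ofReal (B' ^ 2) *
          (ENNReal.ofReal (M ^ 2) * (16 * ENNReal.ofReal (B ^ 2)) * T)) +
          2 * (ENNReal.ofReal (B ^ 2) * T) := by
          gcongr
          exact hxF.trans (by gcongr)
      _ = D * T := by rw [hD]; ring
  have hDtop : D ≠ ⊤ := by finiteness
  have hψtop : energy (fun e => x e + ψ₀ e) ≠ ⊤ := ne_top_of_le_ne_top (by finiteness) hψT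
  refine ⟨ofEnergy _ hψtop, ?_, ?_⟩
  · refine ⟨fun e => (fun t => F (org e) * csC E t +
        (F (tgt e) - F (org e) * csC E (len a b e)) / snC E (len a b e) * snC E t) + u₀ e,
      fun e => (fun t => -E * F (org e) * snC E t +
        (F (tgt e) - F (org e) * csC E (len a b e)) / snC E (len a b e) * csC E t) + v₀ e,
      fun e => ?_, fun i j => ?_⟩
    · convert! (solvesOnEdge_cauchy E (len a b e) (F (org e)) _).add (hsol e) using 1
      change (E : ℂ) • (x e + ψ₀ e) + f e = _
      simp only [hx, interp]
      module
    · have la : ∀ p, len a b (.inl p) = a := fun _ => rfl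
      have lb : ∀ p, len a b (.inr p) = b := fun _ => rfl
      have oa : ∀ p, org (.inl p) = p := fun _ => rfl
      have ob : ∀ p, org (.inr p) = p := fun _ => rfl
      have ta : ∀ i j, tgt (.inl (i, j)) = (i + 1, j) := fun _ _ => by simp [tgt]
      have tb : ∀ i j, tgt (.inr (i, j)) = (i, j + 1) := fun _ _ => by simp [tgt]
      have ua : ∀ p, u₀ (.inl p) a = 0 := fun p => huL (.inl p)
      have ub : ∀ p, u₀ (.inr p) b = 0 := fun p => huL (.inr p)
      refine ⟨?_, ?_, ?_, ?_⟩
      · simp only [Pi.add_apply, la, oa, ta, ua, hu0, csC_zero, snC_zero, sub_add_cancel]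
        field_simp
        ring
      · simp only [Pi.add_apply, oa, ob, hu0, csC_zero, snC_zero, mul_zero]
      · simp only [Pi.add_apply, lb, oa, ob, tb, ub, hu0, csC_zero, snC_zero, sub_add_cancel]
        field_simp
        ring
      · have hA : vertexOp a b E c F (i, j) = g (i, j) := congrFun hFg (i, j)
        have e1 := csC_sq_add E a
        have e2 := csC_sq_add E b
        simp only [vertexOp, hg] at hA
        simp only [Pi.add_apply, la, lb, oa, ob, ta, tb, hu0, csC_zero, snC_zero, sub_add_cancel]
        have r1 : -(E * F (i - 1, j) * snC E a) + (F (i, j) - F (i - 1, j) * csC E a) / snC E a *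
            csC E a = (F (i, j) * csC E a - F (i - 1, j)) / snC E a := by
          field_simp
          linear_combination -F (i - 1, j) * e1
        have r2 : -(E * F (i, j - 1) * snC E b) + (F (i, j) - F (i, j - 1) * csC E b) / snC E b *
            csC E b = (F (i, j) * csC E b - F (i, j - 1)) / snC E b := by
          field_simp
          linear_combination -F (i, j - 1) * e2
        linear_combination hA - r1 - r2
  · have h1 : energy (fun e => x e + ψ₀ e) = ENNReal.ofReal (‖ofEnergy _ hψtop‖ ^ 2) :=
      energy_coe (ofEnergy _ hψtop)
    have h2 : T = ENNReal.ofReal (‖f‖ ^ 2) := energy_coe f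
    rw [h1, h2, ← ENNReal.ofReal_toReal hDtop, ← ENNReal.ofReal_mul ENNReal.toReal_nonneg,
      ENNReal.ofReal_le_ofReal_iff (by positivity)] at hψT
    refine abs_le_of_sq_le_sq' ?_ (by positivity) |>.2
    rwa [mul_pow, Real.sq_sqrt ENNReal.toReal_nonneg]

/-- The inverse of `A` solves the inhomogeneous vertex equation with a norm bound, and injectivity
of `A` excludes eigenfunctions; both transfer to the graph. -/
theorem isResolventPoint_of_isUnit (ha : 0 < a) (hb : 0 < b) (hr : Regular a b E)
    (A : Vtx →L[ℂ] Vtx) (hA : ∀ F : Vtx, (A F : ℤ × ℤ → ℂ) = vertexOp a b E c F) (hu : IsUnit A) :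
    IsResolventPoint (hamiltonian a b c) (E : ℂ) := by
  obtain ⟨U, rfl⟩ := hu
  obtain ⟨C, hC⟩ := exists_solution (c := c) (M := ‖(↑U⁻¹ : Vtx →L[ℂ] Vtx)‖) ha hb hr fun g =>
    ⟨(↑U⁻¹ : Vtx →L[ℂ] Vtx) g, by
      rw [← hA, ← mul_apply_eq_comp, U.mul_inv]; rfl,
      (↑U⁻¹ : Vtx →L[ℂ] Vtx).le_opNorm g⟩
  refine isResolventPoint_of_exists hC fun ψ hψ => eq_zero_of_eigen ha hb hr (fun F hF h0 => ?_) hψ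
  have h1 : (↑U : Vtx →L[ℂ] Vtx) (ofEnergy F hF) = 0 := lp.ext (by rw [hA]; exact h0)
  have h2 : (↑U⁻¹ : Vtx →L[ℂ] Vtx) ((↑U : Vtx →L[ℂ] Vtx) (ofEnergy F hF)) = ofEnergy F hF := by
    rw [← mul_apply_eq_comp, U.inv_mul]; rfl
  rw [h1, map_zero] at h2
  have h3 := congrArg (fun x : Vtx => (x : ℤ × ℤ → ℂ)) h2
  exact h3.symm

end

/-! ### Perturbation along a line in a C*-algebra -/

section Abstract

variable {A : Type*} [CStarAlgebra A]

/-- A perturbation by `D` of an element with right inverse `G`. -/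
theorem isUnit_sub_of_mul_eq_one {A₀ G D Y : A} (h0 : A₀ * G = 1)
    (h : D * Y = D + D * G * D * Y) (hsa : IsSelfAdjoint (A₀ - D)) : IsUnit (A₀ - D) := by
  -- This is Krein's resolvent formula, with `Y` solving the equation reduced to the support of `D`.
  -- Self-adjointness turns the right inverse into a two-sided one.
  have h1 : (A₀ - D) * (G + G * D * Y * G) = 1 := by
    calc (A₀ - D) * (G + G * D * Y * G)
        = A₀ * G + A₀ * G * (D * Y) * G - D * G - D * G * D * Y * G := by noncomm_ring
      _ = 1 := by rw [h0, one_mul, h]; noncomm_ring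
  have h2 : star (G + G * D * Y * G) * (A₀ - D) = 1 := by
    have := congrArg star h1
    rwa [star_mul, hsa.star_eq, star_one] at this
  exact isUnit_iff_exists.2 ⟨_, h1, by rw [← left_inv_eq_right_inv h2 h1]; exact h2⟩

/-- The diagonal block of the geometric series. -/
theorem proj_geom_proj {U P Λ : A} (hU : ‖Λ * U‖ < 1) (hc : Commute Λ U) (hP : P * P = P)
    (hΛP : Commute Λ P) (h : ∀ n : ℕ, P * U ^ (n + 1) * P = 0) :
    P * (∑' n : ℕ, (Λ * U) ^ n) * P = P := by
  have hs : Summable fun n : ℕ => (Λ * U) ^ n := summable_geometric_of_norm_lt_one hU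
  rw [← hs.tsum_mul_left, ← (hs.mul_left P).tsum_mul_right, tsum_eq_single 0]
  · simp [hP]
  · intro n hn
    obtain ⟨m, rfl⟩ := Nat.exists_eq_succ_of_ne_zero hn
    rw [Nat.succ_eq_add_one, hc.mul_pow, ← mul_assoc, ← (hΛP.pow_left (m + 1)).eq, mul_assoc,
      mul_assoc, ← mul_assoc P, h m, mul_zero]

variable {U U' B P : A}

/-- Invertibility of a lattice operator perturbed along a line, by the functional calculus of the
transversal part `B`. -/
theorem isUnit_perturbed (hUU' : U * U' = 1) (hU'U : U' * U = 1) (hU : ‖U‖ ≤ 1) (hU' : ‖U'‖ ≤ 1)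
    (hstar : star U = U') (hB : IsSelfAdjoint B) (hP : IsSelfAdjoint P) (hBU : Commute B U)
    (hBU' : Commute B U') (hBP : Commute B P) (hPP : P * P = P)
    (h1 : ∀ n : ℕ, P * U ^ (n + 1) * P = 0) (h2 : ∀ n : ℕ, P * U' ^ (n + 1) * P = 0)
    (hspec : spectrum ℝ B ⊆ Icc (-1) 1) {s p q δ : ℝ} (hs : s ≠ 0) {lam : ℝ → ℝ}
    (hc : ContinuousOn lam (Icc (-1) 1)) (hne : ∀ x ∈ Icc (-1 : ℝ) 1, lam x ≠ 0)
    (hlt : ∀ x ∈ Icc (-1 : ℝ) 1, |lam x| < 1)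
    (hω : ∀ x ∈ Icc (-1 : ℝ) 1, lam x + (lam x)⁻¹ = s * (p + q * x))
    (hδ : ∀ x ∈ Icc (-1 : ℝ) 1, lam x - (lam x)⁻¹ ≠ s * δ) :
    IsUnit (s⁻¹ • (U + U') - (p • 1 + q • B) - δ • P) := by
  have hc' : ContinuousOn lam (spectrum ℝ B) := hc.mono hspec
  have hci : ContinuousOn (fun x => (lam x)⁻¹) (spectrum ℝ B) :=
    hc'.inv₀ fun x hx => hne x (hspec hx)
  -- The reciprocal of `κ` is the diagonal value at `i = 0` of the one-dimensional Green function `λ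
  -- ^ |i| / κ`; the impurity binds where `κ = δ`. Here `κ ≠ 0` because `|λ| < 1`.
  set κ : ℝ → ℝ := fun x => s⁻¹ * (lam x - (lam x)⁻¹) with hκ
  have hκc : ContinuousOn κ (spectrum ℝ B) := continuousOn_const.mul (hc'.sub hci)
  have hκ0 : ∀ x ∈ spectrum ℝ B, κ x ≠ 0 := fun x hx h0 => by
    have hl := hne x (hspec hx)
    have hl1 := hlt x (hspec hx)
    rw [hκ] at h0
    simp only [mul_eq_zero, inv_eq_zero, hs, false_or, sub_eq_zero] at h0
    have : lam x * lam x = 1 := by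
      nth_rewrite 2 [h0]
      exact mul_inv_cancel₀ hl
    have := abs_lt.1 hl1
    nlinarith
  have hκδ : ∀ x ∈ spectrum ℝ B, κ x - δ ≠ 0 := fun x hx h0 => by
    refine hδ x (hspec hx) ?_
    have : s⁻¹ * (lam x - (lam x)⁻¹) = δ := sub_eq_zero.1 h0
    rw [← this, mul_inv_cancel_left₀ hs]
  have hκic : ContinuousOn (fun x => (κ x)⁻¹) (spectrum ℝ B) := hκc.inv₀ hκ0
  have hyc : ContinuousOn (fun x => κ x * (κ x - δ)⁻¹) (spectrum ℝ B) :=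
    hκc.mul ((hκc.sub continuousOn_const).inv₀ hκδ)
  set Λ := cfc lam B with hΛ
  set Λi := cfc (fun x => (lam x)⁻¹) B with hΛi
  set K := cfc κ B with hK
  set Ki := cfc (fun x => (κ x)⁻¹) B with hKi
  -- Solves the scalar equation `Y = 1 + (δ / κ) Y`.
  set Y := cfc (fun x => κ x * (κ x - δ)⁻¹) B with hY
  have eΛ : Λi * Λ = 1 := by
    rw [hΛ, hΛi, ← cfc_mul _ _ B hci hc', ← cfc_one ℝ B]
    exact cfc_congr fun x hx => inv_mul_cancel₀ (hne x (hspec hx))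
  have eK : K * Ki = 1 := by
    rw [hK, hKi, ← cfc_mul _ _ B hκc hκic, ← cfc_one ℝ B]
    exact cfc_congr fun x hx => mul_inv_cancel₀ (hκ0 x hx)
  have eKs : K = s⁻¹ • (Λ - Λi) := by
    rw [hK, hΛ, hΛi, ← cfc_sub _ _ B hc' hci,
      ← cfc_const_mul s⁻¹ (fun x => lam x - (lam x)⁻¹) B (hc'.sub hci)]
  have eω : p • 1 + q • B = s⁻¹ • (Λ + Λi) := by
    rw [hΛ, hΛi, ← cfc_add B _ _ hc' hci,
      ← cfc_const_mul s⁻¹ (fun x => lam x + (lam x)⁻¹) B (hc'.add hci)]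
    have : cfc (fun x => p + q * x) B = p • 1 + q • B := by
      rw [cfc_const_add p (fun x => q * x) B (by fun_prop), cfc_const_mul_id q B,
        Algebra.algebraMap_eq_smul_one]
    rw [← this]
    refine cfc_congr fun x hx => ?_
    rw [hω x (hspec hx), inv_mul_cancel_left₀ hs]
  have eY : Y = 1 + δ • (Ki * Y) := by
    rw [hKi, hY, ← cfc_mul _ _ B hκic hyc,
      ← cfc_const_mul δ (fun x => (κ x)⁻¹ * (κ x * (κ x - δ)⁻¹)) B (hκic.mul hyc),
      ← cfc_const_one ℝ B,
      ← cfc_add B (fun _ => 1) (fun x => δ * ((κ x)⁻¹ * (κ x * (κ x - δ)⁻¹))) continuousOn_const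
        (continuousOn_const.mul (hκic.mul hyc))]
    refine cfc_congr fun x hx => ?_
    have := hκ0 x hx
    have := hκδ x hx
    field_simp
    ring
  have hΛn : ‖Λ‖ < 1 := norm_cfc_lt one_pos fun x hx => hlt x (hspec hx)
  have cΛU : Commute Λ U := hBU.cfc_real lam
  have cΛU' : Commute Λ U' := hBU'.cfc_real lam
  have cΛP : Commute Λ P := hBP.cfc_real lam
  have cKiP : Commute Ki P := hBP.cfc_real _
  have cKiY : Commute Ki Y := cfc_commute_cfc _ _ B
  have cKiΛ : Commute Ki Λ := cfc_commute_cfc _ _ B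
  have cYP : Commute Y P := hBP.cfc_real _
  have cΛΛi : Commute Λ Λi := cfc_commute_cfc _ _ B
  have nΛU : ‖Λ * U‖ < 1 := (norm_mul_le _ _).trans_lt
    ((mul_le_of_le_one_right (norm_nonneg _) hU).trans_lt hΛn)
  have nΛU' : ‖Λ * U'‖ < 1 := (norm_mul_le _ _).trans_lt
    ((mul_le_of_le_one_right (norm_nonneg _) hU').trans_lt hΛn)
  set N := ∑' n : ℕ, (Λ * U) ^ n with hN
  set N' := ∑' n : ℕ, (Λ * U') ^ n with hN'
  have eN : (1 - Λ * U) * N = 1 := mul_neg_geom_series _ nΛU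
  have eN' : (1 - Λ * U') * N' = 1 := mul_neg_geom_series _ nΛU'
  have cc : Commute (1 - Λ * U) (1 - Λ * U') := by
    have : Commute (Λ * U) (Λ * U') :=
      ((Commute.refl Λ).mul_right cΛU').mul_left
        (cΛU.symm.mul_right (by rw [commute_iff_eq, hUU', hU'U]))
    exact (Commute.one_left _).sub_left ((Commute.one_right _).sub_right this)
  have efac : (1 - Λ * U) * (1 - Λ * U') = 1 + Λ * Λ - Λ * U - Λ * U' := by
    have : Λ * U * (Λ * U') = Λ * Λ := by
      rw [mul_assoc, ← mul_assoc U, ← cΛU.eq, mul_assoc Λ U, hUU', mul_one]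
    rw [sub_mul, mul_sub, mul_sub, this]
    noncomm_ring
  -- `N + N' - 1` is the two-sided series `∑ Λ ^ |i| U ^ i`, the Green function up to normalization.
  -- The second difference operator factors through `(1 - Λ U) (1 - Λ U')`, which maps this series
  -- to `1 - Λ²`.
  have egeo : (1 - Λ * U) * (1 - Λ * U') * (N + N' - 1) = 1 - Λ * Λ := by
    rw [mul_sub, mul_add, mul_assoc _ _ N', eN', cc.eq, mul_assoc _ _ N, eN, ← cc.eq, efac]
    noncomm_ring
  set G := (N + N' - 1) * Ki with hG
  have eA₀ : s⁻¹ • (U + U') - (p • 1 + q • B) =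
      s⁻¹ • (-(Λi * ((1 - Λ * U) * (1 - Λ * U')))) := by
    rw [eω, efac, ← smul_sub]
    congr 1
    have e1 : Λi * (Λ * Λ) = Λ := by rw [← mul_assoc, eΛ, one_mul]
    have e2 : Λi * (Λ * U) = U := by rw [← mul_assoc, eΛ, one_mul]
    have e3 : Λi * (Λ * U') = U' := by rw [← mul_assoc, eΛ, one_mul]
    rw [mul_sub, mul_sub, mul_add, e1, e2, e3]
    noncomm_ring
  have hAG : (s⁻¹ • (U + U') - (p • 1 + q • B)) * G = 1 := by
    rw [eA₀, hG, smul_mul_assoc, neg_mul, ← mul_assoc, mul_assoc Λi, egeo, mul_sub, mul_one,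
      ← mul_assoc Λi, eΛ, one_mul, ← neg_mul, neg_sub, ← smul_mul_assoc, ← eKs, eK]
  have hPGP : P * G * P = Ki * P := by
    rw [hG, mul_assoc, mul_assoc, cKiP.eq, ← mul_assoc, ← mul_assoc]
    -- Only the zeroth power of the translation leads from the line back to itself.
    have : P * (N + N' - 1) * P = P := by
      rw [mul_sub, mul_add, sub_mul, add_mul, proj_geom_proj nΛU cΛU hPP cΛP h1,
        proj_geom_proj nΛU' cΛU' hPP cΛP h2, mul_one, hPP, add_sub_cancel_right]
    rw [this]
  refine isUnit_sub_of_mul_eq_one (Y := Y) hAG ?_ ?_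
  · have : δ • P * G * (δ • P) * Y = δ • (P * (δ • (Ki * Y))) := by
      rw [smul_mul_assoc, smul_mul_assoc, smul_mul_assoc, mul_smul_comm, smul_mul_assoc, hPGP,
        mul_smul_comm, cKiP.eq, mul_assoc]
    rw [this, smul_mul_assoc, ← smul_add, ← mul_one_add P, ← eY]
  · have h3 : star (U + U') = U + U' := by
      rw [star_add, hstar, ← hstar, star_star, add_comm]
    refine IsSelfAdjoint.sub (IsSelfAdjoint.sub ?_ (IsSelfAdjoint.add ?_ ?_)) ?_
    · exact IsSelfAdjoint.smul (IsSelfAdjoint.all _) h3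
    · exact IsSelfAdjoint.smul (IsSelfAdjoint.all _) (IsSelfAdjoint.one A)
    · exact IsSelfAdjoint.smul (IsSelfAdjoint.all _) hB
    · exact IsSelfAdjoint.smul (IsSelfAdjoint.all _) hP

end Abstract

/-! ### Translations and the chain projection on `ℓ²(ℤ × ℤ)` -/

section

/-- The bounded operator of `ℓ²` with a given pointwise action. -/
noncomputable def mkVtx (f : (ℤ × ℤ → ℂ) →ₗ[ℂ] (ℤ × ℤ → ℂ)) (h : ∀ F, energy (f F) ≤ energy F) :
    Vtx →L[ℂ] Vtx :=
  LinearMap.mkContinuous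
    { toFun := fun F => ofEnergy (f F) (ne_top_of_le_ne_top (energy_ne_top F) (h F))
      map_add' := fun F G => lp.ext (map_add f (F : ℤ × ℤ → ℂ) G)
      map_smul' := fun z F => lp.ext (map_smul f z (F : ℤ × ℤ → ℂ)) } 1 fun F => by
    have h1 := h F
    rw [energy_coe] at h1
    change energy (ofEnergy (f F) (ne_top_of_le_ne_top (energy_ne_top F) (h F)) : ℤ × ℤ → ℂ) ≤
      _ at h1
    rw [energy_coe, ENNReal.ofReal_le_ofReal_iff (by positivity)] at h1
    rw [one_mul]
    exact (abs_le_of_sq_le_sq' h1 (norm_nonneg _)).2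

variable {f : (ℤ × ℤ → ℂ) →ₗ[ℂ] (ℤ × ℤ → ℂ)} {h : ∀ F, energy (f F) ≤ energy F}

theorem norm_mkVtx_le : ‖mkVtx f h‖ ≤ 1 := LinearMap.mkContinuous_norm_le _ zero_le_one _

/-- The translation of functions on the vertices. -/
noncomputable def trans (n m : ℤ) : Vtx →L[ℂ] Vtx :=
  mkVtx (LinearMap.funLeft ℂ ℂ (shift n m)) fun F => (energy_comp_equiv (shift n m) F).le

theorem trans_apply (n m : ℤ) (F : Vtx) (p : ℤ × ℤ) :
    (trans n m F : ℤ × ℤ → ℂ) p = F (p.1 + n, p.2 + m) := rfl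

theorem norm_trans_le (n m : ℤ) : ‖trans n m‖ ≤ 1 := norm_mkVtx_le

theorem trans_mul (n m n' m' : ℤ) : trans n m * trans n' m' = trans (n + n') (m + m') := by
  ext F p
  change F (p.1 + n + n', p.2 + m + m') = F (p.1 + (n + n'), p.2 + (m + m'))
  rw [add_assoc, add_assoc]

theorem trans_zero : trans 0 0 = 1 := by
  ext F p
  change F (p.1 + 0, p.2 + 0) = F p
  simp

theorem commute_trans (n m n' m' : ℤ) : Commute (trans n m) (trans n' m') := by
  rw [commute_iff_eq, trans_mul, trans_mul, add_comm n, add_comm m]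

theorem trans_pow (n m : ℤ) (k : ℕ) : trans n m ^ k = trans (k * n) (k * m) := by
  induction k with
  | zero => simp [trans_zero]
  | succ k ih =>
    rw [pow_succ, ih, trans_mul]
    push_cast
    congr 1 <;> ring

theorem star_trans (n m : ℤ) : star (trans n m) = trans (-n) (-m) := by
  rw [ContinuousLinearMap.star_eq_adjoint, eq_comm, ContinuousLinearMap.eq_adjoint_iff]
  intro F G
  rw [lp.inner_eq_tsum, lp.inner_eq_tsum, ← (shift n m).tsum_eq]
  refine tsum_congr fun p => ?_
  simp only [trans_apply, shift_apply, add_neg_cancel_right]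

/-- The restriction to the chain `i = 0`. -/
noncomputable def chain : Vtx →L[ℂ] Vtx :=
  mkVtx
    { toFun := fun F p => if p.1 = 0 then F p else 0
      map_add' := fun F G => by funext p; by_cases hp : p.1 = 0 <;> simp [hp]
      map_smul' := fun z F => by funext p; by_cases hp : p.1 = 0 <;> simp [hp] }
    fun F => energy_mono fun p => by by_cases hp : p.1 = 0 <;> simp [hp]

theorem chain_apply (F : Vtx) (p : ℤ × ℤ) :
    (chain F : ℤ × ℤ → ℂ) p = if p.1 = 0 then F p else 0 := rfl

theorem isSelfAdjoint_chain : IsSelfAdjoint chain := by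
  rw [IsSelfAdjoint, ContinuousLinearMap.star_eq_adjoint, eq_comm,
    ContinuousLinearMap.eq_adjoint_iff]
  intro F G
  rw [lp.inner_eq_tsum, lp.inner_eq_tsum]
  refine tsum_congr fun p => ?_
  simp only [chain_apply]
  split_ifs <;> simp

theorem chain_mul_chain : chain * chain = chain := by
  ext F p
  change (if p.1 = 0 then (if p.1 = 0 then F p else 0) else 0) = if p.1 = 0 then F p else 0
  split_ifs <;> rfl

theorem commute_trans_chain (m : ℤ) : Commute (trans 0 m) chain := by
  rw [commute_iff_eq]
  ext F p
  change (if p.1 + 0 = 0 then F (p.1 + 0, p.2 + m) else 0) =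
    if p.1 = 0 then F (p.1 + 0, p.2 + m) else 0
  rw [add_zero]

theorem chain_trans_chain {n : ℤ} (hn : n ≠ 0) (m : ℤ) : chain * trans n m * chain = 0 := by
  ext F p
  change (if p.1 = 0 then (if p.1 + n = 0 then F (p.1 + n, p.2 + m) else 0) else 0) = 0
  split_ifs with h1 h2
  · exact absurd (by omega) hn
  · rfl
  · rfl

/-- Half of the sum of the two translations along the chain. -/
noncomputable def hop : Vtx →L[ℂ] Vtx := (2⁻¹ : ℂ) • (trans 0 1 + trans 0 (-1))

theorem isSelfAdjoint_hop : IsSelfAdjoint hop := by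
  rw [hop, IsSelfAdjoint, star_smul, star_add, star_trans, star_trans, add_comm]
  simp

theorem norm_hop_le : ‖hop‖ ≤ 1 := by
  have := (norm_add_le (trans 0 1) (trans 0 (-1))).trans
    (add_le_add (norm_trans_le 0 1) (norm_trans_le 0 (-1)))
  rw [hop, norm_smul, norm_inv, Complex.norm_ofNat]
  linarith

theorem hop_apply (F : Vtx) (p : ℤ × ℤ) : (hop F : ℤ × ℤ → ℂ) p =
    2⁻¹ * (F (p.1, p.2 + 1) + F (p.1, p.2 - 1)) := by
  change (2⁻¹ : ℂ) * (F (p.1 + 0, p.2 + 1) + F (p.1 + 0, p.2 + -1)) = _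
  rw [add_zero, ← sub_eq_add_neg]

theorem commute_hop {T : Vtx →L[ℂ] Vtx} (h1 : Commute (trans 0 1) T)
    (h2 : Commute (trans 0 (-1)) T) : Commute hop T :=
  (h1.add_left h2).smul_left _

theorem spectrum_hop : spectrum ℝ hop ⊆ Icc (-1) 1 := by
  -- The bound of spectral values by the norm needs a unit of norm one, hence a nonzero space.
  have : Nontrivial Vtx := ⟨⟨lp.single 2 (0 : ℤ × ℤ) (1 : ℂ), 0, fun h => by
    have := congrArg (fun F : Vtx => F 0) h
    simp at this⟩⟩
  intro x hx
  have h1 := spectrum.norm_le_norm_of_mem hx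
  exact abs_le.1 (h1.trans norm_hop_le)

section
variable {a b γ γ' E : ℝ}

/-- The vertex operator is the abstract line perturbation, with `hop` as transversal part. The
variable `x` in `[-1, 1]` is the cosine of the quasimomentum along the chain, and `hδ` says that no
quasimomentum admits a bound state. -/
theorem isResolventPoint_of_mul_inv (ha : 0 < a) (hb : 0 < b) (hr : Regular a b E) {lam : ℝ → ℝ}
    (hc : ContinuousOn lam (Icc (-1) 1)) (hne : ∀ x ∈ Icc (-1 : ℝ) 1, lam x ≠ 0)
    (hlt : ∀ x ∈ Icc (-1 : ℝ) 1, |lam x| < 1)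
    (hω : ∀ x ∈ Icc (-1 : ℝ) 1, lam x + (lam x)⁻¹ =
      2 * cs E a + sn E a * (γ - 2 * (x - cs E b) / sn E b))
    (hδ : ∀ x ∈ Icc (-1 : ℝ) 1, lam x - (lam x)⁻¹ ≠ sn E a * (γ' - γ)) :
    IsResolventPoint (hamiltonian a b fun i _ => if i = 0 then γ' else γ) (E : ℂ) := by
  have hsa := hr.1
  have hsb := hr.2
  have hu := isUnit_perturbed (U := trans 1 0) (U' := trans (-1) 0) (B := hop) (P := chain)
    (by rw [trans_mul]; exact trans_zero) (by rw [trans_mul]; exact trans_zero)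
    (norm_trans_le _ _) (norm_trans_le _ _) (star_trans 1 0) isSelfAdjoint_hop isSelfAdjoint_chain
    (commute_hop (commute_trans _ _ _ _) (commute_trans _ _ _ _))
    (commute_hop (commute_trans _ _ _ _) (commute_trans _ _ _ _))
    (commute_hop (commute_trans_chain _) (commute_trans_chain _)) chain_mul_chain
    (fun n => by rw [trans_pow]; exact chain_trans_chain (by push_cast; omega) _)
    (fun n => by rw [trans_pow]; exact chain_trans_chain (by push_cast; omega) _)
    spectrum_hop (s := sn E a) (p := 2 * cs E a / sn E a + 2 * cs E b / sn E b + γ)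
    (q := -2 / sn E b) (δ := γ' - γ) hsa hc hne hlt
    (fun x hx => by rw [hω x hx]; field_simp; ring) hδ
  refine isResolventPoint_of_isUnit ha hb hr _ (fun F => ?_) hu
  have hsa' := snC_ne_zero hsa
  have hsb' := snC_ne_zero hsb
  funext p
  change (((sn E a)⁻¹ : ℝ) : ℂ) * (F (p.1 + 1, p.2 + 0) + F (p.1 + -1, p.2 + 0)) -
    (((2 * cs E a / sn E a + 2 * cs E b / sn E b + γ : ℝ) : ℂ) * F p +
      ((-2 / sn E b : ℝ) : ℂ) * (hop F : ℤ × ℤ → ℂ) p) -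
      ((γ' - γ : ℝ) : ℂ) * (if p.1 = 0 then F p else 0) = _
  rw [hop_apply, vertexOp]
  push_cast
  rw [← csC, ← csC, ← snC, ← snC]
  simp only [add_zero, ← sub_eq_add_neg]
  split_ifs <;> field_simp <;> ring

end

end

/-! ### Approximate eigenfunctions: energies in the spectrum -/

section

theorem energy_mul (f g : ℤ → ℂ) :
    energy (fun p : ℤ × ℤ => f p.1 * g p.2) = energy f * energy g := by
  unfold energy
  rw [ENNReal.tsum_prod', ← ENNReal.tsum_mul_right]
  refine tsum_congr fun i => ?_
  rw [← ENNReal.tsum_mul_left]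
  refine tsum_congr fun j => ?_
  rw [norm_mul, mul_pow, ENNReal.ofReal_mul (by positivity)]

/-- The energy of a finitely supported bounded function. -/
theorem energy_le_card {f : ℤ → ℂ} {s : Finset ℤ} {B : ℝ} (h0 : ∀ i ∉ s, f i = 0)
    (h : ∀ i, ‖f i‖ ≤ B) : energy f ≤ s.card * ENNReal.ofReal (B ^ 2) := by
  unfold energy
  rw [tsum_eq_sum (s := s) fun i hi => by simp [h0 i hi], ← nsmul_eq_mul]
  exact Finset.sum_le_card_nsmul _ _ _ fun i _ =>
    ENNReal.ofReal_le_ofReal (pow_le_pow_left₀ (norm_nonneg _) (h i) 2)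

/-- A truncated plane wave. -/
noncomputable def wave (z : ℂ) (N : ℕ) (i : ℤ) : ℂ := if 1 ≤ i ∧ i ≤ N then z ^ i else 0

variable {z : ℂ}

theorem energy_wave (hz : ‖z‖ = 1) (N : ℕ) : energy (wave z N) = N := by
  unfold energy
  rw [tsum_eq_sum (s := Finset.Icc (1 : ℤ) N) fun i hi => by
    rw [Finset.mem_Icc] at hi; simp [wave, hi]]
  rw [Finset.sum_congr rfl (g := fun _ => 1) fun i hi => by
    rw [Finset.mem_Icc] at hi; simp [wave, hi, hz]]
  simp

theorem norm_wave_le (hz : ‖z‖ = 1) (N : ℕ) (i : ℤ) : ‖wave z N i‖ ≤ 1 := by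
  unfold wave
  split_ifs <;> simp [hz]

/-- The geometric recursion fails only where the truncation starts and just after it ends, by at
most `2` each time. The bound `2 · 2² = 8` does not depend on the length `N`. -/
theorem energy_wave_sub_le (hz : ‖z‖ = 1) (N : ℕ) :
    energy (fun i => wave z N i - z * wave z N (i - 1)) ≤ 8 := by
  have hz0 : z ≠ 0 := by rintro rfl; simp at hz
  have h1 := energy_le_card (f := fun i => wave z N i - z * wave z N (i - 1))
    (s := {1, (N : ℤ) + 1}) (B := 2) (fun i hi => by
      simp only [Finset.mem_insert, Finset.mem_singleton, not_or] at hi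
      simp only [wave]
      by_cases h : 1 ≤ i ∧ i ≤ N
      · rw [if_pos h, if_pos (by omega), ← zpow_one_add₀ hz0, add_sub_cancel, sub_self]
      · rw [if_neg h, if_neg (by omega), mul_zero, sub_self])
    (fun i => by
      refine (norm_sub_le _ _).trans ?_
      rw [norm_mul, hz, one_mul]
      linarith [norm_wave_le hz N i, norm_wave_le hz N (i - 1)])
  refine h1.trans ?_
  have h2 : (({1, (N : ℤ) + 1} : Finset ℤ).card : ℝ≥0∞) ≤ 2 := by exact_mod_cast Finset.card_le_two
  calc _ ≤ 2 * ENNReal.ofReal (2 ^ 2) := by gcongr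
    _ = 8 := by
      rw [show (2 : ℝ) ^ 2 = ((4 : ℕ) : ℝ) by norm_num, ENNReal.ofReal_natCast]
      norm_num

/-- Approximate eigenfunctions of the discrete Laplacian on a half-line. -/
theorem exists_quasimode {x : ℝ} (hx : x ∈ Icc (-1 : ℝ) 1) (N : ℕ) : ∃ w : ℤ → ℂ,
    (∀ i ≤ 0, w i = 0) ∧ energy w = N ∧
      energy (fun i => w (i + 1) + w (i - 1) - 2 * x * w i) ≤ 32 := by
  set z : ℂ := Complex.exp (Real.arccos x * Complex.I) with hzd
  have hz : ‖z‖ = 1 := Complex.norm_exp_ofReal_mul_I _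
  have hz0 : z ≠ 0 := Complex.exp_ne_zero _
  have hx2 : 2 * (x : ℂ) = z + z⁻¹ := by
    rw [hzd, ← Complex.exp_neg, ← neg_mul, ← Complex.two_cos, ← Complex.ofReal_cos,
      Real.cos_arccos hx.1 hx.2]
  refine ⟨wave z N, fun i hi => ?_, energy_wave hz N, ?_⟩
  · rw [wave, if_neg (by omega)]
  set d : ℤ → ℂ := fun i => wave z N i - z * wave z N (i - 1) with hd
  have hd8 : energy d ≤ 8 := energy_wave_sub_le hz N
  have hd1 : energy (fun i => d (i + 1)) ≤ 8 :=
    (energy_comp_equiv (Equiv.addRight (1 : ℤ)) d).trans_le hd8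
  have hd2 : energy (fun i => -(z⁻¹ * d i)) ≤ 8 := by
    refine (energy_mono fun i => ?_).trans hd8
    rw [norm_neg, norm_mul, norm_inv, hz, inv_one, one_mul]
  -- With `2 x = z + z⁻¹` the second difference factors into two first-order ones, so its error
  -- comes from the two ends of the wave.
  have e : (fun i => wave z N (i + 1) + wave z N (i - 1) - 2 * x * wave z N i) =
      fun i => d (i + 1) + -(z⁻¹ * d i) := by
    funext i
    simp only [hd, hx2, add_sub_cancel_right]
    field_simp
    ring
  rw [e]
  refine (energy_add_le _ _).trans ?_
  calc _ ≤ 2 * (8 : ℝ≥0∞) + 2 * 8 := by gcongr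
    _ = 32 := by norm_num

theorem not_forall_nat_le {K : ℝ≥0∞} (hK : K ≠ ⊤) : ¬ ∀ N : ℕ, (N : ℝ≥0∞) ≤ K := fun h => by
  obtain ⟨n, hn⟩ := ENNReal.exists_nat_gt hK
  exact absurd (h n) (not_le.2 hn)

section
variable {a b E : ℝ} {c : ℤ → ℤ → ℝ}

theorem norm_csC_eq_one {E L : ℝ} (hs : sn E L = 0) : ‖csC E L‖ = 1 := by
  have h1 := cs_sq_add E L
  rw [hs] at h1
  rw [csC, Complex.norm_real, Real.norm_eq_abs, ← sq_eq_sq₀ (abs_nonneg _) zero_le_one, sq_abs]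
  linarith

/-- At the energies of the Dirichlet problem on the horizontal edges there is spectrum for all
couplings. -/
theorem not_isResolventPoint_of_left (ha : 0 < a) (hb : 0 < b) (hs : sn E a = 0) :
    ¬ IsResolventPoint (hamiltonian a b c) (E : ℂ) := by
  intro h
  obtain ⟨C, hC, hb⟩ := exists_energy_le_defect ha hb h
  have hz : ‖csC E a‖ = 1 := norm_csC_eq_one hs
  have hsC : snC E a = 0 := by simp [snC, hs]
  refine not_forall_nat_le (K := C * 8) (by finiteness) fun N => ?_
  -- Multiples of `sn` on the single row `j = 1`. They vanish at all vertices, so the coupling is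
  -- not felt, and the derivative condition asks for `β i = cs · β (i - 1)` with `|cs| = 1`.
  set β : Edge → ℂ := Sum.elim (fun p => wave (csC E a) N p.1 * wave 1 1 p.2)
    (fun _ => 0) with hβ
  have e1 : energy (wave 1 1) = 1 := by rw [energy_wave (by simp), Nat.cast_one]
  have eβ : energy β = N := by
    rw [energy_sum, show energy (fun p => β (.inr p)) = 0 from energy_eq_zero.2 fun _ => rfl,
      add_zero]
    change energy (fun p : ℤ × ℤ => wave (csC E a) N p.1 * wave 1 1 p.2) = N
    rw [energy_mul, e1, energy_wave hz, mul_one]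
  have hd : energy (defect a b E c 0 β) ≤ 8 := by
    have : defect a b E c 0 β = fun p : ℤ × ℤ =>
        (fun i => wave (csC E a) N i - csC E a * wave (csC E a) N (i - 1)) p.1 *
        wave 1 1 p.2 := by
      funext p
      simp only [defect, hβ, Sum.elim_inl, Sum.elim_inr, Pi.zero_apply]
      ring
    rw [this, energy_mul (fun i => wave (csC E a) N i - csC E a * wave (csC E a) N (i - 1)), e1,
      mul_one]
    exact energy_wave_sub_le hz N
  have h0 : energy (0 : Edge → ℂ) = 0 := energy_eq_zero.2 fun _ => rfl
  have := hb 0 β (by rw [h0]; simp) (by rw [eβ]; simp)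
    ⟨fun i j => by simp [hsC], fun i j => rfl, fun i j => by simp [hβ]⟩
  rw [h0, zero_add, eβ] at this
  exact this.trans (by gcongr)

/-- At the energies of the Dirichlet problem on the vertical edges there is spectrum for all
couplings. -/
theorem not_isResolventPoint_of_right (ha : 0 < a) (hb : 0 < b) (hs : sn E b = 0) :
    ¬ IsResolventPoint (hamiltonian a b c) (E : ℂ) := by
  intro h
  obtain ⟨C, hC, hb⟩ := exists_energy_le_defect ha hb h
  have hz : ‖csC E b‖ = 1 := norm_csC_eq_one hs
  have hsC : snC E b = 0 := by simp [snC, hs]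
  refine not_forall_nat_le (K := C * 8) (by finiteness) fun N => ?_
  set β : Edge → ℂ := Sum.elim (fun _ => 0)
    (fun p => wave 1 1 p.1 * wave (csC E b) N p.2) with hβ
  have e1 : energy (wave 1 1) = 1 := by rw [energy_wave (by simp), Nat.cast_one]
  have eβ : energy β = N := by
    rw [energy_sum, show energy (fun p => β (.inl p)) = 0 from energy_eq_zero.2 fun _ => rfl,
      zero_add]
    change energy (fun p : ℤ × ℤ => wave 1 1 p.1 * wave (csC E b) N p.2) = N
    rw [energy_mul, e1, energy_wave hz, one_mul]
  have hd : energy (defect a b E c 0 β) ≤ 8 := by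
    have : defect a b E c 0 β = fun p : ℤ × ℤ => wave 1 1 p.1 *
        (fun i => wave (csC E b) N i - csC E b * wave (csC E b) N (i - 1)) p.2 := by
      funext p
      simp only [defect, hβ, Sum.elim_inl, Sum.elim_inr, Pi.zero_apply]
      ring
    rw [this, energy_mul _ fun i => wave (csC E b) N i - csC E b * wave (csC E b) N (i - 1), e1,
      one_mul]
    exact energy_wave_sub_le hz N
  have h0 : energy (0 : Edge → ℂ) = 0 := energy_eq_zero.2 fun _ => rfl
  have := hb 0 β (by rw [h0]; simp) (by rw [eβ]; simp)
    ⟨fun i j => by simp [hβ], fun i j => rfl, fun i j => by simp [hsC]⟩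
  rw [h0, zero_add, eβ] at this
  exact this.trans (by gcongr)

/-- At a regular point of the resolvent set the vertex equation is bounded below. -/
theorem exists_energy_le_vertexOp (ha : 0 < a) (hb : 0 < b) (hr : Regular a b E)
    (h : IsResolventPoint (hamiltonian a b c) (E : ℂ)) : ∃ C : ℝ≥0∞, C ≠ ⊤ ∧
      ∀ F : ℤ × ℤ → ℂ, energy F ≠ ⊤ → energy F ≤ C * energy (vertexOp a b E c F) := by
  obtain ⟨C, hC, hbd⟩ := exists_energy_le_defect ha hb h
  have hsa := snC_ne_zero hr.1
  have hsb := snC_ne_zero hr.2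
  refine ⟨C, hC, fun F hF => ?_⟩
  -- Interpolating `F` along the edges gives continuous functions whose defect is exactly the vertex
  -- operator.
  set α : Edge → ℂ := fun e => F (org e) with hα
  set β : Edge → ℂ := fun e =>
    (F (tgt e) + -(csC E (len a b e) * F (org e))) / snC E (len a b e) with hβ
  have hαt : energy α ≠ ⊤ := by rw [energy_comp_org]; finiteness
  have htt : energy (fun e => F (tgt e)) ≠ ⊤ := by rw [energy_comp_tgt]; finiteness
  have hβt : energy β ≠ ⊤ := by
    set M := (1 + max ‖csC E a‖ ‖csC E b‖) * max ‖snC E a‖⁻¹ ‖snC E b‖⁻¹ with hM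
    have hcs : ∀ e, ‖csC E (len a b e)‖ ≤ max ‖csC E a‖ ‖csC E b‖ := by
      rintro (e | e)
      exacts [le_max_left _ _, le_max_right _ _]
    have hsn : ∀ e, ‖snC E (len a b e)‖⁻¹ ≤ max ‖snC E a‖⁻¹ ‖snC E b‖⁻¹ := by
      rintro (e | e)
      exacts [le_max_left _ _, le_max_right _ _]
    have h1 := energy_le_add (x := β) (p := fun e => M * ‖F (tgt e)‖)
      (q := fun e => M * ‖F (org e)‖) fun e => by
        rw [← mul_add, hβ, norm_div, div_eq_mul_inv, hM]
        have h2 := norm_add_le (F (tgt e)) (-(csC E (len a b e) * F (org e)))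
        rw [norm_neg, norm_mul] at h2
        have h3 : ‖csC E (len a b e)‖ * ‖F (org e)‖ ≤
          max ‖csC E a‖ ‖csC E b‖ * ‖F (org e)‖ := by gcongr; exact hcs e
        have h4 : ‖F (tgt e) + -(csC E (len a b e) * F (org e))‖ ≤
            (1 + max ‖csC E a‖ ‖csC E b‖) * (‖F (tgt e)‖ + ‖F (org e)‖) := by
          have : 0 ≤ max ‖csC E a‖ ‖csC E b‖ := (norm_nonneg _).trans (le_max_left _ _)
          nlinarith [norm_nonneg (F (tgt e)), norm_nonneg (F (org e))]
        calc _ ≤ (1 + max ‖csC E a‖ ‖csC E b‖) * (‖F (tgt e)‖ + ‖F (org e)‖) *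
              max ‖snC E a‖⁻¹ ‖snC E b‖⁻¹ := by gcongr; exact hsn e
          _ = _ := by ring
    rw [energy_norm_mul, energy_norm_mul] at h1
    exact ne_top_of_le_ne_top (by finiteness) h1
  have hm : MatchesAtVertices a b E α β := by
    refine ⟨fun i j => ?_, fun i j => rfl, fun i j => ?_⟩
    · simp [hα, hβ, org, tgt, len]
      field_simp
      ring
    · simp [hα, hβ, org, tgt, len]
      field_simp
      ring
  have hd : defect a b E c α β = vertexOp a b E c F := by
    funext ⟨i, j⟩
    have e1 := csC_sq_add E a
    have e2 := csC_sq_add E b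
    simp only [defect, vertexOp, hα, hβ, org, tgt, len, Sum.elim_inl, Sum.elim_inr, id,
      shift_apply, sub_add_cancel, add_zero]
    have r1 : -(E * F (i - 1, j) * snC E a) + (F (i, j) - F (i - 1, j) * csC E a) / snC E a *
        csC E a = (F (i, j) * csC E a - F (i - 1, j)) / snC E a := by
      field_simp
      linear_combination -F (i - 1, j) * e1
    have r2 : -(E * F (i, j - 1) * snC E b) + (F (i, j) - F (i, j - 1) * csC E b) / snC E b *
        csC E b = (F (i, j) * csC E b - F (i, j - 1)) / snC E b := by
      field_simp
      linear_combination -F (i, j - 1) * e2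
    linear_combination -r1 - r2
  have := hbd α β hαt hβt hm
  rw [hd] at this
  refine le_trans ?_ (le_self_add.trans this)
  rw [energy_comp_org, two_mul]
  exact le_self_add

/-- Bloch waves supported away from the chain. -/
theorem not_isResolventPoint_of_bloch (ha : 0 < a) (hb : 0 < b) (hr : Regular a b E) {γ x y : ℝ}
    (hc : ∀ i j, i ≠ 0 → c i j = γ) (hx : x ∈ Icc (-1 : ℝ) 1) (hy : y ∈ Icc (-1 : ℝ) 1)
    (h : γ = 2 * (x - cs E a) / sn E a + 2 * (y - cs E b) / sn E b) :
    ¬ IsResolventPoint (hamiltonian a b c) (E : ℂ) := by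
  intro hres
  obtain ⟨C, hC, hbd⟩ := exists_energy_le_vertexOp ha hb hr hres
  have hsa := snC_ne_zero hr.1
  have hsb := snC_ne_zero hr.2
  have hγ : (γ : ℂ) = 2 * (x - csC E a) / snC E a + 2 * (y - csC E b) / snC E b := by
    rw [h, csC, csC, snC, snC]
    push_cast
    ring
  set Ka := ENNReal.ofReal (‖snC E a‖⁻¹ ^ 2)
  set Kb := ENNReal.ofReal (‖snC E b‖⁻¹ ^ 2)
  refine not_forall_nat_le (K := C * (2 * (Ka * 32) + 2 * (Kb * 32))) (by finiteness) fun N => ?_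
  rcases Nat.eq_zero_or_pos N with rfl | hN
  · simp
  -- The transversal factor vanishes for `i ≤ 0`, so the altered coupling on the chain is never
  -- seen.
  obtain ⟨w, hw0, hwN, hwr⟩ := exists_quasimode hx N
  obtain ⟨z, -, hzN, hzr⟩ := exists_quasimode hy N
  set r : ℤ → ℂ := fun i => w (i + 1) + w (i - 1) - 2 * x * w i with hrd
  set t : ℤ → ℂ := fun i => z (i + 1) + z (i - 1) - 2 * y * z i with htd
  have hv : vertexOp a b E c (fun p => w p.1 * z p.2) = fun p =>
      r p.1 * z p.2 / snC E a + w p.1 * t p.2 / snC E b := by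
    funext p
    have hcw : (c p.1 p.2 : ℂ) * (w p.1 * z p.2) = γ * (w p.1 * z p.2) := by
      by_cases hp : p.1 = 0
      · rw [hw0 p.1 hp.le]; simp
      · rw [hc _ _ hp]
    simp only [vertexOp, hcw, hrd, htd, hγ]
    field_simp
    ring
  have e0 : energy (fun p : ℤ × ℤ => w p.1 * z p.2) = N * N := by rw [energy_mul, hwN, hzN]
  have h1 := hbd (fun p => w p.1 * z p.2) (by rw [e0]; finiteness)
  rw [e0, hv] at h1
  have k1 : energy (fun p : ℤ × ℤ => r p.1 * z p.2 / snC E a) ≤ Ka * 32 * N := by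
    refine (energy_le_of_le (B := ‖snC E a‖⁻¹) (y := fun p : ℤ × ℤ => r p.1 * z p.2)
      fun p => ?_).trans ?_
    · rw [norm_div, div_eq_inv_mul]
    · rw [energy_mul, hzN, mul_assoc]
      gcongr
  have k2 : energy (fun p : ℤ × ℤ => w p.1 * t p.2 / snC E b) ≤ Kb * 32 * N := by
    refine (energy_le_of_le (B := ‖snC E b‖⁻¹) (y := fun p : ℤ × ℤ => w p.1 * t p.2)
      fun p => ?_).trans ?_
    · rw [norm_div, div_eq_inv_mul]
    · rw [energy_mul, hwN, mul_assoc, mul_comm (32 : ℝ≥0∞)]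
      gcongr
  -- The trial function has energy `N²`, but the error sits on the boundary of an `N × N` square and
  -- is of order `N`.
  have h2 : (N : ℝ≥0∞) * N ≤ C * (2 * (Ka * 32) + 2 * (Kb * 32)) * N := by
    refine h1.trans ?_
    calc _ ≤ C * (2 * (Ka * 32 * N) + 2 * (Kb * 32 * N)) := by
          gcongr
          exact (energy_add_le _ _).trans (by gcongr)
      _ = _ := by ring
  exact (ENNReal.mul_le_mul_iff_left (by simp; omega) (by simp)).1 h2

/-- Waves along the chain that decay away from it. -/
theorem not_isResolventPoint_of_guided (ha : 0 < a) (hb : 0 < b) (hr : Regular a b E)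
    {γ γ' x lam : ℝ} (hx : x ∈ Icc (-1 : ℝ) 1) (h0 : lam ≠ 0) (h1 : |lam| < 1)
    (hω : lam + lam⁻¹ = 2 * cs E a + sn E a * (γ - 2 * (x - cs E b) / sn E b))
    (hδ : lam - lam⁻¹ = sn E a * (γ' - γ)) :
    ¬ IsResolventPoint (hamiltonian a b fun i _ => if i = 0 then γ' else γ) (E : ℂ) := by
  intro hres
  obtain ⟨C, hC, hbd⟩ := exists_energy_le_vertexOp ha hb hr hres
  have hsa := snC_ne_zero hr.1
  have hsb := snC_ne_zero hr.2
  have hl0 : (lam : ℂ) ≠ 0 := by exact_mod_cast h0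
  have hωC : (lam : ℂ) + (lam : ℂ)⁻¹ =
      2 * csC E a + snC E a * (γ - 2 * (x - csC E b) / snC E b) := by
    have := congrArg (fun t : ℝ => (t : ℂ)) hω
    push_cast at this
    exact this
  have hδC : (lam : ℂ) - (lam : ℂ)⁻¹ = snC E a * (γ' - γ) := by
    have := congrArg (fun t : ℝ => (t : ℂ)) hδ
    push_cast at this
    exact this
  -- The bound state across the chain. It solves the transversal recursion exactly, so only the
  -- truncation along the chain produces an error.
  set g : ℤ → ℂ := fun i => (lam : ℂ) ^ i.natAbs with hg
  have hgtop : energy g ≠ ⊤ := by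
    have h2 : |lam| ^ 2 < 1 := by nlinarith [abs_nonneg lam]
    have hs : Summable fun n : ℕ => (|lam| ^ 2) ^ n :=
      summable_geometric_of_lt_one (by positivity) h2
    have hs' : Summable fun i : ℤ => (|lam| ^ 2) ^ i.natAbs :=
      Summable.of_nat_of_neg (by simpa using hs) (by simpa using hs)
    have : energy g = ∑' i : ℤ, ENNReal.ofReal ((|lam| ^ 2) ^ i.natAbs) := by
      refine tsum_congr fun i => ?_
      rw [hg, norm_pow, Complex.norm_real, Real.norm_eq_abs, pow_right_comm]
    rw [this, ← ENNReal.ofReal_tsum_of_nonneg (fun i => by positivity) hs']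
    exact ENNReal.ofReal_ne_top
  have hg0 : energy g ≠ 0 := fun h => by
    have := energy_eq_zero.1 h 0
    simp [hg] at this
  set Kb := ENNReal.ofReal (‖snC E b‖⁻¹ ^ 2)
  refine not_forall_nat_le (K := C * (Kb * 32)) (by finiteness) fun N => ?_
  obtain ⟨w, -, hwN, hwr⟩ := exists_quasimode hx N
  set r : ℤ → ℂ := fun i => w (i + 1) + w (i - 1) - 2 * x * w i with hrd
  have hrec : ∀ i : ℤ, (g (i + 1) + g (i - 1) - 2 * csC E a * g i) / snC E a =
      ((if i = 0 then γ' else γ : ℝ) - 2 * (x - csC E b) / snC E b) * g i := by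
    intro i
    have hpos : ∀ n : ℕ, g (n + 1) = lam * g n := fun n => by
      simp only [hg, show ((n : ℤ) + 1).natAbs = n + 1 by omega, Int.natAbs_natCast, pow_succ']
    have hneg : ∀ i, g (-i) = g i := fun i => by simp [hg]
    have key : ∀ n : ℕ, g (n + 2) + g n = (lam + (lam : ℂ)⁻¹) * g (n + 1) := fun n => by
      have e1 := hpos n
      have e2 := hpos (n + 1)
      push_cast at e2
      rw [add_assoc, one_add_one_eq_two] at e2
      rw [e2, e1]
      field_simp
    rw [div_eq_iff hsa]
    rcases lt_trichotomy i 0 with hi | rfl | hi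
    · rw [if_neg hi.ne]
      obtain ⟨n, rfl⟩ : ∃ n : ℕ, i = -((n : ℤ) + 1) := ⟨(-i - 1).toNat, by omega⟩
      have e := key n
      rw [hωC] at e
      rw [show -((n : ℤ) + 1) + 1 = -n by ring, show -((n : ℤ) + 1) - 1 = -(n + 2) by ring, hneg,
        hneg, hneg]
      linear_combination e
    -- On the chain both neighbours equal `λ`, and `2 λ = (λ + 1/λ) + (λ - 1/λ)` replaces `γ` by
    -- `γ'`.
    · have e1 : g 0 = 1 := by simp [hg]
      have e2 : g 1 = lam := by simp [hg]
      have e3 : g (-1) = lam := by simp [hg]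
      simp only [if_true, zero_add, zero_sub, e1, e2, e3]
      linear_combination hωC + hδC
    · rw [if_neg hi.ne']
      obtain ⟨n, rfl⟩ : ∃ n : ℕ, i = (n : ℤ) + 1 := ⟨(i - 1).toNat, by omega⟩
      have e := key n
      rw [hωC] at e
      rw [show (n : ℤ) + 1 + 1 = n + 2 by ring, add_sub_cancel_right]
      linear_combination e
  have hv : vertexOp a b E (fun i _ => if i = 0 then γ' else γ) (fun p => g p.1 * w p.2) =
      fun p => g p.1 * r p.2 / snC E b := by
    funext p
    have e := hrec p.1
    have e2 : (g (p.1 + 1) * w p.2 + g (p.1 - 1) * w p.2 - 2 * csC E a * (g p.1 * w p.2)) /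
        snC E a = (g (p.1 + 1) + g (p.1 - 1) - 2 * csC E a * g p.1) / snC E a * w p.2 := by ring
    simp only [vertexOp, hrd]
    rw [e2, e]
    field_simp
    ring
  have e0 : energy (fun p : ℤ × ℤ => g p.1 * w p.2) = energy g * N := by rw [energy_mul, hwN]
  have h2 := hbd (fun p => g p.1 * w p.2) (by rw [e0]; finiteness)
  rw [e0, hv] at h2
  have k2 : energy (fun p : ℤ × ℤ => g p.1 * r p.2 / snC E b) ≤ Kb * (energy g * 32) := by
    refine (energy_le_of_le (B := ‖snC E b‖⁻¹) (y := fun p : ℤ × ℤ => g p.1 * r p.2)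
      fun p => ?_).trans ?_
    · rw [norm_div, div_eq_inv_mul]
    · rw [energy_mul]
      gcongr
  have h3 : energy g * (N : ℝ≥0∞) ≤ energy g * (C * (Kb * 32)) := by
    refine (h2.trans (mul_le_mul_right k2 C)).trans_eq (by ring)
  exact (ENNReal.mul_le_mul_iff_right hg0 hgtop).1 h3

end

end

/-! ### Spectral criteria at regular energies -/

section
variable {a b γ γ' E : ℝ}

theorem le_div_sn {L : ℝ} (h : sn E L ≠ 0) {x : ℝ} (hx : x ∈ Icc (-1 : ℝ) 1) :
    (x - cs E L) / sn E L ∈ Icc (lo L E) (up L E) := by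
  rcases h.lt_or_gt with h | h
  · rw [up_of_neg h, lo_of_neg h]
    exact ⟨div_le_div_of_nonpos_of_le h.le (by linarith [hx.2]),
      div_le_div_of_nonpos_of_le h.le (by linarith [hx.1])⟩
  · rw [up_of_pos h, lo_of_pos h]
    exact ⟨div_le_div_of_nonneg_right (by linarith [hx.1]) h.le,
      div_le_div_of_nonneg_right (by linarith [hx.2]) h.le⟩

theorem exists_eq_div_sn {L : ℝ} (h : sn E L ≠ 0) {t : ℝ} (ht : t ∈ Icc (lo L E) (up L E)) :
    ∃ x ∈ Icc (-1 : ℝ) 1, t = (x - cs E L) / sn E L := by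
  refine ⟨t * sn E L + cs E L, ?_, by field_simp; ring⟩
  rcases h.lt_or_gt with h | h
  · rw [up_of_neg h, lo_of_neg h] at ht
    have h1 := (div_le_iff_of_neg h).1 ht.1
    have h2 := (le_div_iff_of_neg h).1 ht.2
    constructor <;> linarith
  · rw [up_of_pos h, lo_of_pos h] at ht
    have h1 := (div_le_iff₀ h).1 ht.1
    have h2 := (le_div_iff₀ h).1 ht.2
    constructor <;> linarith

/-- The discriminant of the recursion transversal to the chain. -/
noncomputable def disc (a E X : ℝ) : ℝ := (X - 2 * up a E) * (X - 2 * lo a E)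

/-- The right-hand side is the discriminant of `λ² - (2 cs + sn X) λ + 1`, whose roots coincide
exactly when `X / 2` is an end of the one-edge dispersion. -/
theorem disc_eq (h : sn E a ≠ 0) (X : ℝ) :
    sn E a ^ 2 * disc a E X = (2 * cs E a + sn E a * X) ^ 2 - 4 := by
  have h1 : |sn E a| ≠ 0 := abs_ne_zero.2 h
  have h2 : sn E a ^ 2 * (1 / |sn E a|) ^ 2 = 1 := by
    rw [one_div, inv_pow, sq_abs]
    exact mul_inv_cancel₀ (pow_ne_zero 2 h)
  have h3 : sn E a * (cs E a / sn E a) = cs E a := mul_div_cancel₀ _ h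
  have h4 : disc a E X = (X + 2 * (cs E a / sn E a)) ^ 2 - 4 * (1 / |sn E a|) ^ 2 := by
    rw [disc, up, lo]; ring
  rw [h4]
  linear_combination (-4) * h2 +
    (2 * sn E a * X + 2 * sn E a * (cs E a / sn E a) + 2 * cs E a) * 2 * h3

theorem sn_mul_eq (h : sn E a ≠ 0) (X : ℝ) :
    sn E a * (2 * cs E a + sn E a * X) = sn E a ^ 2 * (X - up a E - lo a E) := by
  have h3 : sn E a * (cs E a / sn E a) = cs E a := mul_div_cancel₀ _ h
  have : X - up a E - lo a E = X + 2 * (cs E a / sn E a) := by rw [up, lo]; ring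
  rw [this]
  linear_combination (-2 * sn E a) * h3

/-- The decaying solution of the recursion transversal to the chain. -/
theorem decaying (h : sn E a ≠ 0) {X K : ℝ} (hK : K ^ 2 = disc a E X)
    (hs : K * (X - up a E - lo a E) < 0) :
    (2 * cs E a + sn E a * X + sn E a * K) / 2 ≠ 0 ∧
    |(2 * cs E a + sn E a * X + sn E a * K) / 2| < 1 ∧
    ((2 * cs E a + sn E a * X + sn E a * K) / 2)⁻¹ =
      (2 * cs E a + sn E a * X - sn E a * K) / 2 := by
  have h1 := disc_eq h X
  have h2 := sn_mul_eq h X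
  have hp : (2 * cs E a + sn E a * X + sn E a * K) / 2 *
      ((2 * cs E a + sn E a * X - sn E a * K) / 2) = 1 := by
    rw [← hK] at h1
    linear_combination (-1 / 4) * h1
  set l := (2 * cs E a + sn E a * X + sn E a * K) / 2 with hl
  set m := (2 * cs E a + sn E a * X - sn E a * K) / 2 with hm
  have hne : l ≠ 0 := left_ne_zero_of_mul_eq_one hp
  refine ⟨hne, ?_, inv_eq_of_mul_eq_one_right hp⟩
  -- The two roots have product one, so the smaller one in modulus decays. The sign of `l² - m² = (l
  -- - m) (l + m)` tells which one it is.
  have h3 : l ^ 2 - m ^ 2 = sn E a ^ 2 * (K * (X - up a E - lo a E)) := by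
    rw [hl, hm]
    linear_combination K * h2
  have h4 : l ^ 2 < m ^ 2 := by
    have : 0 < sn E a ^ 2 := by positivity
    nlinarith
  rw [← sq_lt_one_iff_abs_lt_one]
  have h5 : l ^ 2 * m ^ 2 = 1 := by rw [← mul_pow, hp, one_pow]
  by_contra! h6
  nlinarith

theorem mem_Icc_of_mem (h : sn E b ≠ 0) {x : ℝ} (hx : x ∈ Icc (-1 : ℝ) 1) :
    γ - 2 * (x - cs E b) / sn E b ∈ Icc (γ - 2 * up b E) (γ - 2 * lo b E) := by
  have := le_div_sn h hx
  rw [mul_div_assoc]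
  constructor <;> linarith [this.1, this.2]

/-- One sign `ε` of the square root selects the decaying root for all quasimomenta at once, so this
root is a continuous function and enters the functional calculus. -/
theorem isResolventPoint_of_disc (ha : 0 < a) (hb : 0 < b) (hr : Regular a b E) {ε : ℝ}
    (hε : ε ^ 2 = 1)
    (h0 : ∀ X ∈ Icc (γ - 2 * up b E) (γ - 2 * lo b E), 0 < disc a E X ∧
      ε * (X - up a E - lo a E) < 0)
    (hδ : ∀ X ∈ Icc (γ - 2 * up b E) (γ - 2 * lo b E), ε * √(disc a E X) ≠ γ' - γ) :
    IsResolventPoint (hamiltonian a b fun i _ => if i = 0 then γ' else γ) (E : ℂ) := by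
  set X : ℝ → ℝ := fun x => γ - 2 * (x - cs E b) / sn E b with hX
  have hXm : ∀ x ∈ Icc (-1 : ℝ) 1, X x ∈ Icc (γ - 2 * up b E) (γ - 2 * lo b E) :=
    fun x hx => mem_Icc_of_mem hr.2 hx
  have hdec : ∀ x ∈ Icc (-1 : ℝ) 1, _ := fun x hx =>
    decaying (X := X x) (K := ε * √(disc a E (X x))) hr.1
      (by rw [mul_pow, hε, one_mul, Real.sq_sqrt (h0 _ (hXm x hx)).1.le])
      (by
        rw [mul_right_comm]
        exact mul_neg_of_neg_of_pos (h0 _ (hXm x hx)).2 (Real.sqrt_pos.2 (h0 _ (hXm x hx)).1))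
  refine isResolventPoint_of_mul_inv ha hb hr
    (lam := fun x => (2 * cs E a + sn E a * X x + sn E a * (ε * √(disc a E (X x)))) / 2) ?_
    (fun x hx => (hdec x hx).1) (fun x hx => (hdec x hx).2.1) (fun x hx => ?_) (fun x hx => ?_)
  · unfold disc
    fun_prop
  · rw [(hdec x hx).2.2]
    ring
  · rw [(hdec x hx).2.2]
    intro h
    refine hδ _ (hXm x hx) (mul_left_cancel₀ hr.1 ?_)
    rw [← h]
    ring

theorem not_isResolventPoint_of_disc (ha : 0 < a) (hb : 0 < b) (hr : Regular a b E) {X : ℝ}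
    (hX : X ∈ Icc (γ - 2 * up b E) (γ - 2 * lo b E)) (h : (γ' - γ) ^ 2 = disc a E X)
    (hs : (γ' - γ) * (X - up a E - lo a E) < 0) :
    ¬ IsResolventPoint (hamiltonian a b fun i _ => if i = 0 then γ' else γ) (E : ℂ) := by
  obtain ⟨x, hx, hxX⟩ := exists_eq_div_sn hr.2 (t := (γ - X) / 2)
    ⟨by linarith [hX.2], by linarith [hX.1]⟩
  obtain ⟨h1, h2, h3⟩ := decaying hr.1 h hs
  refine not_isResolventPoint_of_guided ha hb hr hx h1 h2 ?_ ?_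
  · rw [h3, mul_div_assoc, ← hxX]
    ring
  · rw [h3]
    ring

/-- Here `X > 2 up a` for every quasimomentum, so the discriminant is positive and increases with
`X`; its extremes are attained at the ends of the interval of `X`. Decay selects the negative square
root, hence `γ' < γ`, and the intermediate value theorem supplies the quasimomentum of a guided
wave. -/
theorem mem_σ₁_iff_above (ha : 0 < a) (hb : 0 < b) (hr : Regular a b E)
    (hγ : 2 * up a E + 2 * up b E < γ) : E ∈ σ₁ a b γ γ' ↔
      γ' < γ ∧ minAbove a b γ E ≤ (γ' - γ) ^ 2 ∧ (γ' - γ) ^ 2 ≤ maxAbove a b γ E := by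
  have hla := lo_lt_up hr.1
  have hlb := lo_lt_up hr.2
  have hpos : ∀ X ∈ Icc (γ - 2 * up b E) (γ - 2 * lo b E), 2 * up a E < X :=
    fun X hX => by linarith [hX.1]
  have hD : ∀ X ∈ Icc (γ - 2 * up b E) (γ - 2 * lo b E), 0 < disc a E X := fun X hX =>
    mul_pos (by linarith [hpos X hX]) (by linarith [hpos X hX])
  constructor
  · intro h
    by_contra hn
    refine h (isResolventPoint_of_disc (ε := -1) ha hb hr (by norm_num)
      (fun X hX => ⟨hD X hX, by linarith [hpos X hX]⟩) fun X hX hXe => hn ?_)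
    have h1 := Real.sqrt_pos.2 (hD X hX)
    have h2 : (γ' - γ) ^ 2 = disc a E X := by
      rw [← hXe, mul_pow, Real.sq_sqrt (hD X hX).le]; norm_num
    have h3 := hpos X hX
    rw [h2, minAbove, maxAbove, disc]
    refine ⟨by linarith, ?_, ?_⟩
    · exact mul_le_mul (by linarith [hX.1]) (by linarith [hX.1]) (by linarith) (by linarith)
    · exact mul_le_mul (by linarith [hX.2]) (by linarith [hX.2]) (by linarith) (by linarith [hX.2])
  · rintro ⟨h1, h2, h3⟩
    have hcont : ContinuousOn (disc a E) (Icc (γ - 2 * up b E) (γ - 2 * lo b E)) := by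
      unfold disc
      fun_prop
    obtain ⟨X, hX, hXd⟩ := intermediate_value_Icc (by linarith) hcont ⟨h2, h3⟩
    exact not_isResolventPoint_of_disc ha hb hr hX hXd.symm
      (mul_neg_of_neg_of_pos (by linarith) (by linarith [hpos X hX]))

/-- The mirror image: `X < 2 lo a`, the discriminant decreases with `X`, and decay selects the
positive square root. -/
theorem mem_σ₁_iff_below (ha : 0 < a) (hb : 0 < b) (hr : Regular a b E)
    (hγ : γ < 2 * lo a E + 2 * lo b E) : E ∈ σ₁ a b γ γ' ↔
      γ < γ' ∧ minBelow a b γ E ≤ (γ' - γ) ^ 2 ∧ (γ' - γ) ^ 2 ≤ maxBelow a b γ E := by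
  have hla := lo_lt_up hr.1
  have hlb := lo_lt_up hr.2
  have hpos : ∀ X ∈ Icc (γ - 2 * up b E) (γ - 2 * lo b E), X < 2 * lo a E :=
    fun X hX => by linarith [hX.2]
  have hD : ∀ X ∈ Icc (γ - 2 * up b E) (γ - 2 * lo b E), 0 < disc a E X := fun X hX =>
    mul_pos_of_neg_of_neg (by linarith [hpos X hX]) (by linarith [hpos X hX])
  have e1 : minBelow a b γ E = disc a E (γ - 2 * lo b E) := by rw [minBelow, disc]; ring
  have e2 : maxBelow a b γ E = disc a E (γ - 2 * up b E) := by rw [maxBelow, disc]; ring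
  constructor
  · intro h
    by_contra hn
    refine h (isResolventPoint_of_disc (ε := 1) ha hb hr (by norm_num)
      (fun X hX => ⟨hD X hX, by linarith [hpos X hX]⟩) fun X hX hXe => hn ?_)
    have h1 := Real.sqrt_pos.2 (hD X hX)
    have h2 : (γ' - γ) ^ 2 = disc a E X := by
      rw [← hXe, mul_pow, Real.sq_sqrt (hD X hX).le]; norm_num
    have h3 := hpos X hX
    have e3 : disc a E X = (2 * up a E - X) * (2 * lo a E - X) := by rw [disc]; ring
    rw [h2, minBelow, maxBelow, e3]
    refine ⟨by linarith, ?_, ?_⟩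
    · exact mul_le_mul (by linarith [hX.2]) (by linarith [hX.2]) (by linarith) (by linarith)
    · exact mul_le_mul (by linarith [hX.1]) (by linarith [hX.1]) (by linarith) (by linarith [hX.1])
  · rintro ⟨h1, h2, h3⟩
    have hcont : ContinuousOn (disc a E) (Icc (γ - 2 * up b E) (γ - 2 * lo b E)) := by
      unfold disc
      fun_prop
    obtain ⟨X, hX, hXd⟩ := intermediate_value_Icc' (by linarith) hcont
      ⟨e1.symm.trans_le h2, h3.trans_eq e2⟩
    exact not_isResolventPoint_of_disc ha hb hr hX hXd.symm
      (mul_neg_of_pos_of_neg (by linarith) (by linarith [hpos X hX]))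

/-- Division by `|sn a · sn b|`. The undivided form makes sense at Dirichlet energies too and is
continuous in `E`, which yields closedness of the spectrum. -/
theorem band_condition_iff (hr : Regular a b E) :
    |2 * cs E a * sn E b + 2 * cs E b * sn E a + γ * sn E a * sn E b| ≤
      2 * |sn E a| + 2 * |sn E b| ↔
    2 * lo a E + 2 * lo b E ≤ γ ∧ γ ≤ 2 * up a E + 2 * up b E := by
  have ha := abs_pos.2 hr.1
  have hb := abs_pos.2 hr.2
  have hsa := hr.1
  have hsb := hr.2
  have e1 : 2 * cs E a * sn E b + 2 * cs E b * sn E a + γ * sn E a * sn E b =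
      (2 * (cs E a / sn E a) + 2 * (cs E b / sn E b) + γ) * (sn E a * sn E b) := by
    field_simp
  have e2 : 2 * |sn E a| + 2 * |sn E b| =
      (2 * (1 / |sn E a|) + 2 * (1 / |sn E b|)) * (|sn E a| * |sn E b|) := by
    field_simp
    ring
  rw [e1, e2, abs_mul, abs_mul, mul_le_mul_iff_left₀ (by positivity), abs_le, up, up, lo, lo,
    neg_div, neg_div]
  constructor <;> rintro ⟨h1, h2⟩ <;> constructor <;> linarith

theorem not_isResolventPoint_of_band {c : ℤ → ℤ → ℝ} (ha : 0 < a) (hb : 0 < b)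
    (hc : ∀ i j, i ≠ 0 → c i j = γ)
    (h : |2 * cs E a * sn E b + 2 * cs E b * sn E a + γ * sn E a * sn E b| ≤
      2 * |sn E a| + 2 * |sn E b|) : ¬ IsResolventPoint (hamiltonian a b c) (E : ℂ) := by
  by_cases hsa : sn E a = 0
  · exact not_isResolventPoint_of_left ha hb hsa
  by_cases hsb : sn E b = 0
  · exact not_isResolventPoint_of_right ha hb hsb
  have hr : Regular a b E := ⟨hsa, hsb⟩
  obtain ⟨h1, h2⟩ := (band_condition_iff hr).1 h
  have hla := lo_lt_up hsa
  have hlb := lo_lt_up hsb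
  -- The sum of two intervals is an interval: `γ / 2` is split into a part for each direction, and
  -- each part into a quasimomentum.
  obtain ⟨t, ht, ht'⟩ : ∃ t ∈ Icc (lo a E) (up a E), γ / 2 - t ∈ Icc (lo b E) (up b E) := by
    refine ⟨max (lo a E) (γ / 2 - up b E), ⟨le_max_left _ _, max_le hla.le (by linarith)⟩, ?_, ?_⟩
    · rcases max_cases (lo a E) (γ / 2 - up b E) with ⟨h, -⟩ | ⟨h, -⟩ <;> rw [h] <;> linarith
    · linarith [le_max_right (lo a E) (γ / 2 - up b E)]
  obtain ⟨x, hx, rfl⟩ := exists_eq_div_sn hsa ht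
  obtain ⟨y, hy, hy'⟩ := exists_eq_div_sn hsb ht'
  exact not_isResolventPoint_of_bloch ha hb hr hc hx hy
    (by rw [mul_div_assoc, mul_div_assoc, ← hy']; ring)

theorem mem_σ₀_iff (ha : 0 < a) (hb : 0 < b) : E ∈ σ₀ a b γ ↔
    |2 * cs E a * sn E b + 2 * cs E b * sn E a + γ * sn E a * sn E b| ≤
      2 * |sn E a| + 2 * |sn E b| := by
  refine ⟨fun h => ?_, not_isResolventPoint_of_band ha hb fun _ _ _ => rfl⟩
  by_cases hsa : sn E a = 0
  · have h1 := norm_csC_eq_one hsa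
    rw [csC, Complex.norm_real, Real.norm_eq_abs] at h1
    simp [hsa, abs_mul, h1]
  by_cases hsb : sn E b = 0
  · have h1 := norm_csC_eq_one hsb
    rw [csC, Complex.norm_real, Real.norm_eq_abs] at h1
    simp [hsb, abs_mul, h1]
  have hr : Regular a b E := ⟨hsa, hsb⟩
  -- The unperturbed operator is the case `γ' = γ`, for which both strict inequalities between the
  -- couplings fail.
  have e : σ₀ a b γ = σ₁ a b γ γ := by simp [σ₀, σ₁]
  rw [e] at h
  rw [band_condition_iff hr]
  by_contra hn
  rw [not_and_or, not_le, not_le] at hn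
  rcases hn with hn | hn
  · exact absurd ((mem_σ₁_iff_below ha hb hr hn).1 h).1 (lt_irrefl _)
  · exact absurd ((mem_σ₁_iff_above ha hb hr hn).1 h).1 (lt_irrefl _)

end

theorem σ₀_subset_σ₁ {a b : ℝ} (ha : 0 < a) (hb : 0 < b) (γ γ' : ℝ) :
    σ₀ a b γ ⊆ σ₁ a b γ γ' := fun _ h =>
  not_isResolventPoint_of_band ha hb (fun _ _ hi => if_neg hi) ((mem_σ₀_iff ha hb).1 h)

/-! ### The unperturbed spectrum and the shape of its gaps -/

section Gaps

variable {a b γ : ℝ}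

theorem not_regular_iff {E : ℝ} : ¬ Regular a b E ↔ sn E a = 0 ∨ sn E b = 0 := by
  unfold Regular
  tauto

theorem mem_σ₀_of_not_regular {E : ℝ} (ha : 0 < a) (hb : 0 < b) (h : sn E a = 0 ∨ sn E b = 0) :
    E ∈ σ₀ a b γ := by
  rw [mem_σ₀_iff ha hb]
  have key : ∀ L, sn E L = 0 → |cs E L| = 1 := fun L hL => by
    have h1 := cs_sq_add E L
    rw [hL] at h1
    nlinarith [sq_abs (cs E L), abs_nonneg (cs E L)]
  rcases h with h | h
  · rw [h]
    simp [abs_mul, key a h]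
  · rw [h]
    simp [abs_mul, key b h]

theorem regular_of_notMem {E : ℝ} (ha : 0 < a) (hb : 0 < b) (h : E ∉ σ₀ a b γ) :
    Regular a b E := by
  by_contra hr
  exact h (mem_σ₀_of_not_regular ha hb (not_regular_iff.1 hr))

theorem mem_σ₀_iff_of_regular {E : ℝ} (ha : 0 < a) (hb : 0 < b) (hr : Regular a b E) :
    E ∈ σ₀ a b γ ↔ 2 * lo a E + 2 * lo b E ≤ γ ∧ γ ≤ 2 * up a E + 2 * up b E := by
  have h1 := hr.1
  have h2 := hr.2
  have hp : 0 < |sn E a * sn E b| := abs_pos.2 (mul_ne_zero h1 h2)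
  have e1 : 2 * cs E a * sn E b + 2 * cs E b * sn E a + γ * sn E a * sn E b =
      (2 * (cs E a / sn E a) + 2 * (cs E b / sn E b) + γ) * (sn E a * sn E b) := by
    field_simp
  have e2 : 2 * |sn E a| + 2 * |sn E b| =
      (2 * (1 / |sn E a|) + 2 * (1 / |sn E b|)) * |sn E a * sn E b| := by
    rw [abs_mul]
    have := abs_ne_zero.2 h1
    have := abs_ne_zero.2 h2
    field_simp
    ring
  rw [mem_σ₀_iff ha hb, e1, e2, abs_mul, mul_le_mul_iff_left₀ hp, abs_le]
  unfold up lo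
  constructor
  · rintro ⟨h, h'⟩
    constructor <;> linarith [neg_div (sn E a) (cs E a), neg_div (sn E b) (cs E b)]
  · rintro ⟨h, h'⟩
    constructor <;> linarith [neg_div (sn E a) (cs E a), neg_div (sn E b) (cs E b)]

theorem isClosed_σ₀ (ha : 0 < a) (hb : 0 < b) : IsClosed (σ₀ a b γ) := by
  have : σ₀ a b γ = {E | |2 * cs E a * sn E b + 2 * cs E b * sn E a + γ * sn E a * sn E b| ≤
      2 * |sn E a| + 2 * |sn E b|} := Set.ext fun E => mem_σ₀_iff ha hb
  rw [this]
  have := continuous_cs_energy a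
  have := continuous_cs_energy b
  have := continuous_sn_energy a
  have := continuous_sn_energy b
  exact isClosed_le (by fun_prop) (by fun_prop)

theorem not_bddAbove_σ₀ (ha : 0 < a) (hb : 0 < b) : ¬ BddAbove (σ₀ a b γ) := by
  rintro ⟨B, hB⟩
  obtain ⟨n, hn⟩ := exists_nat_gt (|B| * a / Real.pi + 1 + a / Real.pi)
  have hpi := Real.pi_pos
  have h0 : 0 < |B| * a / Real.pi + 1 + a / Real.pi := by positivity
  have hn0 : 0 < n := by exact_mod_cast h0.trans hn
  have h1 := hB (mem_σ₀_of_not_regular (γ := γ) ha hb (.inl (sn_eq_zero_of_nat ha n hn0)))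
  have h2 : |B| + 1 < n * Real.pi / a := by
    rw [lt_div_iff₀ ha]
    have : (|B| * a / Real.pi + a / Real.pi) * Real.pi = (|B| + 1) * a := by field_simp
    rw [← this]
    exact mul_lt_mul_of_pos_right (by linarith) hpi
  nlinarith [le_abs_self B, abs_nonneg B]

theorem notMem_σ₀_of_lt {E : ℝ} (ha : 0 < a) (hb : 0 < b) (hr : Regular a b E)
    (h : 2 * up a E + 2 * up b E < γ) : E ∉ σ₀ a b γ := by
  rw [mem_σ₀_iff_of_regular ha hb hr]
  exact fun h' => h.not_ge h'.2

theorem notMem_σ₀_of_gt {E : ℝ} (ha : 0 < a) (hb : 0 < b) (hr : Regular a b E)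
    (h : γ < 2 * lo a E + 2 * lo b E) : E ∉ σ₀ a b γ := by
  rw [mem_σ₀_iff_of_regular ha hb hr]
  exact fun h' => h.not_ge h'.1

theorem regular_of_lt {E : ℝ} (ha : 0 < a) (hb : 0 < b)
    (h : E < min ((Real.pi / a) ^ 2) ((Real.pi / b) ^ 2)) : Regular a b E := by
  have key : ∀ L > 0, E < (Real.pi / L) ^ 2 → sn E L ≠ 0 := by
    intro L hL hlt h0
    obtain ⟨n, hn, hk⟩ := exists_nat_of_sn_eq_zero hL h0
    have hE := pos_of_sn_eq_zero hL h0
    have h1 : Real.pi ≤ √E * L := by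
      rw [hk]
      exact le_mul_of_one_le_left Real.pi_pos.le (by exact_mod_cast hn)
    have h2 : Real.pi / L ≤ √E := (div_le_iff₀ hL).2 h1
    have h3 := pow_le_pow_left₀ (div_pos Real.pi_pos hL).le h2 2
    rw [Real.sq_sqrt hE.le] at h3
    exact hlt.not_ge h3
  exact ⟨key a ha (lt_min_iff.1 h).1, key b hb (lt_min_iff.1 h).2⟩

/-- Below the first Dirichlet energy `up a + up b` is continuous; it tends to `-∞` with the energy
and to `+∞` at that Dirichlet energy, so it takes the value `γ / 2`. -/
theorem exists_bottom (ha : 0 < a) (hb : 0 < b) (γ : ℝ) :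
    ∃ E₀, (∀ E ≤ E₀, Regular a b E) ∧ up a E₀ + up b E₀ = γ / 2 := by
  set e := min ((Real.pi / a) ^ 2) ((Real.pi / b) ^ 2) with he
  have he0 : 0 < e := by have := Real.pi_pos; positivity
  have hpos : ∀ᶠ E in 𝓝[<] e, 0 < E :=
    (Ioi_mem_nhds he0 : Ioi 0 ∈ 𝓝 e) |> fun h => mem_nhdsWithin_of_mem_nhds h
  have hreg : ∀ᶠ E in 𝓝[<] e, Regular a b E :=
    eventually_of_mem self_mem_nhdsWithin fun E hE => regular_of_lt ha hb hE
  have htop : Tendsto (fun E => up a E + up b E) (𝓝[<] e) atTop := by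
    rcases min_choice ((Real.pi / a) ^ 2) ((Real.pi / b) ^ 2) with h | h
    · have h0 : sn e a = 0 := by
        rw [he, h]; simpa using sn_eq_zero_of_nat ha 1 one_pos
      refine tendsto_atTop_mono' _ ?_ (tendsto_up_left ha h0)
      filter_upwards [hpos, hreg] with E hE hr
      linarith [up_pos hb hr.2 hE]
    · have h0 : sn e b = 0 := by
        rw [he, h]; simpa using sn_eq_zero_of_nat hb 1 one_pos
      refine tendsto_atTop_mono' _ ?_ (tendsto_up_left hb h0)
      filter_upwards [hpos, hreg] with E hE hr
      linarith [up_pos ha hr.1 hE]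
  obtain ⟨y, hy1, hy2⟩ := ((htop.eventually_ge_atTop (γ / 2)).and self_mem_nhdsWithin).exists
  have hbot : Tendsto (fun E => up a E + up b E) atBot atBot :=
    (tendsto_up_atBot ha).atBot_add_atBot (tendsto_up_atBot hb)
  obtain ⟨x, hx1, hx2⟩ :=
    ((hbot.eventually_le_atBot (γ / 2)).and (eventually_le_atBot y)).exists
  have hreg' : ∀ E ≤ y, Regular a b E := fun E hE => regular_of_lt ha hb (hE.trans_lt hy2)
  obtain ⟨E₀, hE₀, h⟩ := intermediate_value_Icc (f := fun E => up a E + up b E) hx2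
    (fun E hE => ((continuousAt_up (hreg' E hE.2).1).add
      (continuousAt_up (hreg' E hE.2).2)).continuousWithinAt) ⟨hx1, hy1⟩
  exact ⟨E₀, fun E hE => hreg' E (hE.trans hE₀.2), h⟩

/-- The bottom of the unperturbed spectrum. -/
theorem bottom_spec (ha : 0 < a) (hb : 0 < b) (γ : ℝ) :
    IsLeast (σ₀ a b γ) (sInf (σ₀ a b γ)) ∧
      ∀ l < sInf (σ₀ a b γ), AboveGap a b γ l (sInf (σ₀ a b γ)) := by
  obtain ⟨E₀, hreg, hE₀⟩ := exists_bottom ha hb γ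
  have hgap : ∀ l < E₀, AboveGap a b γ l E₀ := fun l hl => ⟨hl, fun E hE => hreg E hE.2, hE₀⟩
  have hleast : IsLeast (σ₀ a b γ) E₀ := by
    have hr := hreg E₀ le_rfl
    refine ⟨(mem_σ₀_iff_of_regular ha hb hr).2 ⟨?_, by linarith⟩, fun E hE => ?_⟩
    · linarith [lo_lt_up hr.1, lo_lt_up hr.2]
    · by_contra hlt
      push Not at hlt
      exact notMem_σ₀_of_lt ha hb (hreg E hlt.le)
        -- In the semi-infinite gap the left end is arbitrary; `E - 1` merely makes `E` an interior
        -- point.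
        ((hgap (E - 1) (by linarith)).lt_of_mem ha hb ⟨by linarith, hlt⟩) hE
  rw [hleast.csInf_eq]
  exact ⟨hleast, hgap⟩

/-- At the bottom `up a + up b = γ / 2 < 0`, whereas `up ≥ 0` at nonnegative energies. -/
theorem sInf_σ₀_neg (ha : 0 < a) (hb : 0 < b) (hγ : γ < 0) : sInf (σ₀ a b γ) < 0 := by
  by_contra h
  have hg := (bottom_spec ha hb γ).2 (sInf (σ₀ a b γ) - 1) (by linarith)
  have hr := hg.regular _ (right_mem_Ioc.2 hg.lt)
  linarith [hg.edge, up_nonneg ha hr.1 (not_lt.1 h), up_nonneg hb hr.2 (not_lt.1 h)]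

/-- The gaps above the bottom for attractive coupling. -/
theorem belowGap_of_isGap (ha : 0 < a) (hb : 0 < b) (hγ : γ < 0) {l u : ℝ}
    (h : IsGap (σ₀ a b γ) l u) : BelowGap a b γ l u ∧ (sn u a = 0 ∨ sn u b = 0) := by
  have hlu := h.lt
  have hnot : ∀ E ∈ Ioo l u, E ∉ σ₀ a b γ := fun E hE h' => disjoint_left.1 h.disjoint hE h'
  have hregI : ∀ E ∈ Ioo l u, Regular a b E := fun E hE => regular_of_notMem ha hb (hnot E hE)
  -- If `γ` were above the dispersion at `E`, then `E < 0`, and by monotonicity this would persist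
  -- at all lower energies, in particular at `l`, which is in the spectrum.
  have hlt : ∀ E ∈ Ioo l u, γ < 2 * lo a E + 2 * lo b E := by
    intro E hE
    by_contra hc
    have hr := hregI E hE
    have hup : 2 * up a E + 2 * up b E < γ := by
      by_contra hc'
      exact hnot E hE ((mem_σ₀_iff_of_regular ha hb hr).2 ⟨not_lt.1 hc, not_lt.1 hc'⟩)
    have hE0 : E < 0 := by
      by_contra h0
      linarith [up_nonneg ha hr.1 (not_lt.1 h0), up_nonneg hb hr.2 (not_lt.1 h0)]
    have hreg : ∀ x ≤ E, Regular a b x := fun x hx =>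
      ⟨(sn_pos_of_nonpos (hx.trans hE0.le) ha).ne', (sn_pos_of_nonpos (hx.trans hE0.le) hb).ne'⟩
    have h1 := up_lt ha hE.1 fun x hx => (hreg x hx.2).1
    have h2 := up_lt hb hE.1 fun x hx => (hreg x hx.2).2
    exact notMem_σ₀_of_lt ha hb (hreg l hE.1.le) (by linarith) h.left_mem
  -- At a Dirichlet energy `l` the lower end of the dispersion would tend to `-∞` from the right and
  -- could not stay above `γ`.
  have hl : Regular a b l := by
    by_contra hc
    have key : Tendsto (fun E => 2 * lo a E + 2 * lo b E) (𝓝[>] l) atBot := by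
      rcases not_regular_iff.1 hc with h0 | h0
      · refine tendsto_atBot_mono' _ ?_
          ((tendsto_lo_right ha h0).const_mul_atBot (by norm_num : (0 : ℝ) < 2))
        filter_upwards [Ioo_mem_nhdsGT hlu] with E hE
        linarith [lo_neg hb (hregI E hE).2]
      · refine tendsto_atBot_mono' _ ?_
          ((tendsto_lo_right hb h0).const_mul_atBot (by norm_num : (0 : ℝ) < 2))
        filter_upwards [Ioo_mem_nhdsGT hlu] with E hE
        linarith [lo_neg ha (hregI E hE).1]
    obtain ⟨E, hE1, hE2⟩ := ((key.eventually_le_atBot γ).and (Ioo_mem_nhdsGT hlu)).exists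
    exact (hlt E hE2).not_ge hE1
  have hregl : ∀ E ∈ Ico l u, Regular a b E := fun E hE => by
    rcases hE.1.eq_or_lt with rfl | hlt
    · exact hl
    · exact hregI E ⟨hlt, hE.2⟩
  refine ⟨⟨hlu, hregl, ?_⟩, ?_⟩
  · have h1 := ((mem_σ₀_iff_of_regular ha hb hl).1 h.left_mem).1
    have h2 : γ ≤ 2 * lo a l + 2 * lo b l := by
      have hc : ContinuousAt (fun E => 2 * lo a E + 2 * lo b E) l :=
        ((continuousAt_lo hl.1).const_mul 2).add ((continuousAt_lo hl.2).const_mul 2)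
      refine ge_of_tendsto (hc.tendsto.mono_left (nhdsWithin_le_nhds (s := Ioi l))) ?_
      filter_upwards [Ioo_mem_nhdsGT hlu] with E hE using (hlt E hE).le
    linarith
  -- At a regular `u` the lower end would be even higher than inside the gap, so `u` would not be in
  -- the spectrum.
  · by_contra hc
    have hu : Regular a b u := by_contra fun h' => hc (not_regular_iff.1 h')
    obtain ⟨x, hx⟩ := exists_between hlu
    have hreg : ∀ E ∈ Icc x u, Regular a b E := fun E hE => by
      rcases hE.2.eq_or_lt with rfl | hlt
      · exact hu
      · exact hregI E ⟨hx.1.trans_le hE.1, hlt⟩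
    have h1 := lo_lt ha hx.2 fun E hE => (hreg E hE).1
    have h2 := lo_lt hb hx.2 fun E hE => (hreg E hE).2
    exact notMem_σ₀_of_gt ha hb hu (by linarith [hlt x hx]) h.right_mem

/-- The gaps above the bottom for repulsive coupling. -/
theorem aboveGap_of_isGap (ha : 0 < a) (hb : 0 < b) (hγ : 0 < γ) {l u : ℝ}
    (h : IsGap (σ₀ a b γ) l u) : AboveGap a b γ l u ∧ (sn l a = 0 ∨ sn l b = 0) := by
  have hlu := h.lt
  have hnot : ∀ E ∈ Ioo l u, E ∉ σ₀ a b γ := fun E hE h' => disjoint_left.1 h.disjoint hE h'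
  have hregI : ∀ E ∈ Ioo l u, Regular a b E := fun E hE => regular_of_notMem ha hb (hnot E hE)
  -- Since `lo < 0 < γ`, only the upper inequality of the band condition can fail.
  have hlt : ∀ E ∈ Ioo l u, 2 * up a E + 2 * up b E < γ := by
    intro E hE
    have hr := hregI E hE
    by_contra hc
    exact hnot E hE ((mem_σ₀_iff_of_regular ha hb hr).2
      ⟨by linarith [lo_neg ha hr.1, lo_neg hb hr.2], not_lt.1 hc⟩)
  have hl : sn l a = 0 ∨ sn l b = 0 := by
    by_contra hc
    have hl : Regular a b l := by_contra fun h' => hc (not_regular_iff.1 h')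
    obtain ⟨x, hx⟩ := exists_between hlu
    have hreg : ∀ E ∈ Icc l x, Regular a b E := fun E hE => by
      rcases hE.1.eq_or_lt with rfl | hlt
      · exact hl
      · exact hregI E ⟨hlt, hE.2.trans_lt hx.2⟩
    have h1 := up_lt ha hx.1 fun E hE => (hreg E hE).1
    have h2 := up_lt hb hx.1 fun E hE => (hreg E hE).2
    exact notMem_σ₀_of_lt ha hb hl (by linarith [hlt x hx]) h.left_mem
  have hl0 : 0 < l := by
    rcases hl with hl | hl
    · exact pos_of_sn_eq_zero ha hl
    · exact pos_of_sn_eq_zero hb hl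
  have hu : Regular a b u := by
    by_contra hc
    have key : Tendsto (fun E => 2 * up a E + 2 * up b E) (𝓝[<] u) atTop := by
      rcases not_regular_iff.1 hc with h0 | h0
      · refine tendsto_atTop_mono' _ ?_
          ((tendsto_up_left ha h0).const_mul_atTop (by norm_num : (0 : ℝ) < 2))
        filter_upwards [Ioo_mem_nhdsLT hlu] with E hE
        linarith [up_pos hb (hregI E hE).2 (hl0.trans hE.1)]
      · refine tendsto_atTop_mono' _ ?_
          ((tendsto_up_left hb h0).const_mul_atTop (by norm_num : (0 : ℝ) < 2))
        filter_upwards [Ioo_mem_nhdsLT hlu] with E hE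
        linarith [up_pos ha (hregI E hE).1 (hl0.trans hE.1)]
    obtain ⟨E, hE1, hE2⟩ := ((key.eventually_ge_atTop γ).and (Ioo_mem_nhdsLT hlu)).exists
    exact (hlt E hE2).not_ge hE1
  have hregl : ∀ E ∈ Ioc l u, Regular a b E := fun E hE => by
    rcases hE.2.eq_or_lt with rfl | hlt
    · exact hu
    · exact hregI E ⟨hE.1, hlt⟩
  refine ⟨⟨hlu, hregl, ?_⟩, hl⟩
  have h1 := ((mem_σ₀_iff_of_regular ha hb hu).1 h.right_mem).2
  have h2 : 2 * up a u + 2 * up b u ≤ γ := by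
    have hc : ContinuousAt (fun E => 2 * up a E + 2 * up b E) u :=
      ((continuousAt_up hu.1).const_mul 2).add ((continuousAt_up hu.2).const_mul 2)
    refine le_of_tendsto (hc.tendsto.mono_left (nhdsWithin_le_nhds (s := Iio u))) ?_
    filter_upwards [Ioo_mem_nhdsLT hlu] with E hE using (hlt E hE).le
  linarith

theorem AboveGap.isGap {l u : ℝ} (h : AboveGap a b γ l u) (ha : 0 < a) (hb : 0 < b)
    (hl : sn l a = 0 ∨ sn l b = 0) : IsGap (σ₀ a b γ) l u where
  lt := h.lt
  left_mem := mem_σ₀_of_not_regular ha hb hl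
  right_mem := by
    have hr := h.regular u (right_mem_Ioc.2 h.lt)
    refine (mem_σ₀_iff_of_regular ha hb hr).2 ⟨?_, by linarith [h.edge]⟩
    linarith [lo_lt_up hr.1, lo_lt_up hr.2, h.edge]
  disjoint := disjoint_left.2 fun E hE =>
    notMem_σ₀_of_lt ha hb (h.regular E (Ioo_subset_Ioc_self hE)) (h.lt_of_mem ha hb hE)

theorem BelowGap.isGap {l u : ℝ} (h : BelowGap a b γ l u) (ha : 0 < a) (hb : 0 < b)
    (hu : sn u a = 0 ∨ sn u b = 0) : IsGap (σ₀ a b γ) l u where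
  lt := h.lt
  right_mem := mem_σ₀_of_not_regular ha hb hu
  left_mem := by
    have hr := h.regular l (left_mem_Ico.2 h.lt)
    refine (mem_σ₀_iff_of_regular ha hb hr).2 ⟨by linarith [h.edge], ?_⟩
    linarith [lo_lt_up hr.1, lo_lt_up hr.2, h.edge]
  disjoint := disjoint_left.2 fun E hE =>
    notMem_σ₀_of_gt ha hb (h.regular E (Ioo_subset_Ico_self hE)) (h.lt_of_mem ha hb hE)

theorem AboveGap.mem_σ₁_iff {l u γ' E : ℝ} (h : AboveGap a b γ l u) (ha : 0 < a) (hb : 0 < b)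
    (hE : E ∈ Ioo l u) : E ∈ σ₁ a b γ γ' ↔
      γ' < γ ∧ minAbove a b γ E ≤ (γ' - γ) ^ 2 ∧ (γ' - γ) ^ 2 ≤ maxAbove a b γ E :=
  mem_σ₁_iff_above ha hb (h.regular E (Ioo_subset_Ioc_self hE)) (h.lt_of_mem ha hb hE)

theorem BelowGap.mem_σ₁_iff {l u γ' E : ℝ} (h : BelowGap a b γ l u) (ha : 0 < a) (hb : 0 < b)
    (hE : E ∈ Ioo l u) : E ∈ σ₁ a b γ γ' ↔
      γ < γ' ∧ minBelow a b γ E ≤ (γ' - γ) ^ 2 ∧ (γ' - γ) ^ 2 ≤ maxBelow a b γ E :=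
  mem_σ₁_iff_below ha hb (h.regular E (Ioo_subset_Ico_self hE)) (h.lt_of_mem ha hb hE)

/-! ### New bands in the gaps -/

/-- The new band in a bounded gap of a repulsive lattice. -/
theorem AboveGap.exists_isNewBand {l u γ' : ℝ} (h : AboveGap a b γ l u) (ha : 0 < a) (hb : 0 < b)
    (hl : sn l a = 0 ∨ sn l b = 0) (hγ' : γ' < γ) :
    ∃ α β, IsNewBand (Ioo l u) (σ₁ a b γ γ') α β ∧
      ((γ' - γ) ^ 2 ≤ maxAbove a b γ u → β = u) ∧ (maxAbove a b γ u < (γ' - γ) ^ 2 → β < u) ∧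
      ((∃ E ∈ Ioo l u, (γ' - γ) ^ 2 < minAbove a b γ E) → l < α) := by
  have hd : 0 < (γ' - γ) ^ 2 := by have := sub_ne_zero.2 hγ'.ne; positivity
  obtain ⟨E, hE1, hE2⟩ := (((h.tendsto_maxAbove ha hb hl).eventually_gt_atTop ((γ' - γ) ^ 2)).and
    (Ioo_mem_nhdsGT h.lt)).exists
  obtain ⟨α, β, h1, h2, h3, h4, h5⟩ := h.exists_band ha hb hd ⟨E, hE2, hE1⟩
  refine ⟨α, β, .of_iff h.lt h1 h2 h3 fun E hE => ?_, h5⟩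
  rw [h.mem_σ₁_iff ha hb hE, and_iff_right hγ', h4 E hE]

/-- The new band in a bounded gap of an attractive lattice. -/
theorem BelowGap.exists_isNewBand {l u γ' : ℝ} (h : BelowGap a b γ l u) (ha : 0 < a) (hb : 0 < b)
    (hu : sn u a = 0 ∨ sn u b = 0) (hγ' : γ < γ') :
    ∃ α β, IsNewBand (Ioo l u) (σ₁ a b γ γ') α β ∧
      ((γ' - γ) ^ 2 ≤ maxBelow a b γ l → α = l) ∧ (maxBelow a b γ l < (γ' - γ) ^ 2 → l < α) ∧
      ((∃ E ∈ Ioo l u, (γ' - γ) ^ 2 < minBelow a b γ E) → β < u) := by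
  have hd : 0 < (γ' - γ) ^ 2 := by have := sub_ne_zero.2 hγ'.ne'; positivity
  obtain ⟨E, hE1, hE2⟩ := (((h.tendsto_maxBelow ha hb hu).eventually_gt_atTop ((γ' - γ) ^ 2)).and
    (Ioo_mem_nhdsLT h.lt)).exists
  obtain ⟨α, β, h1, h2, h3, h4, h5⟩ := h.exists_band ha hb hd ⟨E, hE2, hE1⟩
  refine ⟨α, β, .of_iff h.lt h1 h2 h3 fun E hE => ?_, h5⟩
  rw [h.mem_σ₁_iff ha hb hE, and_iff_right hγ', h4 E hE]

/-- The new band below the unperturbed spectrum. -/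
theorem exists_isNewBand_bottom {γ' : ℝ} (ha : 0 < a) (hb : 0 < b) (hγ' : γ' < γ) :
    ∃ α β, IsNewBand (Iio (sInf (σ₀ a b γ))) (σ₁ a b γ γ') α β ∧ β ≤ sInf (σ₀ a b γ) ∧
      ((γ' - γ) ^ 2 ≤ maxAbove a b γ (sInf (σ₀ a b γ)) → β = sInf (σ₀ a b γ)) ∧
      (maxAbove a b γ (sInf (σ₀ a b γ)) < (γ' - γ) ^ 2 → β < sInf (σ₀ a b γ)) := by
  obtain ⟨-, hgap⟩ := bottom_spec ha hb γ
  set u := sInf (σ₀ a b γ)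
  set d := (γ' - γ) ^ 2 with hd'
  have hd : 0 < d := by have := sub_ne_zero.2 hγ'.ne; positivity
  have hbot : Tendsto (fun E => up a E + up b E) atBot atBot :=
    (tendsto_up_atBot ha).atBot_add_atBot (tendsto_up_atBot hb)
  obtain ⟨x, hx1, hx2⟩ :=
    ((hbot.eventually_le_atBot ((γ - (d + 1)) / 2)).and (eventually_lt_atBot u)).exists
  have hxu : AboveGap a b γ (x - 1) u := hgap _ (by linarith)
  have hxm : x ∈ Ioo (x - 1) u := ⟨by linarith, hx2⟩
  have hrx := hxu.regular x (Ioo_subset_Ioc_self hxm)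
  -- Far down both factors of the minimum are at least `d + 1`, and `(d + 1)² > d`; hence the band
  -- is bounded below and a bounded interval suffices to locate it.
  have hmin : d < minAbove a b γ x := by
    have h1 := lo_lt_up hrx.1
    have h2 : d + 1 ≤ γ - 2 * up b x - 2 * up a x := by linarith
    have h3 : (d + 1) * (d + 1) ≤ minAbove a b γ x :=
      mul_le_mul h2 (by linarith) (by linarith) (by linarith)
    nlinarith
  have hmax := minAbove_lt_maxAbove (γ := γ) hrx (hxu.lt_of_mem ha hb hxm).le
  obtain ⟨α, β, h1, h2, h3, h4, h5, h6, h7⟩ :=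
    hxu.exists_band ha hb hd ⟨x, hxm, hmin.trans hmax⟩
  have hα := h7 ⟨x, hxm, hmin⟩
  refine ⟨α, β, .Iio_of_iff h2 h3 fun E hE => ?_, h3, h5, h6⟩
  have hEg := (hgap (E - 1) (by linarith))
  have hEm : E ∈ Ioo (E - 1) u := ⟨by linarith, hE⟩
  rw [hEg.mem_σ₁_iff ha hb hEm, and_iff_right hγ', ← hd']
  -- Below `x - 1` the minimum is larger still, so there is no further spectrum.
  rcases lt_or_ge (x - 1) E with hxE | hxE
  · exact h4 E ⟨hxE, hE⟩
  · have : minAbove a b γ x < minAbove a b γ E :=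
      (hEg.anti ha hb).1 (Ioo_subset_Ioc_self hEm) ⟨by linarith, hx2.le⟩ (by linarith)
    constructor
    · exact fun h => absurd h.1 (hmin.trans this).not_ge
    · exact fun h => absurd h.1 (by linarith)

/-- A zero would mean that `π a / b` is a multiple of `π`. Thus the first Dirichlet energy of the
edges of length `b` is not resonant for those of length `a`, which makes it the place to look for
gaps that close. -/
theorem sn_pi_div_ne_zero (hab : ∀ n : ℕ, a ≠ n * b) (ha : 0 < a) (hb : 0 < b) :
    sn ((Real.pi / b) ^ 2) a ≠ 0 := by
  intro h
  obtain ⟨n, -, hn⟩ := exists_nat_of_sn_eq_zero ha h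
  have hpi := Real.pi_pos
  rw [Real.sqrt_sq (by positivity), div_mul_eq_mul_div, div_eq_iff hb.ne'] at hn
  refine hab n (mul_left_cancel₀ hpi.ne' ?_)
  linarith

/-- A gap of an attractive lattice that some perturbation closes. -/
theorem exists_closed_belowGap (hab : ∀ n : ℕ, a ≠ n * b) (ha : 0 < a) (hb : 0 < b) :
    ∃ γ < 0, ∃ l u, BelowGap a b γ l u ∧ sn u b = 0 ∧
      ∃ d > 0, ∀ E ∈ Ioo l u, minBelow a b γ E ≤ d ∧ d ≤ maxBelow a b γ E := by
  set u := (Real.pi / b) ^ 2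
  have hua : sn u a ≠ 0 := sn_pi_div_ne_zero hab ha hb
  have hub : sn u b = 0 := by simpa using sn_eq_zero_of_nat hb 1 one_pos
  have hu0 := pos_of_sn_eq_zero hb hub
  have hreg : ∀ᶠ E in 𝓝[<] u, Regular a b E ∧ 0 < E := by
    have h1 : ∀ᶠ E in 𝓝[<] u, sn E a ≠ 0 := mem_nhdsWithin_of_mem_nhds
      ((continuous_sn_energy a).continuousAt.eventually_ne hua)
    have h2 : ∀ᶠ E in 𝓝[<] u, 0 < E := mem_nhdsWithin_of_mem_nhds (Ioi_mem_nhds hu0)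
    filter_upwards [h1, h2, (sn_sign_near hb hub).1] with E hE h0 hE'
    refine ⟨⟨hE, fun h => ?_⟩, h0⟩
    simp [h] at hE'
  obtain ⟨l₀, hl₀, hsub⟩ := (mem_nhdsLT_iff_exists_Ioo_subset).1 hreg
  obtain ⟨l₁, hl₁⟩ := exists_between (show l₀ < u from hl₀)
  have hregI : ∀ E ∈ Ico l₁ u, Regular a b E ∧ 0 < E := fun E hE =>
    hsub ⟨hl₁.1.trans_le hE.1, hE.2⟩
  have hrega : ∀ E ∈ Icc l₁ u, sn E a ≠ 0 := fun E hE => by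
    rcases hE.2.eq_or_lt with rfl | h
    · exact hua
    · exact (hregI E ⟨hE.1, h⟩).1.1
  have hr₁ := (hregI l₁ (left_mem_Ico.2 hl₁.2)).1
  -- On any gap `(l, u)` with `l₁ < l` the coupling satisfies `-γ < G`, because `lo` increases. This
  -- gives the bound `d` below on the minimum, uniformly in `l`.
  set G := -(2 * lo a l₁ + 2 * lo b l₁) with hG
  have hG0 : 0 < G := by linarith [lo_neg ha hr₁.1, lo_neg hb hr₁.2]
  have hupu := up_pos ha hua hu0
  set d := (2 * up a u + G) * G with hd
  have hd0 : 0 < d := by positivity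
  -- Near `u` the maximum at the left end exceeds `(d + 1)² ≥ d`, since both of its factors are at
  -- least `up b l`. Taking `γ` from the edge condition at `l` turns `(l, u)` into a gap.
  obtain ⟨l, hl1, hl2⟩ := (((tendsto_up_left hb hub).eventually_ge_atTop (d + 1)).and
    (Ioo_mem_nhdsLT hl₁.2)).exists
  have hrl := (hregI l (Ioo_subset_Ico_self hl2)).1
  have hla := lo_neg ha hrl.1
  have hlb := lo_neg hb hrl.2
  have hgap : BelowGap a b (2 * lo a l + 2 * lo b l) l u :=
    ⟨hl2.2, fun E hE => (hregI E ⟨hl2.1.le.trans hE.1, hE.2⟩).1, by ring⟩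
  refine ⟨2 * lo a l + 2 * lo b l, by linarith, l, u, hgap, hub, d, hd0, fun E hE => ⟨?_, ?_⟩⟩
  · have hE' : E ∈ Ico l₁ u := ⟨(hl2.1.trans hE.1).le, hE.2⟩
    have hrE := (hregI E hE').1
    have h1 := lo_lt ha hl2.1 fun x hx => (hregI x ⟨hx.1, hx.2.trans_lt hl2.2⟩).1.1
    have h2 := lo_lt hb hl2.1 fun x hx => (hregI x ⟨hx.1, hx.2.trans_lt hl2.2⟩).1.2
    have h3 := up_lt ha hE.2 fun x hx => hrega x ⟨hE'.1.trans hx.1, hx.2⟩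
    have h4 := hgap.lt_of_mem ha hb hE
    have h5 := lo_neg ha hrE.1
    have h6 := lo_neg hb hrE.2
    exact mul_le_mul (by linarith) (by linarith) (by linarith) (by linarith)
  · have h1 := (hgap.mono ha hb).2 (left_mem_Ico.2 hgap.lt) (Ioo_subset_Ico_self hE) hE.1
    refine le_trans ?_ h1.le
    have h2 : (d + 1) * (d + 1) ≤ maxBelow a b (2 * lo a l + 2 * lo b l) l := by
      have := lo_lt_up hrl.1
      exact mul_le_mul (by linarith) (by linarith) (by linarith) (by linarith)
    nlinarith

/-- A gap of a repulsive lattice that some perturbation closes. -/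
theorem exists_closed_aboveGap (hab : ∀ n : ℕ, a ≠ n * b) (ha : 0 < a) (hb : 0 < b) :
    ∃ γ > 0, ∃ l u, AboveGap a b γ l u ∧ sn l b = 0 ∧
      ∃ d > 0, ∀ E ∈ Ioo l u, minAbove a b γ E ≤ d ∧ d ≤ maxAbove a b γ E := by
  set l := (Real.pi / b) ^ 2
  have hla : sn l a ≠ 0 := sn_pi_div_ne_zero hab ha hb
  have hlb : sn l b = 0 := by simpa using sn_eq_zero_of_nat hb 1 one_pos
  have hl0 := pos_of_sn_eq_zero hb hlb
  have hreg : ∀ᶠ E in 𝓝[>] l, Regular a b E := by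
    have h1 : ∀ᶠ E in 𝓝[>] l, sn E a ≠ 0 := mem_nhdsWithin_of_mem_nhds
      ((continuous_sn_energy a).continuousAt.eventually_ne hla)
    filter_upwards [h1, (sn_sign_near hb hlb).2] with E hE hE'
    refine ⟨hE, fun h => ?_⟩
    simp [h] at hE'
  obtain ⟨u₀, hu₀, hsub⟩ := (mem_nhdsGT_iff_exists_Ioo_subset).1 hreg
  obtain ⟨u₁, hu₁⟩ := exists_between (show l < u₀ from hu₀)
  have hregI : ∀ E ∈ Ioc l u₁, Regular a b E := fun E hE =>
    hsub ⟨hE.1, hE.2.trans_lt hu₁.2⟩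
  have hrega : ∀ E ∈ Icc l u₁, sn E a ≠ 0 := fun E hE => by
    rcases hE.1.eq_or_lt with rfl | h
    · exact hla
    · exact (hregI E ⟨h, hE.2⟩).1
  have hr₁ := hregI u₁ (right_mem_Ioc.2 hu₁.1)
  have hu₁0 := hl0.trans hu₁.1
  -- The analogue on the right of a Dirichlet energy: `γ < G` for every gap `(l, u)` with `u < u₁`,
  -- so the minimum is bounded by `d` uniformly in `u`, while `lo b u → -∞` drives the maximum up.
  set G := 2 * up a u₁ + 2 * up b u₁ with hG
  have hG0 : 0 < G := by linarith [up_pos ha hr₁.1 hu₁0, up_pos hb hr₁.2 hu₁0]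
  have hlol := lo_neg ha hla
  set d := G * (G - 2 * lo a l) with hd
  have hd0 : 0 < d := mul_pos hG0 (by linarith)
  obtain ⟨u, hu1, hu2⟩ := (((tendsto_lo_right hb hlb).eventually_le_atBot (-(d + 1))).and
    (Ioo_mem_nhdsGT hu₁.1)).exists
  have hru := hregI u (Ioo_subset_Ioc_self hu2)
  have hu0 := hl0.trans hu2.1
  have hua := up_pos ha hru.1 hu0
  have hub := up_pos hb hru.2 hu0
  have hgap : AboveGap a b (2 * up a u + 2 * up b u) l u :=
    ⟨hu2.1, fun E hE => hregI E ⟨hE.1, hE.2.trans hu2.2.le⟩, by ring⟩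
  refine ⟨2 * up a u + 2 * up b u, by linarith, l, u, hgap, hlb, d, hd0, fun E hE => ⟨?_, ?_⟩⟩
  · have hE' : E ∈ Ioc l u₁ := ⟨hE.1, (hE.2.trans hu2.2).le⟩
    have hrE := hregI E hE'
    have h1 := up_lt ha hu2.2 fun x hx => (hregI x ⟨hu2.1.trans_le hx.1, hx.2⟩).1
    have h2 := up_lt hb hu2.2 fun x hx => (hregI x ⟨hu2.1.trans_le hx.1, hx.2⟩).2
    have h3 := lo_lt ha hE.1 fun x hx => hrega x ⟨hx.1, hx.2.trans hE'.2⟩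
    have h4 := hgap.lt_of_mem ha hb hE
    have h5 := up_pos ha hrE.1 (hl0.trans hE.1)
    have h6 := up_pos hb hrE.2 (hl0.trans hE.1)
    have h7 := lo_neg ha hrE.1
    exact mul_le_mul (by linarith) (by linarith) (by linarith) (by linarith)
  · have h1 := (hgap.anti ha hb).2 (Ioo_subset_Ioc_self hE) (right_mem_Ioc.2 hgap.lt) hE.2
    refine le_trans ?_ h1.le
    have h2 : (d + 1) * (d + 1) ≤ maxAbove a b (2 * up a u + 2 * up b u) u := by
      have := lo_lt_up hru.1
      exact mul_le_mul (by linarith) (by linarith) (by linarith) (by linarith)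
    nlinarith

end Gaps

/-! ### Contact of the new bands with the gap edges -/

theorem exists_lt_sub_sq_eq (γ : ℝ) {d : ℝ} (hd : 0 < d) : ∃ γ' < γ, (γ' - γ) ^ 2 = d :=
  ⟨γ - √d, by linarith [Real.sqrt_pos.2 hd], by
    rw [sub_sub_cancel_left, neg_sq, Real.sq_sqrt hd.le]⟩

theorem exists_gt_sub_sq_eq (γ : ℝ) {d : ℝ} (hd : 0 < d) : ∃ γ' > γ, (γ' - γ) ^ 2 = d :=
  ⟨γ + √d, by linarith [Real.sqrt_pos.2 hd], by
    rw [add_sub_cancel_left, Real.sq_sqrt hd.le]⟩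

section

variable {a b γ : ℝ}

/-- The edge `l` is reached when `(γ' - γ)²` is at most the maximum at `l`, so this value and this
value plus one serve as witnesses. Contact with `u` is avoided by a squared change below the minimum
at some interior point. -/
theorem attractive_bounded_gap (ha : 0 < a) (hb : 0 < b) (hγ : γ < 0) {l u : ℝ}
    (h : IsGap (σ₀ a b γ) l u) :
    (∃ γ' > γ, ∃ β, IsNewBand (Ioo l u) (σ₁ a b γ γ') l β) ∧
    (∃ γ' > γ, ∃ α > l, ∃ β, IsNewBand (Ioo l u) (σ₁ a b γ γ') α β) ∧
    (∃ γ' > γ, ∃ α, ∃ β < u, IsNewBand (Ioo l u) (σ₁ a b γ γ') α β) ∧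
    (a = b → ∀ γ' > γ, ∀ α β, IsNewBand (Ioo l u) (σ₁ a b γ γ') α β → β < u) := by
  obtain ⟨hg, hu⟩ := belowGap_of_isGap ha hb hγ h
  have hpos := hg.maxBelow_edge_pos
  refine ⟨?_, ?_, ?_, ?_⟩
  · obtain ⟨γ', hγ', hd⟩ := exists_gt_sub_sq_eq γ hpos
    obtain ⟨α, β, h1, h2, -⟩ := hg.exists_isNewBand ha hb hu hγ'
    exact ⟨γ', hγ', β, h2 hd.le ▸ h1⟩
  · obtain ⟨γ', hγ', hd⟩ := exists_gt_sub_sq_eq γ (hpos.trans (lt_add_one _))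
    obtain ⟨α, β, h1, -, h2, -⟩ := hg.exists_isNewBand ha hb hu hγ'
    exact ⟨γ', hγ', α, h2 (by rw [hd]; exact lt_add_one _), β, h1⟩
  · obtain ⟨x, hx⟩ := exists_between hg.lt
    have h0 : 0 < minBelow a b γ x := by
      rw [← hg.minBelow_edge]
      exact (hg.mono ha hb).1 (left_mem_Ico.2 hg.lt) (Ioo_subset_Ico_self hx) hx.1
    obtain ⟨γ', hγ', hd⟩ := exists_gt_sub_sq_eq γ (half_pos h0)
    obtain ⟨α, β, h1, -, -, h2⟩ := hg.exists_isNewBand ha hb hu hγ'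
    exact ⟨γ', hγ', α, β, h2 ⟨x, hx, by rw [hd]; exact half_lt_self h0⟩, h1⟩
  · rintro rfl γ' hγ' α β hband
    by_contra hc
    rw [or_self] at hu
    have hα := max_lt h.lt (hband.lt.trans_le (by
      have := hband.subset (right_mem_Icc.2 hband.lt.le)
      rw [closure_Ioo h.lt.ne] at this
      exact this.2))
    -- For `a = b` the end `u` is a Dirichlet energy of the edges of length `a`. The minimum is
    -- unbounded there, so points close to `u` stay outside the perturbed spectrum.
    obtain ⟨E, hE1, hE2⟩ := (((hg.tendsto_minBelow ha hb hu).eventually_gt_atTop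
      ((γ' - γ) ^ 2)).and (Ioo_mem_nhdsLT hα)).exists
    have hEm : E ∈ Ioo l u := ⟨(le_max_left _ _).trans_lt hE2.1, hE2.2⟩
    have hmem : E ∈ Ioo l u ∩ σ₁ a a γ γ' := by
      rw [hband.inter_eq]
      exact ⟨hEm, ((le_max_right _ _).trans_lt hE2.1).le, hE2.2.le.trans (not_lt.1 hc)⟩
    exact hE1.not_ge ((hg.mem_σ₁_iff ha hb hEm).1 hmem.2).2.1

theorem repulsive_bounded_gap (ha : 0 < a) (hb : 0 < b) (hγ : 0 < γ) {l u : ℝ}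
    (h : IsGap (σ₀ a b γ) l u) :
    (∃ γ' < γ, ∃ α, IsNewBand (Ioo l u) (σ₁ a b γ γ') α u) ∧
    (∃ γ' < γ, ∃ α, ∃ β < u, IsNewBand (Ioo l u) (σ₁ a b γ γ') α β) ∧
    (∃ γ' < γ, ∃ α > l, ∃ β, IsNewBand (Ioo l u) (σ₁ a b γ γ') α β) ∧
    (a = b → ∀ γ' < γ, ∀ α β, IsNewBand (Ioo l u) (σ₁ a b γ γ') α β → l < α) := by
  obtain ⟨hg, hl⟩ := aboveGap_of_isGap ha hb hγ h
  have hpos := hg.maxAbove_edge_pos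
  refine ⟨?_, ?_, ?_, ?_⟩
  · obtain ⟨γ', hγ', hd⟩ := exists_lt_sub_sq_eq γ hpos
    obtain ⟨α, β, h1, h2, -⟩ := hg.exists_isNewBand ha hb hl hγ'
    exact ⟨γ', hγ', α, h2 hd.le ▸ h1⟩
  · obtain ⟨γ', hγ', hd⟩ := exists_lt_sub_sq_eq γ (hpos.trans (lt_add_one _))
    obtain ⟨α, β, h1, -, h2, -⟩ := hg.exists_isNewBand ha hb hl hγ'
    exact ⟨γ', hγ', α, β, h2 (by rw [hd]; exact lt_add_one _), h1⟩
  -- Half the minimum at an interior point `x` is a squared change too small to bind a state at `x`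
  -- or at any lower energy of the gap, so the band starts above `l`.
  · obtain ⟨x, hx⟩ := exists_between hg.lt
    have h0 : 0 < minAbove a b γ x := by
      rw [← hg.minAbove_edge]
      exact (hg.anti ha hb).1 (Ioo_subset_Ioc_self hx) (right_mem_Ioc.2 hg.lt) hx.2
    obtain ⟨γ', hγ', hd⟩ := exists_lt_sub_sq_eq γ (half_pos h0)
    obtain ⟨α, β, h1, -, -, h2⟩ := hg.exists_isNewBand ha hb hl hγ'
    exact ⟨γ', hγ', α, h2 ⟨x, hx, by rw [hd]; exact half_lt_self h0⟩, β, h1⟩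
  · rintro rfl γ' hγ' α β hband
    by_contra hc
    rw [or_self] at hl
    have hβ := lt_min h.lt (lt_of_le_of_lt (by
      have := hband.subset (left_mem_Icc.2 hband.lt.le)
      rw [closure_Ioo h.lt.ne] at this
      exact this.1) hband.lt)
    obtain ⟨E, hE1, hE2⟩ := (((hg.tendsto_minAbove ha hb hl).eventually_gt_atTop
      ((γ' - γ) ^ 2)).and (Ioo_mem_nhdsGT hβ)).exists
    have hEm : E ∈ Ioo l u := ⟨hE2.1, hE2.2.trans_le (min_le_left _ _)⟩
    have hmem : E ∈ Ioo l u ∩ σ₁ a a γ γ' := by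
      rw [hband.inter_eq]
      exact ⟨hEm, (not_lt.1 hc).trans hE2.1.le, (hE2.2.trans_le (min_le_right _ _)).le⟩
    exact hE1.not_ge ((hg.mem_σ₁_iff ha hb hEm).1 hmem.2).2.1

theorem bottom_band_contact (ha : 0 < a) (hb : 0 < b) (γ : ℝ) :
    (∃ γ' < γ, ∃ α, IsNewBand (Iio (sInf (σ₀ a b γ))) (σ₁ a b γ γ') α (sInf (σ₀ a b γ))) ∧
    (∃ γ' < γ, ∃ α, ∃ β < sInf (σ₀ a b γ),
      IsNewBand (Iio (sInf (σ₀ a b γ))) (σ₁ a b γ γ') α β) := by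
  have hpos := ((bottom_spec ha hb γ).2 (sInf (σ₀ a b γ) - 1) (by linarith)).maxAbove_edge_pos
  constructor
  · obtain ⟨γ', hγ', hd⟩ := exists_lt_sub_sq_eq γ hpos
    obtain ⟨α, β, h1, -, h2, -⟩ := exists_isNewBand_bottom ha hb hγ'
    have := h2 hd.le
    rw [this] at h1
    exact ⟨γ', hγ', α, h1⟩
  · obtain ⟨γ', hγ', hd⟩ := exists_lt_sub_sq_eq γ (hpos.trans (lt_add_one _))
    obtain ⟨α, β, h1, -, -, h2⟩ := exists_isNewBand_bottom ha hb hγ'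
    exact ⟨γ', hγ', α, β, h2 (by rw [hd]; exact lt_add_one _), h1⟩

end

end DeltaLattice

/-! ### The theorem -/

open DeltaLattice Set in
theorem theorem3p7 (a b : ℝ) (ha : 0 < a) (hb : 0 < b) :
    -- the infimum of the unperturbed spectrum is meaningful, its gaps are the semi-infinite one below
    -- the infimum and the bounded ones above it, and the perturbation removes nothing
    (∀ γ γ' : ℝ, BddBelow (σ₀ a b γ) ∧ ¬ BddAbove (σ₀ a b γ) ∧ IsClosed (σ₀ a b γ) ∧
      σ₀ a b γ ⊆ σ₁ a b γ γ') ∧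
    -- (i) nothing new above the infimum, a new negative band below it, which touches the old spectrum
    -- for some γ' and does not for others
    (∀ γ < 0,
      (∀ γ' < γ,
        (∀ l u, IsGap (σ₀ a b γ) l u → Disjoint (Ioo l u) (σ₁ a b γ γ')) ∧
        ∃ α β, IsNewBand (Iio (sInf (σ₀ a b γ))) (σ₁ a b γ γ') α β ∧ β < 0) ∧
      (∃ γ' < γ, ∃ α, IsNewBand (Iio (sInf (σ₀ a b γ))) (σ₁ a b γ γ') α (sInf (σ₀ a b γ))) ∧
      (∃ γ' < γ, ∃ α, ∃ β < sInf (σ₀ a b γ),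
        IsNewBand (Iio (sInf (σ₀ a b γ))) (σ₁ a b γ γ') α β)) ∧
    -- (ii) nothing new below the infimum, a new band in every gap above it; its contact with the
    -- edges; complete closure of a gap
    ((∀ γ < 0,
        (∀ γ' > γ,
          Disjoint (Iio (sInf (σ₀ a b γ))) (σ₁ a b γ γ') ∧
          ∀ l u, IsGap (σ₀ a b γ) l u → ∃ α β, IsNewBand (Ioo l u) (σ₁ a b γ γ') α β) ∧
        (∀ l u, IsGap (σ₀ a b γ) l u →
          (∃ γ' > γ, ∃ β, IsNewBand (Ioo l u) (σ₁ a b γ γ') l β) ∧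
          (∃ γ' > γ, ∃ α > l, ∃ β, IsNewBand (Ioo l u) (σ₁ a b γ γ') α β) ∧
          (∃ γ' > γ, ∃ α, ∃ β < u, IsNewBand (Ioo l u) (σ₁ a b γ γ') α β) ∧
          (a = b → ∀ γ' > γ, ∀ α β, IsNewBand (Ioo l u) (σ₁ a b γ γ') α β → β < u))) ∧
      ((∀ n : ℕ, a ≠ n * b) →
        ∃ γ < 0, ∃ γ' > γ, ∃ l u, IsGap (σ₀ a b γ) l u ∧ Ioo l u ⊆ σ₁ a b γ γ')) ∧
    -- (iii) a new band in every gap; its contact with the edges; complete closure of a gap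
    ((∀ γ > 0,
        (∀ γ' < γ,
          (∃ α β, IsNewBand (Iio (sInf (σ₀ a b γ))) (σ₁ a b γ γ') α β) ∧
          ∀ l u, IsGap (σ₀ a b γ) l u → ∃ α β, IsNewBand (Ioo l u) (σ₁ a b γ γ') α β) ∧
        (∃ γ' < γ, ∃ α, IsNewBand (Iio (sInf (σ₀ a b γ))) (σ₁ a b γ γ') α (sInf (σ₀ a b γ))) ∧
        (∃ γ' < γ, ∃ α, ∃ β < sInf (σ₀ a b γ),
          IsNewBand (Iio (sInf (σ₀ a b γ))) (σ₁ a b γ γ') α β) ∧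
        (∀ l u, IsGap (σ₀ a b γ) l u →
          (∃ γ' < γ, ∃ α, IsNewBand (Ioo l u) (σ₁ a b γ γ') α u) ∧
          (∃ γ' < γ, ∃ α, ∃ β < u, IsNewBand (Ioo l u) (σ₁ a b γ γ') α β) ∧
          (∃ γ' < γ, ∃ α > l, ∃ β, IsNewBand (Ioo l u) (σ₁ a b γ γ') α β) ∧
          (a = b → ∀ γ' < γ, ∀ α β, IsNewBand (Ioo l u) (σ₁ a b γ γ') α β → l < α))) ∧
      ((∀ n : ℕ, a ≠ n * b) →
        ∃ γ > 0, ∃ γ' < γ, ∃ l u, IsGap (σ₀ a b γ) l u ∧ Ioo l u ⊆ σ₁ a b γ γ')) ∧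
    -- (iv) nothing changes
    (∀ γ > 0, ∀ γ' > γ, σ₁ a b γ γ' = σ₀ a b γ) := by
  -- Below the bottom `γ` lies above the dispersion, where only a decrease of the coupling binds.
  have hbelow : ∀ γ γ', γ < γ' → Disjoint (Iio (sInf (σ₀ a b γ))) (σ₁ a b γ γ') := by
    intro γ γ' hγ'
    refine disjoint_left.2 fun E (hE : E < _) hmem => ?_
    have hg := (bottom_spec ha hb γ).2 (E - 1) (by linarith)
    exact hγ'.not_gt ((hg.mem_σ₁_iff ha hb ⟨by linarith, hE⟩).1 hmem).1
  refine ⟨fun γ γ' => ⟨⟨_, (bottom_spec ha hb γ).1.2⟩, not_bddAbove_σ₀ ha hb, isClosed_σ₀ ha hb,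
    σ₀_subset_σ₁ ha hb γ γ'⟩, fun γ hγ => ⟨fun γ' hγ' => ⟨fun l u h => ?_, ?_⟩,
    bottom_band_contact ha hb γ⟩, ⟨fun γ hγ => ⟨fun γ' hγ' => ⟨hbelow γ γ' hγ', fun l u h => ?_⟩,
    fun l u h => attractive_bounded_gap ha hb hγ h⟩, fun hab => ?_⟩,
    ⟨fun γ hγ => ⟨fun γ' hγ' => ⟨?_, fun l u h => ?_⟩, (bottom_band_contact ha hb γ).1,
    (bottom_band_contact ha hb γ).2, fun l u h => repulsive_bounded_gap ha hb hγ h⟩,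
    fun hab => ?_⟩, fun γ hγ γ' hγ' => ?_⟩
  · refine disjoint_left.2 fun E hE hmem => ?_
    exact hγ'.not_gt (((belowGap_of_isGap ha hb hγ h).1.mem_σ₁_iff ha hb hE).1 hmem).1
  · obtain ⟨α, β, h1, h2, -⟩ := exists_isNewBand_bottom ha hb hγ'
    exact ⟨α, β, h1, h2.trans_lt (sInf_σ₀_neg ha hb hγ)⟩
  · obtain ⟨hg, hu⟩ := belowGap_of_isGap ha hb hγ h
    obtain ⟨α, β, h1, -⟩ := hg.exists_isNewBand ha hb hu hγ'
    exact ⟨α, β, h1⟩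
  · obtain ⟨γ, hγ, l, u, hg, hu, d, hd, hmem⟩ := exists_closed_belowGap hab ha hb
    obtain ⟨γ', hγ', rfl⟩ := exists_gt_sub_sq_eq γ hd
    exact ⟨γ, hγ, γ', hγ', l, u, hg.isGap ha hb (.inr hu), fun E hE =>
      (hg.mem_σ₁_iff ha hb hE).2 ⟨hγ', hmem E hE⟩⟩
  · obtain ⟨α, β, h1, -⟩ := exists_isNewBand_bottom ha hb hγ'
    exact ⟨α, β, h1⟩
  · obtain ⟨hg, hl⟩ := aboveGap_of_isGap ha hb hγ h
    obtain ⟨α, β, h1, -⟩ := hg.exists_isNewBand ha hb hl hγ'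
    exact ⟨α, β, h1⟩
  · obtain ⟨γ, hγ, l, u, hg, hl, d, hd, hmem⟩ := exists_closed_aboveGap hab ha hb
    obtain ⟨γ', hγ', rfl⟩ := exists_lt_sub_sq_eq γ hd
    exact ⟨γ, hγ, γ', hγ', l, u, hg.isGap ha hb (.inr hl), fun E hE =>
      (hg.mem_σ₁_iff ha hb hE).2 ⟨hγ', hmem E hE⟩⟩
  · refine Subset.antisymm (fun E hE => ?_) (σ₀_subset_σ₁ ha hb γ γ')
    by_contra hc
    have hr := regular_of_notMem ha hb hc
    -- For `γ > 0` every point outside the spectrum lies on the side where binding requires `γ' <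
    -- γ`, since `lo` is negative.
    have hlt : 2 * up a E + 2 * up b E < γ := by
      by_contra h
      exact hc ((mem_σ₀_iff_of_regular ha hb hr).2
        ⟨by linarith [lo_neg ha hr.1, lo_neg hb hr.2], not_lt.1 h⟩)
    exact hγ'.not_gt ((mem_σ₁_iff_above ha hb hr hlt).1 hE).1
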